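/- Let $n\ge 1$ and let $\Omega\subset\mathbb R^n$ be a bounded domain with $C^\infty$ boundary. Let $\Delta=-\sum_i\partial_{x_i}^2$ be the positive Laplacian and $d_n$ the derivative along the inward unit normal on $\partial\Omega$. For $r\ge 0$ let $Y_r=\{x\in\overline\Omega:\operatorname{dist}(x,\partial\Omega)=r\}$, with the $L^2$ norm for its surface measure. Call $\delta>0$ a collar width of $\Omega$ if Fermi coordinates exist on the collar $\mathcal C_\delta=\{x\in\overline\Omega:\operatorname{dist}(x,\partial\Omega)\le\delta\}$, i.e. the function $\operatorname{dist}(\cdot,\partial\Omega)$ on $\mathcal C_\delta$ extends to a $C^\infty$ function on a neighbourhood of $\mathcal C_\delta$, every point of $\mathcal C_\delta$ has a unique nearest point on $\partial\Omega$, and for every $y\in\partial\Omega$ with inward unit normal $\nu(y)$ one has $y+r\nu(y)\in Y_r$ for all $r\in[0,\delta]$. Then $\Omega$ has a collar width, and for every collar width $\delta$ there is a constant $C>0$, depending only on $\Omega$ and $\delta$, with the following two properties. (1) Let $u\in C^2(\overline\Omega)$ be real-valued with $d_nu=0$ on $\partial\Omega$, and let $0<h\le1$ be such that $(h^2\Delta-1)u$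 has a weak gradient in $L^1_{\mathrm{loc}}(\Omega)$. Then for every $r\in[0,\delta/3]$ $$\|u\|_{L^2(Y_r)}^2\le C h^{-2/3}\Big(\|u\|_{L^2(\Omega)}^2+h^{-2}\|(h^2\Delta-1)u\|_{L^2(\Omega)}^2+\|\nabla(h^2\Delta-1)u\|_{L^2(\Omega)}^2\Big),$$ where the right-hand side is $+\infty$ if the weak gradient is not in $L^2(\Omega)$. (2) In particular, let $0<h\le 1$ and let $u\in C^2(\overline\Omega)$ be a real-valued Neumann eigenfunction with eigenvalue $h^{-2}$, i.e. $\Delta u=h^{-2}u$ in $\Omega$ and $d_nu=0$ on $\partial\Omega$, normalized by $\|u\|_{L^2(\Omega)}=1$. Then $$\|u|_{\partial\Omega}\|_{L^2(\partial\Omega)}\le C h^{-1/3}.$$ -/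

import Mathlib

open MeasureTheory Set
open scoped ContDiff ENNReal

namespace NeumannTrace

/-- `ℝⁿ` with its Euclidean norm. -/
abbrev Eucl (n : ℕ) : Type := EuclideanSpace ℝ (Fin n)

/-- `ρ`, defined on the open neighbourhood `U` of the boundary point `p`, is a smooth local
defining function of `Ω` at `p`: its differential does not vanish at `p`, and inside `U` the
set `Ω` is exactly `{ρ > 0}`. -/
structure IsLocalDefiningFunction {n : ℕ} (Ω : Set (Eucl n)) (p : Eucl n) (U : Set (Eucl n))
    (ρ : Eucl n → ℝ) : Prop where
  isOpen : IsOpen U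
  mem : p ∈ U
  contDiffOn : ContDiffOn ℝ ∞ ρ U
  gradient_ne_zero : gradient ρ p ≠ 0
  inter_eq : Ω ∩ U = {x ∈ U | 0 < ρ x}

/-- A smooth bounded domain in `ℝⁿ`: a bounded, connected, nonempty open set whose boundary is
locally the zero set of a smooth function with nonvanishing gradient, with `Ω` lying
on one side of it. -/
structure IsSmoothBoundedDomain {n : ℕ} (Ω : Set (Eucl n)) : Prop where
  isOpen : IsOpen Ω
  isConnected : IsConnected Ω
  isBounded : Bornology.IsBounded Ω
  smooth_boundary : ∀ p ∈ frontier Ω, ∃ (U : Set (Eucl n)) (ρ : Eucl n → ℝ),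
    IsLocalDefiningFunction Ω p U ρ

/-- `ν` is the inward unit normal vector of `Ω` at the boundary point `p`: the normalized gradient
of a local defining function which is positive inside `Ω`. -/
def IsInwardUnitNormal {n : ℕ} (Ω : Set (Eucl n)) (p ν : Eucl n) : Prop :=
  ∃ (U : Set (Eucl n)) (ρ : Eucl n → ℝ),
    IsLocalDefiningFunction Ω p U ρ ∧ ν = ‖gradient ρ p‖⁻¹ • gradient ρ p

/-- The distance to the boundary of `Ω`. -/
noncomputable def bdryDist {n : ℕ} (Ω : Set (Eucl n)) (x : Eucl n) : ℝ :=
  Metric.infDist x (frontier Ω)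

/-- The level set `Y_r` of points of `closure Ω` at distance `r` from the boundary. -/
def levelSet {n : ℕ} (Ω : Set (Eucl n)) (r : ℝ) : Set (Eucl n) :=
  {x ∈ closure Ω | bdryDist Ω x = r}

/-- The collar of width `δ`: the points of `closure Ω` at distance at most `δ` from the boundary. -/
def collar {n : ℕ} (Ω : Set (Eucl n)) (δ : ℝ) : Set (Eucl n) :=
  {x ∈ closure Ω | bdryDist Ω x ≤ δ}

/-- `δ > 0` is small enough for Fermi coordinates `(r, y)` on the collar of width `δ`:
the distance `r` to the boundary is smooth there, up to the edges of the collar,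
each point `x` of the collar has a unique nearest boundary point `y`, and
for every boundary point `y` the inward normal segment `r ↦ y + r ν(y)`, `0 ≤ r ≤ δ`, runs in
the collar, at distance `r` from the boundary.  -/
structure IsFermiCollarWidth {n : ℕ} (Ω : Set (Eucl n)) (δ : ℝ) : Prop where
  pos : 0 < δ
  smooth_dist : ∃ (U : Set (Eucl n)) (ρ : Eucl n → ℝ), IsOpen U ∧ collar Ω δ ⊆ U ∧
    ContDiffOn ℝ ∞ ρ U ∧ ∀ x ∈ collar Ω δ, ρ x = bdryDist Ω x
  unique_foot : ∀ x ∈ collar Ω δ, ∃! y, y ∈ frontier Ω ∧ dist x y = bdryDist Ω x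
  normal_segment : ∀ y ∈ frontier Ω, ∀ ν, IsInwardUnitNormal Ω y ν →
    ∀ r ∈ Icc 0 δ, y + r • ν ∈ levelSet Ω r

/-- The Neumann condition `d_n u = 0` on the boundary, for `u` differentiable up to the boundary.
The derivative at a boundary point is taken within `closure Ω`. -/
def NeumannCondition {n : ℕ} (Ω : Set (Eucl n)) (u : Eucl n → ℝ) : Prop :=
  ∀ p ∈ frontier Ω, ∀ ν, IsInwardUnitNormal Ω p ν → fderivWithin ℝ u (closure Ω) p ν = 0

/-- The positive Laplacian `-∑ ∂²/∂xᵢ²`. -/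
noncomputable def posLaplacian {n : ℕ} (u : Eucl n → ℝ) (x : Eucl n) : ℝ :=
  -(Laplacian.laplacian u x)

/-- `(h² Δ - 1) u`, with `Δ` the positive Laplacian. -/
noncomputable def helmholtz {n : ℕ} (h : ℝ) (u : Eucl n → ℝ) (x : Eucl n) : ℝ :=
  h ^ 2 * posLaplacian u x - u x

/-- `G` is the weak (distributional) gradient of `w` on the open set `Ω`. -/
structure HasWeakGradient {n : ℕ} (Ω : Set (Eucl n)) (w : Eucl n → ℝ)
    (G : Eucl n → Eucl n) : Prop where
  locallyIntegrableOn : LocallyIntegrableOn w Ω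
  gradient_locallyIntegrableOn : LocallyIntegrableOn G Ω
  integral_eq : ∀ φ : Eucl n → ℝ, ContDiff ℝ ∞ φ → HasCompactSupport φ → tsupport φ ⊆ Ω →
    ∀ v : Eucl n, ∫ x in Ω, w x * fderiv ℝ φ x v = -∫ x in Ω, inner ℝ (G x) v * φ x

/-- The `L²(Ω)` norm, as an extended nonnegative real. -/
noncomputable def l2Norm {n : ℕ} {F : Type*} [NormedAddCommGroup F] (Ω : Set (Eucl n))
    (f : Eucl n → F) : ℝ≥0∞ :=
  eLpNorm f 2 (volume.restrict Ω)

/-- The `L²(Y)` norm on a hypersurface `Y`, for its surface measure, which is the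
`(n - 1)`-dimensional Hausdorff measure normalized as in Euclidean geometry. -/
noncomputable def l2NormSurface {n : ℕ} (Y : Set (Eucl n)) (f : Eucl n → ℝ) : ℝ≥0∞ :=
  eLpNorm f 2 ((Measure.euclideanHausdorffMeasure (n - 1)).restrict Y)

/-- `u` is an `L²`-normalized Neumann eigenfunction of the positive Laplacian on `Ω`, with
eigenvalue `E`. -/
structure IsNormalizedNeumannEigenfunction {n : ℕ} (Ω : Set (Eucl n)) (E : ℝ)
    (u : Eucl n → ℝ) : Prop where
  contDiffOn : ContDiffOn ℝ 2 u (closure Ω)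
  neumann : NeumannCondition Ω u
  eigen : ∀ x ∈ Ω, posLaplacian u x = E * u x
  normalized : l2Norm Ω u = 1

end NeumannTrace

/-! Write `D` for the distance to the boundary (flattened away from the collar), `f` for `(h² Δ - 1)
u` and `R` for the integral over `Ω` of `u² + h⁻² f²`. Formally the theorem is a one-dimensional
statement about `F(r) = ∫ u²` over `Y_r`: up to curvature terms, `F''` is twice the integral of
`(∂_r u)² + u ∂_r² u`. By the equation, `F''` equals a nonnegative square of the normal derivative
minus `2 h⁻²` times a normal energy, the integral over `Y_r` of `2 h² (∂_r u)² + u² - h² |∇u|²`. So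
`F` is almost convex, and a large value of `F` at one `r` forces a large mass nearby unless the
normal energy concentrates.

It does not. The Rellich identity for the field `a(D) ∇D` with `a(0) = 0` has the normal energy
multiplied by `a'` as its leading term. Taking `a` to be a primitive of `φ` bounds the integral of
`φ(D)` times the normal energy by `R` times a bound `A` for the primitive of `φ`
(`exists_integral_normalEnergy_le`). Green's formula for `u²` and `φ(D)`, with the square of the
normal derivative discarded, turns this into an upper bound for `-∫ u² φ''(D)` of order `(sup |φ'| +
h⁻² A + h⁻¹ sup φ) R` (`exists_integral_second_variation_le`).

The test function `φ` is a tent of height and width `L`, with its downward kink at `r` smoothed at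
scale `ε` (`exists_test_function`). Then `-φ''` is about `1/ε` on the shell `r < D < r + ε` and at
least `-C/L` elsewhere, while `A` is of order `L²`. The average of `u²` over the shell is therefore
at most a constant times `(1 + h⁻² L² + h⁻¹ L + 1/L) R`, and `L` of order `h^(2/3)` gives `h^(-2/3)
R` uniformly in `ε` (`exists_integral_shell_le`).

Surface integrals are recovered as `ε → 0` by a Vitali covering argument that bounds Hausdorff
measure by volumes of shells (`lintegral_levelSet_le`), so neither the area formula nor a boundary
trace is needed. All integrations by parts rest on a divergence theorem for fields tangent to the
boundary in the limit (`integral_div_eq_zero`), proved with cutoffs. Collar widths come from the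
inverse function theorem and a Lebesgue number (`exists_isFermiCollarWidth`). The estimate obtained
has no gradient of `f` on the right; that term only enlarges the bound. -/

namespace NeumannTrace
open Filter Topology

/-! ### Normals, nearest boundary points and the distance to the boundary -/

section Geometry
variable {n : ℕ} {Ω : Set (Eucl n)} {p : Eucl n} {U : Set (Eucl n)} {ρ : Eucl n → ℝ}

lemma eventually_pos_of_hasFDerivAt {f : Eucl n → ℝ} {f' : Eucl n →L[ℝ] ℝ} {p v : Eucl n}
    (hf : HasFDerivAt f f' p) (h0 : f p = 0) (hv : 0 < f' v) :
    ∀ᶠ t in 𝓝[>] (0 : ℝ), 0 < f (p + t • v) := by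
  have h1 : HasDerivAt (fun t : ℝ => f (p + t • v)) (f' v) 0 := by
    have h2 : HasDerivAt (fun t : ℝ => p + t • v) v 0 := by
      simpa using ((hasDerivAt_id (0 : ℝ)).smul_const v).const_add p
    have h3 : HasFDerivAt f f' (p + (0 : ℝ) • v) := by simpa using hf
    exact h3.comp_hasDerivAt 0 h2
  have h4 := (hasDerivWithinAt_iff_tendsto_slope' (self_notMem_Ioi)).1
    (h1.hasDerivWithinAt (s := Ioi 0))
  filter_upwards [h4.eventually (lt_mem_nhds hv), self_mem_nhdsWithin] with t ht ht0
  simp only [slope, vsub_eq_sub, sub_zero, zero_smul, add_zero, h0, smul_eq_mul] at ht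
  exact pos_of_mul_pos_right ht (inv_nonneg.2 (le_of_lt ht0))

/-- A half-space determines its normal ray. If `w` had a component `z ≠ 0` orthogonal to `g`, then
`s • g - z` with small `s > 0` would lie in the half-space of `g` but pair negatively with `w`. -/
lemma eq_smul_of_inner_nonneg {g w : Eucl n} (hg : g ≠ 0)
    (H : ∀ v : Eucl n, 0 < inner ℝ g v → 0 ≤ inner ℝ w v) : ∃ c : ℝ, 0 ≤ c ∧ w = c • g := by
  have hg2 : 0 < inner ℝ g g := by
    rw [real_inner_self_eq_norm_sq]; positivity
  set c : ℝ := inner ℝ w g / inner ℝ g g with hc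
  set z := w - c • g with hz
  have hwg : inner ℝ w g = c * inner ℝ g g := by rw [hc]; field_simp
  have hgz : inner ℝ g z = 0 := by
    rw [hz, inner_sub_right, inner_smul_right, real_inner_comm, hwg]; ring
  have hc0 : 0 ≤ c := div_nonneg (H g hg2) hg2.le
  refine ⟨c, hc0, ?_⟩
  have hwz : inner ℝ w z = inner ℝ z z := by
    have : w = z + c • g := by rw [hz]; abel
    rw [this, inner_add_left, inner_smul_left, hgz]; simp
  have hzz : inner ℝ z z ≤ 0 := by
    by_contra hcon
    push Not at hcon
    -- Small enough that `s * inner w g` stays below `inner z z`; the `+ 1` keeps the denominator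
    -- positive when `inner w g = 0`.
    set s : ℝ := inner ℝ z z / (2 * (inner ℝ w g + 1)) with hs
    have hwg0 : 0 ≤ inner ℝ w g := H g hg2
    have hs0 : 0 < s := by positivity
    have h1 : 0 < inner ℝ g (s • g - z) := by
      rw [inner_sub_right, inner_smul_right, hgz]; simpa using mul_pos hs0 hg2
    have h2 := H _ h1
    rw [inner_sub_right, inner_smul_right, hwz] at h2
    have h3 : s * (inner ℝ w g + 1) = inner ℝ z z / 2 := by rw [hs]; field_simp
    nlinarith
  have : z = 0 := inner_self_eq_zero.1 (le_antisymm hzz real_inner_self_nonneg)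
  rw [hz, sub_eq_zero] at this
  exact this

namespace IsLocalDefiningFunction

lemma differentiableAt (hL : IsLocalDefiningFunction Ω p U ρ) {x : Eucl n} (hx : x ∈ U) :
    DifferentiableAt ℝ ρ x :=
  ((hL.contDiffOn.contDiffAt (hL.isOpen.mem_nhds hx)).differentiableAt (by simp))

lemma hasFDerivAt (hL : IsLocalDefiningFunction Ω p U ρ) {x : Eucl n} (hx : x ∈ U) :
    HasFDerivAt ρ (innerSL ℝ (gradient ρ x)) x := by
  have := (hL.differentiableAt hx).hasGradientAt.hasFDerivAt
  exact this

lemma mem_iff (hL : IsLocalDefiningFunction Ω p U ρ) {x : Eucl n} (hx : x ∈ U) :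
    x ∈ Ω ↔ 0 < ρ x := by
  have := hL.inter_eq
  constructor
  · intro h
    have h1 : x ∈ Ω ∩ U := ⟨h, hx⟩
    rw [this] at h1; exact h1.2
  · intro h
    have h1 : x ∈ {x ∈ U | 0 < ρ x} := ⟨hx, h⟩
    rw [← this] at h1; exact h1.1

lemma eq_zero (hL : IsLocalDefiningFunction Ω p U ρ) (ho : IsOpen Ω) {x : Eucl n} (hx : x ∈ U)
    (hf : x ∈ frontier Ω) : ρ x = 0 := by
  rw [ho.frontier_eq] at hf
  apply le_antisymm
  · by_contra! h
    exact hf.2 ((hL.mem_iff hx).2 h)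
  · by_contra! h
    have h1 : ∀ᶠ y in 𝓝 x, ρ y < 0 ∧ y ∈ U :=
      ((hL.differentiableAt hx).continuousAt.eventually (gt_mem_nhds h)).and (hL.isOpen.mem_nhds hx)
    obtain ⟨y, hy, hyΩ⟩ := mem_closure_iff_nhds.1 hf.1 _ h1
    exact absurd ((hL.mem_iff hy.2).1 hyΩ) (not_lt.2 hy.1.le)

lemma eventually_mem (hL : IsLocalDefiningFunction Ω p U ρ) (ho : IsOpen Ω)
    (hp : p ∈ frontier Ω) {v : Eucl n} (hv : 0 < inner ℝ (gradient ρ p) v) :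
    ∀ᶠ t in 𝓝[>] (0 : ℝ), p + t • v ∈ Ω := by
  have h1 := eventually_pos_of_hasFDerivAt (hL.hasFDerivAt hL.mem) (hL.eq_zero ho hL.mem hp) hv
  have h2 : ∀ᶠ t in 𝓝[>] (0 : ℝ), p + t • v ∈ U := by
    apply nhdsWithin_le_nhds
    have : Tendsto (fun t : ℝ => p + t • v) (𝓝 0) (𝓝 p) := by
      have : Continuous (fun t : ℝ => p + t • v) := by fun_prop
      simpa using this.tendsto 0
    exact this (hL.isOpen.mem_nhds hL.mem)
  filter_upwards [h1, h2] with t ht1 ht2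
  exact (hL.mem_iff ht2).2 ht1

/-- If small steps from `p` in the direction `v` stay in `Ω`, then `v` does not point outwards. -/
lemma inner_nonneg (hL : IsLocalDefiningFunction Ω p U ρ) (ho : IsOpen Ω)
    (hp : p ∈ frontier Ω) {v : Eucl n} (hv : ∀ᶠ t in 𝓝[>] (0 : ℝ), p + t • v ∈ Ω) :
    0 ≤ inner ℝ (gradient ρ p) v := by
  by_contra! hcon
  have h1 := eventually_pos_of_hasFDerivAt (hL.hasFDerivAt hL.mem).neg
    (v := v) (by simp [hL.eq_zero ho hL.mem hp]) (by simpa using hcon)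
  have h2 : ∀ᶠ t in 𝓝[>] (0 : ℝ), p + t • v ∈ U := by
    apply nhdsWithin_le_nhds
    have : Tendsto (fun t : ℝ => p + t • v) (𝓝 0) (𝓝 p) := by
      have : Continuous (fun t : ℝ => p + t • v) := by fun_prop
      simpa using this.tendsto 0
    exact this (hL.isOpen.mem_nhds hL.mem)
  obtain ⟨t, ht⟩ := (h1.and (h2.and hv)).exists
  have := (hL.mem_iff ht.2.1).1 ht.2.2
  simp at ht
  linarith [ht.1]

/-- If small steps from `p` in the direction `v` avoid `Ω`, then `v` does not point inwards. -/
lemma inner_nonpos (hL : IsLocalDefiningFunction Ω p U ρ) (ho : IsOpen Ω)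
    (hp : p ∈ frontier Ω) {v : Eucl n} (hv : ∀ᶠ t in 𝓝[>] (0 : ℝ), p + t • v ∉ Ω) :
    inner ℝ (gradient ρ p) v ≤ 0 := by
  by_contra! hcon
  obtain ⟨t, ht⟩ := ((hL.eventually_mem ho hp hcon).and hv).exists
  exact ht.2 ht.1

end IsLocalDefiningFunction

lemma inv_norm_smul_eq {c : ℝ} {g w : Eucl n} (hc : 0 ≤ c) (hw : w ≠ 0) (h : w = c • g) :
    ‖w‖⁻¹ • w = ‖g‖⁻¹ • g := by
  have hc' : c ≠ 0 := by rintro rfl; simp at h; exact hw h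
  rw [h, norm_smul, smul_smul, Real.norm_of_nonneg hc]
  congr 1
  field_simp

/-- Directions strictly inward for one defining function enter `Ω`, hence are not outward for the
other. By the half-space criterion the two gradients are positively proportional. -/
lemma IsInwardUnitNormal.unique (ho : IsOpen Ω) (hp : p ∈ frontier Ω) {ν ν' : Eucl n}
    (h : IsInwardUnitNormal Ω p ν) (h' : IsInwardUnitNormal Ω p ν') : ν = ν' := by
  obtain ⟨U, ρ, hL, rfl⟩ := h
  obtain ⟨U', ρ', hL', rfl⟩ := h'
  obtain ⟨c, hc, h⟩ := eq_smul_of_inner_nonneg (w := gradient ρ p) hL'.gradient_ne_zero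
    (fun v hv => hL.inner_nonneg ho hp (hL'.eventually_mem ho hp hv))
  exact inv_norm_smul_eq hc hL.gradient_ne_zero h

lemma IsInwardUnitNormal.norm_eq_one {ν : Eucl n} (h : IsInwardUnitNormal Ω p ν) : ‖ν‖ = 1 := by
  obtain ⟨U, ρ, hL, rfl⟩ := h
  have := hL.gradient_ne_zero
  rw [norm_smul, norm_inv, norm_norm, inv_mul_cancel₀ (norm_ne_zero_iff.2 this)]

namespace IsSmoothBoundedDomain

lemma isCompact_closure (hΩ : IsSmoothBoundedDomain Ω) : IsCompact (closure Ω) :=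
  hΩ.isBounded.isCompact_closure

lemma isCompact_frontier (hΩ : IsSmoothBoundedDomain Ω) : IsCompact (frontier Ω) :=
  hΩ.isCompact_closure.of_isClosed_subset isClosed_frontier frontier_subset_closure

lemma frontier_nonempty (hΩ : IsSmoothBoundedDomain Ω) (hn : 1 ≤ n) : (frontier Ω).Nonempty := by
  rw [nonempty_frontier_iff]
  refine ⟨hΩ.isConnected.nonempty, fun h => ?_⟩
  have : Nontrivial (Eucl n) := by
    have : Nonempty (Fin n) := ⟨⟨0, hn⟩⟩
    infer_instance
  have h1 := hΩ.isBounded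
  rw [h] at h1
  exact NormedSpace.unbounded_univ ℝ (Eucl n) h1

lemma exists_normal (hΩ : IsSmoothBoundedDomain Ω) (hp : p ∈ frontier Ω) :
    ∃ ν, IsInwardUnitNormal Ω p ν := by
  obtain ⟨U, ρ, h⟩ := hΩ.smooth_boundary p hp
  exact ⟨_, U, ρ, h, rfl⟩

/-- At a boundary point the tangent cone contains the open half-space of inward directions. This
spans, since any `v` is the difference of `v + s • g` and `s • g`, both inward for large `s`. It
makes `fderivWithin` on the closure continuous for functions smooth up to the boundary. -/
lemma uniqueDiffOn_closure (hΩ : IsSmoothBoundedDomain Ω) : UniqueDiffOn ℝ (closure Ω) := by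
  intro x hx
  by_cases hxΩ : x ∈ Ω
  · exact (hΩ.isOpen.uniqueDiffWithinAt hxΩ).mono subset_closure
  have hp : x ∈ frontier Ω := by rw [hΩ.isOpen.frontier_eq]; exact ⟨hx, hxΩ⟩
  obtain ⟨U, ρ, hL⟩ := hΩ.smooth_boundary x hp
  refine ⟨?_, subset_closure hx⟩
  have hsub : {v : Eucl n | 0 < inner ℝ (gradient ρ x) v} ⊆ tangentConeAt ℝ (closure Ω) x := by
    intro v hv
    have := hL.eventually_mem hΩ.isOpen hp hv
    apply mem_tangentConeAt_of_add_smul_mem (α := ℝ) (l := 𝓝[>] (0 : ℝ)) (c := fun t => t)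
    · exact tendsto_id.mono_right (nhdsWithin_mono _ (fun t ht => ne_of_gt ht))
    · filter_upwards [this] with t ht using subset_closure ht
  have htop : Submodule.span ℝ (tangentConeAt ℝ (closure Ω) x) = ⊤ := by
    rw [eq_top_iff]
    intro v _
    set g := gradient ρ x with hg
    have hg2 : 0 < inner ℝ g g := by
      rw [real_inner_self_eq_norm_sq]
      have := hL.gradient_ne_zero
      positivity
    have hgm : g ∈ Submodule.span ℝ (tangentConeAt ℝ (closure Ω) x) :=
      Submodule.subset_span (hsub hg2)
    set s : ℝ := (|inner ℝ g v| + 1) / inner ℝ g g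
    have h1 : v + s • g ∈ Submodule.span ℝ (tangentConeAt ℝ (closure Ω) x) := by
      apply Submodule.subset_span
      apply hsub
      show 0 < inner ℝ g (v + s • g)
      rw [inner_add_right, inner_smul_right]
      have : s * inner ℝ g g = |inner ℝ g v| + 1 := by simp only [s]; field_simp
      rw [this]
      linarith [neg_abs_le (inner ℝ g v)]
    have := Submodule.sub_mem _ h1 (Submodule.smul_mem _ s hgm)
    simpa using this
  rw [htop]
  exact dense_univ

end IsSmoothBoundedDomain

lemma bdryDist_nonneg (x : Eucl n) : 0 ≤ bdryDist Ω x := Metric.infDist_nonneg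

lemma abs_bdryDist_sub_le (x y : Eucl n) : |bdryDist Ω x - bdryDist Ω y| ≤ dist x y := by
  have := (Metric.lipschitz_infDist_pt (frontier Ω)).dist_le_mul x y
  simpa [Real.dist_eq, bdryDist] using this

lemma continuous_bdryDist : Continuous (bdryDist Ω) := Metric.continuous_infDist_pt _

lemma inter_frontier_nonempty {s : Set (Eucl n)} (hs : IsPreconnected s)
    (h1 : (s ∩ Ω).Nonempty) (h2 : (s ∩ Ωᶜ).Nonempty) : (s ∩ frontier Ω).Nonempty := by
  by_contra! hcon
  have hcon' : ∀ x ∈ s, x ∉ frontier Ω := fun x hx hf => by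
    have : x ∈ s ∩ frontier Ω := ⟨hx, hf⟩
    rw [hcon] at this; exact this
  have key : ∀ x ∈ s, x ∈ interior Ω ∨ x ∉ closure Ω := fun x hx => by
    by_contra! h
    exact hcon' x hx ⟨h.2, h.1⟩
  obtain ⟨x, hx, hxΩ⟩ := h1
  obtain ⟨z, hz, hzΩ⟩ := h2
  obtain ⟨w, _, hw1, hw2⟩ := hs _ _ isOpen_interior isClosed_closure.isOpen_compl key
    ⟨x, hx, (key x hx).resolve_right (fun h => h (subset_closure hxΩ))⟩
    ⟨z, hz, (key z hz).resolve_left (fun h => hzΩ (interior_subset h))⟩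
  exact hw2 (subset_closure (interior_subset hw1))

lemma ball_subset_of_mem {x : Eucl n} (hx : x ∈ Ω) : Metric.ball x (bdryDist Ω x) ⊆ Ω := by
  by_contra hcon
  obtain ⟨z, hz, hzΩ⟩ := not_subset.1 hcon
  have hx0 : x ∈ Metric.ball x (bdryDist Ω x) :=
    Metric.mem_ball_self (lt_of_le_of_lt dist_nonneg hz)
  have hpc : IsPreconnected (Metric.ball x (bdryDist Ω x)) := (convex_ball _ _).isPreconnected
  obtain ⟨y, hy, hyf⟩ := inter_frontier_nonempty hpc ⟨x, hx0, hx⟩ ⟨z, hz, hzΩ⟩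
  have h1 := Metric.infDist_le_dist_of_mem (x := x) hyf
  rw [Metric.mem_ball'] at hy
  unfold bdryDist at hy
  linarith

lemma disjoint_ball_of_notMem {x : Eucl n} (hx : x ∉ Ω) {z : Eucl n}
    (hz : z ∈ Metric.ball x (bdryDist Ω x)) : z ∉ Ω := by
  intro hzΩ
  have hx0 : x ∈ Metric.ball x (bdryDist Ω x) :=
    Metric.mem_ball_self (lt_of_le_of_lt dist_nonneg hz)
  have hpc : IsPreconnected (Metric.ball x (bdryDist Ω x)) := (convex_ball _ _).isPreconnected
  obtain ⟨y, hy, hyf⟩ := inter_frontier_nonempty hpc ⟨z, hz, hzΩ⟩ ⟨x, hx0, hx⟩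
  have h1 := Metric.infDist_le_dist_of_mem (x := x) hyf
  rw [Metric.mem_ball'] at hy
  unfold bdryDist at hy
  linarith

lemma bdryDist_pos_of_mem (hΩ : IsSmoothBoundedDomain Ω) (hn : 1 ≤ n) {x : Eucl n} (hx : x ∈ Ω) :
    0 < bdryDist Ω x := by
  unfold bdryDist
  rw [← isClosed_frontier.notMem_iff_infDist_pos (hΩ.frontier_nonempty hn)]
  rw [hΩ.isOpen.frontier_eq]
  exact fun h => h.2 hx

lemma bdryDist_eq_zero_of_mem_frontier {x : Eucl n} (hx : x ∈ frontier Ω) : bdryDist Ω x = 0 :=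
  Metric.infDist_zero_of_mem hx

lemma mem_frontier_of_bdryDist_eq_zero (hΩ : IsSmoothBoundedDomain Ω) (hn : 1 ≤ n) {x : Eucl n}
    (hx : bdryDist Ω x = 0) : x ∈ frontier Ω :=
  (isClosed_frontier.mem_iff_infDist_zero (hΩ.frontier_nonempty hn)).2 hx

lemma exists_foot (hΩ : IsSmoothBoundedDomain Ω) (hn : 1 ≤ n) (x : Eucl n) :
    ∃ y ∈ frontier Ω, dist x y = bdryDist Ω x := by
  obtain ⟨y, hy, h⟩ := hΩ.isCompact_frontier.exists_infDist_eq_dist (hΩ.frontier_nonempty hn) x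
  exact ⟨y, hy, h.symm⟩

lemma eventually_mem_ball {x y : Eucl n} {v : Eucl n}
    (hv : 0 < inner ℝ (x - y) v) :
    ∀ᶠ t in 𝓝[>] (0 : ℝ), y + t • v ∈ Metric.ball x (dist x y) := by
  have hv0 : v ≠ 0 := by rintro rfl; simp at hv
  have h1 : 0 < 2 * inner ℝ (x - y) v / ‖v‖ ^ 2 := by positivity
  filter_upwards [Ioo_mem_nhdsGT h1] with t ht
  rw [Metric.mem_ball', dist_eq_norm, dist_eq_norm]
  have h2 : x - (y + t • v) = (x - y) - t • v := by abel
  rw [h2]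
  apply lt_of_pow_lt_pow_left₀ 2 (norm_nonneg _)
  rw [norm_sub_sq_real, inner_smul_right, norm_smul, mul_pow, Real.norm_eq_abs, sq_abs]
  have h3 : t * ‖v‖ ^ 2 < 2 * inner ℝ (x - y) v := by
    rw [← lt_div_iff₀ (by positivity)]; exact ht.2
  nlinarith [ht.1]

/-- The ball about `x` of radius the distance to the boundary lies in `Ω` and touches the boundary
at `y`. Directions from `y` into that ball are then not outward, which forces the gradient at `y` to
be a multiple of `x - y`. -/
lemma normal_eq_of_foot_of_mem (hΩ : IsSmoothBoundedDomain Ω) {x y ν : Eucl n} (hx : x ∈ Ω)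
    (hy : y ∈ frontier Ω) (hxy : dist x y = bdryDist Ω x) (hν : IsInwardUnitNormal Ω y ν) :
    x = y + bdryDist Ω x • ν := by
  obtain ⟨U, ρ, hL, rfl⟩ := hν
  have hne : x ≠ y := by
    rintro rfl
    rw [hΩ.isOpen.frontier_eq] at hy
    exact hy.2 hx
  obtain ⟨c, hc, h⟩ := eq_smul_of_inner_nonneg (w := gradient ρ y) (sub_ne_zero.2 hne)
    (fun v hv => hL.inner_nonneg hΩ.isOpen hy (by
      filter_upwards [eventually_mem_ball hv] with t ht
      rw [hxy] at ht
      exact ball_subset_of_mem hx ht))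
  rw [inv_norm_smul_eq hc hL.gradient_ne_zero h, ← hxy, dist_eq_norm, smul_smul,
    mul_inv_cancel₀ (norm_ne_zero_iff.2 (sub_ne_zero.2 hne))]
  simp

lemma normal_eq_of_foot_of_notMem (hΩ : IsSmoothBoundedDomain Ω) {x y ν : Eucl n}
    (hx : x ∉ Ω) (hy : y ∈ frontier Ω) (hxy : dist x y = bdryDist Ω x)
    (hν : IsInwardUnitNormal Ω y ν) : x = y - bdryDist Ω x • ν := by
  obtain ⟨U, ρ, hL, rfl⟩ := hν
  by_cases hne : x = y
  · rw [← hxy, hne]; simp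
  obtain ⟨c, hc, h⟩ := eq_smul_of_inner_nonneg (w := -gradient ρ y) (sub_ne_zero.2 hne)
    (fun v hv => by
      have := hL.inner_nonpos hΩ.isOpen hy (v := v) (by
        filter_upwards [eventually_mem_ball hv] with t ht
        rw [hxy] at ht
        exact disjoint_ball_of_notMem hx ht)
      rw [inner_neg_left]; linarith)
  have h2 := inv_norm_smul_eq hc (neg_ne_zero.2 hL.gradient_ne_zero) h
  rw [norm_neg, smul_neg] at h2
  rw [eq_comm, ← neg_eq_iff_eq_neg] at h2
  rw [← h2, smul_neg, sub_neg_eq_add, ← hxy, dist_eq_norm, smul_smul,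
    mul_inv_cancel₀ (norm_ne_zero_iff.2 (sub_ne_zero.2 hne))]
  simp

end Geometry

/-! ### Existence of a collar width -/

section Collar
variable {n : ℕ} {Ω : Set (Eucl n)} {p : Eucl n} {U : Set (Eucl n)} {ρ : Eucl n → ℝ}

/-- The distance to the boundary, counted negatively outside of `Ω`. -/
noncomputable def signedDist (Ω : Set (Eucl n)) (x : Eucl n) : ℝ :=
  open Classical in if x ∈ Ω then bdryDist Ω x else -bdryDist Ω x

lemma signedDist_of_mem_closure (ho : IsOpen Ω) {x : Eucl n} (hx : x ∈ closure Ω) :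
    signedDist Ω x = bdryDist Ω x := by
  unfold signedDist
  split_ifs with h
  · rfl
  · rw [bdryDist_eq_zero_of_mem_frontier (by rw [ho.frontier_eq]; exact ⟨hx, h⟩)]; simp

lemma abs_signedDist (x : Eucl n) : |signedDist Ω x| = bdryDist Ω x := by
  unfold signedDist
  split_ifs with h <;> simp [abs_of_nonneg (bdryDist_nonneg x)]

lemma eq_add_signedDist_smul (hΩ : IsSmoothBoundedDomain Ω) {x y ν : Eucl n}
    (hy : y ∈ frontier Ω) (hxy : dist x y = bdryDist Ω x) (hν : IsInwardUnitNormal Ω y ν) :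
    x = y + signedDist Ω x • ν := by
  unfold signedDist
  split_ifs with h
  · exact normal_eq_of_foot_of_mem hΩ h hy hxy hν
  · rw [neg_smul, ← sub_eq_add_neg]; exact normal_eq_of_foot_of_notMem hΩ h hy hxy hν

lemma contDiffOn_gradient (hU : IsOpen U) (hρ : ContDiffOn ℝ ∞ ρ U) :
    ContDiffOn ℝ ∞ (gradient ρ) U := by
  have h1 : ContDiffOn ℝ ∞ (fderiv ℝ ρ) U := hρ.fderiv_of_isOpen hU (by simp)
  exact (InnerProductSpace.toDual ℝ (Eucl n)).symm.contDiff.comp_contDiffOn h1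

/-- The map `(y, t) ↦ (y + t N(y), ρ(y))` straightening the boundary, where `N` is the normalized
gradient of `ρ`. -/
noncomputable def normalChart (ρ : Eucl n → ℝ) (q : Eucl n × ℝ) : Eucl n × ℝ :=
  (q.1 + q.2 • (‖gradient ρ q.1‖⁻¹ • gradient ρ q.1), ρ q.1)

lemma IsLocalDefiningFunction.exists_radius (hL : IsLocalDefiningFunction Ω p U ρ) :
    ∃ r > 0, ∀ y ∈ Metric.ball p r, y ∈ U ∧ gradient ρ y ≠ 0 := by
  have hc : ContinuousAt (gradient ρ) p :=
    ((contDiffOn_gradient hL.isOpen hL.contDiffOn).contDiffAt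
      (hL.isOpen.mem_nhds hL.mem)).continuousAt
  have h1 := (hc.eventually_ne hL.gradient_ne_zero).and (hL.isOpen.mem_nhds hL.mem)
  obtain ⟨r, hr, h⟩ := Metric.eventually_nhds_iff_ball.1 h1
  exact ⟨r, hr, fun y hy => ⟨(h y hy).2, (h y hy).1⟩⟩

lemma IsLocalDefiningFunction.at_point (hL : IsLocalDefiningFunction Ω p U ρ) {y : Eucl n}
    (hy : y ∈ U) (hg : gradient ρ y ≠ 0) : IsLocalDefiningFunction Ω y U ρ :=
  ⟨hL.isOpen, hy, hL.contDiffOn, hg, hL.inter_eq⟩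

lemma IsLocalDefiningFunction.contDiffAt_unitGradient (hL : IsLocalDefiningFunction Ω p U ρ)
    {y : Eucl n} (hy : y ∈ U) (hg : gradient ρ y ≠ 0) :
    ContDiffAt ℝ ∞ (fun y => ‖gradient ρ y‖⁻¹ • gradient ρ y) y := by
  have h1 := (contDiffOn_gradient hL.isOpen hL.contDiffOn).contDiffAt (hL.isOpen.mem_nhds hy)
  exact ((h1.norm ℝ hg).inv (norm_ne_zero_iff.2 hg)).smul h1

lemma IsLocalDefiningFunction.contDiffAt_normalChart (hL : IsLocalDefiningFunction Ω p U ρ)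
    {q : Eucl n × ℝ} (hy : q.1 ∈ U) (hg : gradient ρ q.1 ≠ 0) :
    ContDiffAt ℝ ∞ (normalChart ρ) q := by
  have h1 : ContDiffAt ℝ ∞ (fun q : Eucl n × ℝ => ‖gradient ρ q.1‖⁻¹ • gradient ρ q.1) q :=
    (hL.contDiffAt_unitGradient hy hg).comp q contDiffAt_fst
  have h2 : ContDiffAt ℝ ∞ (fun q : Eucl n × ℝ => ρ q.1) q :=
    (hL.contDiffOn.contDiffAt (hL.isOpen.mem_nhds hy)).comp q contDiffAt_fst
  exact (contDiffAt_fst.add (contDiffAt_snd.smul h1)).prodMk h2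

/-- At `t = 0` the derivative of `N` drops out, leaving `(v, s) ↦ (v + s N, ⟨g, v⟩)`. On its kernel
`v = -s N` and then `s ‖g‖ = 0`, so it is injective and hence invertible. -/
lemma IsLocalDefiningFunction.exists_equiv_hasFDerivAt (hL : IsLocalDefiningFunction Ω p U ρ) :
    ∃ e : (Eucl n × ℝ) ≃L[ℝ] (Eucl n × ℝ),
      HasFDerivAt (normalChart ρ) (e : (Eucl n × ℝ) →L[ℝ] (Eucl n × ℝ)) (p, 0) := by
  set g := gradient ρ p with hg
  have hg0 : g ≠ 0 := hL.gradient_ne_zero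
  obtain ⟨N', hN'⟩ := (hL.contDiffAt_unitGradient hL.mem hL.gradient_ne_zero).differentiableAt
    (by simp)
  have h1 : HasFDerivAt (fun q : Eucl n × ℝ => ‖gradient ρ q.1‖⁻¹ • gradient ρ q.1)
      (N'.comp (ContinuousLinearMap.fst ℝ (Eucl n) ℝ)) (p, 0) :=
    HasFDerivAt.comp (p, (0 : ℝ)) (f := Prod.fst) hN' hasFDerivAt_fst
  have h2 : HasFDerivAt (fun q : Eucl n × ℝ => ρ q.1)
      ((innerSL ℝ g).comp (ContinuousLinearMap.fst ℝ (Eucl n) ℝ)) (p, 0) :=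
    HasFDerivAt.comp (p, (0 : ℝ)) (f := Prod.fst) (hL.hasFDerivAt hL.mem) hasFDerivAt_fst
  have h3 := (hasFDerivAt_fst.add (hasFDerivAt_snd.smul h1)).prodMk h2
  set L := ((ContinuousLinearMap.fst ℝ (Eucl n) ℝ) +
    ((p, (0 : ℝ)).2 • (N'.comp (ContinuousLinearMap.fst ℝ (Eucl n) ℝ)) +
      (ContinuousLinearMap.snd ℝ (Eucl n) ℝ).smulRight (‖g‖⁻¹ • g))).prod
      ((innerSL ℝ g).comp (ContinuousLinearMap.fst ℝ (Eucl n) ℝ)) with hLdef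
  have hinj : Function.Injective (L : (Eucl n × ℝ) →ₗ[ℝ] (Eucl n × ℝ)) := by
    rw [← LinearMap.ker_eq_bot, LinearMap.ker_eq_bot']
    rintro ⟨v, s⟩ hvs
    simp only [hLdef, zero_smul, zero_add, ContinuousLinearMap.coe_coe,
      ContinuousLinearMap.prod_apply, add_apply,
      ContinuousLinearMap.coe_fst', ContinuousLinearMap.smulRight_apply,
      ContinuousLinearMap.coe_snd', ContinuousLinearMap.comp_apply, innerSL_apply_apply,
      Prod.mk_eq_zero] at hvs
    obtain ⟨ha, hb⟩ := hvs
    have hv : v = -(s • ‖g‖⁻¹ • g) := eq_neg_of_add_eq_zero_left ha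
    have hs : s = 0 := by
      rw [hv, inner_neg_right, inner_smul_right, inner_smul_right, real_inner_self_eq_norm_sq,
        neg_eq_zero] at hb
      have : ‖g‖ ≠ 0 := norm_ne_zero_iff.2 hg0
      simpa [this] using hb
    subst hs
    simp [hv]
  let e := (LinearEquiv.ofInjectiveEndo _ hinj).toContinuousLinearEquiv
  refine ⟨e, ?_⟩
  have he : (e : (Eucl n × ℝ) →L[ℝ] (Eucl n × ℝ)) = L := by
    ext q <;> rfl
  rw [he]
  exact h3

/-- Carrying `ρ` as an extra coordinate avoids parametrizing the boundary: over boundary points `y`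
the chart sends `(y, t)` to `(y + t ν, 0)`. Its local inverse at `(x, 0)` must then be the pair of
nearest point and signed distance, which gives smoothness, uniqueness of the foot and the segment
property together. -/
lemma exists_local_collar (hΩ : IsSmoothBoundedDomain Ω) (hn : 1 ≤ n) (hp : p ∈ frontier Ω) :
    ∃ ε > 0, ContDiffOn ℝ ∞ (signedDist Ω) (Metric.ball p ε) ∧
      (∀ x ∈ Metric.ball p ε, ∀ y ∈ frontier Ω, ∀ y' ∈ frontier Ω,
        dist x y = bdryDist Ω x → dist x y' = bdryDist Ω x → y = y') ∧
      (∀ y ∈ frontier Ω, y ∈ Metric.ball p ε → ∀ ν, IsInwardUnitNormal Ω y ν →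
        ∀ r, 0 ≤ r → y + r • ν ∈ Metric.ball p ε → y + r • ν ∈ levelSet Ω r) := by
  obtain ⟨U, ρ, hL⟩ := hΩ.smooth_boundary p hp
  obtain ⟨r₀, hr₀, hball⟩ := hL.exists_radius
  obtain ⟨L, hLd⟩ := hL.exists_equiv_hasFDerivAt
  have hcd : ContDiffAt ℝ ∞ (normalChart ρ) (p, 0) :=
    hL.contDiffAt_normalChart hL.mem hL.gradient_ne_zero
  set e := hcd.toOpenPartialHomeomorph (normalChart ρ) hLd (by simp) with he
  have hcoe : ∀ q, e q = normalChart ρ q := fun q => rfl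
  have hsrc : (p, (0 : ℝ)) ∈ e.source := hcd.mem_toOpenPartialHomeomorph_source hLd (by simp)
  have hG0 : normalChart ρ (p, 0) = (p, 0) := by
    simp [normalChart, hL.eq_zero hΩ.isOpen hL.mem hp]
  have htgt : (p, (0 : ℝ)) ∈ e.target := by
    have := hcd.image_mem_toOpenPartialHomeomorph_target hLd (by simp)
    rwa [hG0] at this
  have hsymm0 : e.symm (p, 0) = (p, 0) := by
    have := e.left_inv hsrc
    rwa [hcoe, hG0] at this
  have hsm : ∀ᶠ z in 𝓝 (p, (0 : ℝ)), ContDiffAt ℝ ∞ e.symm z := by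
    have h1 : ∀ᶠ q in 𝓝 (p, (0 : ℝ)), ContDiffAt ℝ ∞ (normalChart ρ) q := by
      have : Tendsto (Prod.fst : Eucl n × ℝ → Eucl n) (𝓝 (p, 0)) (𝓝 p) := continuous_fst.tendsto _
      filter_upwards [this (Metric.ball_mem_nhds p hr₀)] with q hq
      exact hL.contDiffAt_normalChart (hball _ hq).1 (hball _ hq).2
    -- Invertibility of the derivative is an open condition, so the inverse is smooth on a whole
    -- neighbourhood and not only at the centre.
    have h2 : ∀ᶠ q in 𝓝 (p, (0 : ℝ)), ∃ e' : (Eucl n × ℝ) ≃L[ℝ] (Eucl n × ℝ),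
        (e' : (Eucl n × ℝ) →L[ℝ] (Eucl n × ℝ)) = fderiv ℝ (normalChart ρ) q := by
      have hc : ContinuousAt (fderiv ℝ (normalChart ρ)) (p, 0) :=
        (hcd.fderiv_right (m := 0) (by simp)).continuousAt
      have hn := L.nhds
      rw [← hLd.fderiv] at hn
      exact hc hn
    have h3 : Tendsto e.symm (𝓝 (p, 0)) (𝓝 (p, 0)) := by
      have := e.continuousAt_symm htgt
      rwa [ContinuousAt, hsymm0] at this
    filter_upwards [h3.eventually (h1.and h2), e.open_target.mem_nhds htgt] with z hz hzt
    obtain ⟨hz1, e', he'⟩ := hz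
    refine e.contDiffAt_symm (f₀' := e') hzt ?_ hz1
    rw [he']
    exact (hz1.differentiableAt (by simp)).hasFDerivAt
  have hsm' : ∀ᶠ x in 𝓝 p, ContDiffAt ℝ ∞ e.symm (x, 0) := by
    have : Tendsto (fun x : Eucl n => (x, (0 : ℝ))) (𝓝 p) (𝓝 (p, 0)) :=
      (Continuous.prodMk_left (0 : ℝ)).tendsto p
    exact this.eventually hsm
  obtain ⟨r₁, hr₁, hsm1⟩ := Metric.eventually_nhds_iff_ball.1 hsm'
  obtain ⟨r₂, hr₂, hsrc2⟩ := Metric.mem_nhds_iff.1 (e.open_source.mem_nhds hsrc)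
  set η := min r₀ (min r₁ r₂) with hη
  have hη0 : 0 < η := by positivity
  have hkey : ∀ y ∈ frontier Ω, y ∈ Metric.ball p η → ∀ ν, IsInwardUnitNormal Ω y ν →
      ∀ r, |r| < η → e.symm (y + r • ν, 0) = (y, r) := by
    intro y hy hyp ν hν r hr
    have hy0 : y ∈ Metric.ball p r₀ := Metric.ball_subset_ball (min_le_left _ _) hyp
    have hN : ν = ‖gradient ρ y‖⁻¹ • gradient ρ y :=
      hν.unique hΩ.isOpen hy ⟨U, ρ, hL.at_point (hball y hy0).1 (hball y hy0).2, rfl⟩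
    have hmem : (y, r) ∈ e.source := by
      apply hsrc2
      have : η ≤ r₂ := (min_le_right _ _).trans (min_le_right _ _)
      rw [← ball_prod_same]
      exact ⟨Metric.ball_subset_ball this hyp, by simpa using hr.trans_le this⟩
    have h1 := e.left_inv hmem
    rw [hcoe] at h1
    have h2 : normalChart ρ (y, r) = (y + r • ν, 0) := by
      simp [normalChart, hL.eq_zero hΩ.isOpen (hball y hy0).1 hy, hN]
    rwa [h2] at h1
  -- Half the radius suffices: `x` is no farther from its foot than from `p`, so the foot is within
  -- `η` of `p`.
  have hfoot : ∀ x ∈ Metric.ball p (η / 2), ∀ y ∈ frontier Ω, dist x y = bdryDist Ω x →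
      e.symm (x, 0) = (y, signedDist Ω x) := by
    intro x hx y hy hxy
    obtain ⟨ν, hν⟩ := hΩ.exists_normal hy
    have hd : bdryDist Ω x < η / 2 := lt_of_le_of_lt (Metric.infDist_le_dist_of_mem hp) hx
    have hyp : y ∈ Metric.ball p η := by
      rw [Metric.mem_ball] at hx ⊢
      calc dist y p ≤ dist x y + dist x p := dist_triangle_left _ _ _
        _ < η := by linarith
    have := hkey y hy hyp ν hν (signedDist Ω x) (by rw [abs_signedDist]; linarith)
    rwa [← eq_add_signedDist_smul hΩ hy hxy hν] at this
  refine ⟨η / 2, by positivity, ?_, ?_, ?_⟩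
  · have h1 : ContDiffOn ℝ ∞ (fun x : Eucl n => (e.symm (x, 0)).2) (Metric.ball p (η / 2)) := by
      intro x hx
      have hx1 : x ∈ Metric.ball p r₁ := Metric.ball_subset_ball
        ((half_le_self hη0.le).trans ((min_le_right _ _).trans (min_le_left _ _))) hx
      have h2 : ContDiffAt ℝ ∞ (fun x : Eucl n => e.symm (x, (0 : ℝ))) x :=
        ContDiffAt.comp (f := fun x : Eucl n => (x, (0 : ℝ))) x (hsm1 x hx1)
          (contDiffAt_id.prodMk contDiffAt_const)
      exact (contDiffAt_snd.comp x h2).contDiffWithinAt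
    refine h1.congr (fun x hx => ?_)
    obtain ⟨y, hy, hxy⟩ := exists_foot hΩ hn x
    rw [hfoot x hx y hy hxy]
  · intro x hx y hy y' hy' hxy hxy'
    have := (hfoot x hx y hy hxy).symm.trans (hfoot x hx y' hy' hxy')
    exact congrArg Prod.fst this
  · intro y hy hyp ν hν r hr hmem
    have hrη : |r| < η := by
      have h1 : dist (y + r • ν) y = |r| := by
        rw [dist_eq_norm, add_sub_cancel_left, norm_smul, hν.norm_eq_one, mul_one,
          Real.norm_eq_abs]
      rw [← h1]
      rw [Metric.mem_ball] at hyp hmem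
      calc _ ≤ dist (y + r • ν) p + dist y p := dist_triangle_right _ _ _
        _ < η := by linarith
    have h1 := hkey y hy (Metric.ball_subset_ball (half_le_self hη0.le) hyp) ν hν r hrη
    obtain ⟨y', hy', hxy'⟩ := exists_foot hΩ hn (y + r • ν)
    have h2 : signedDist Ω (y + r • ν) = r :=
      congrArg Prod.snd ((hfoot _ hmem y' hy' hxy').symm.trans h1)
    rcases hr.eq_or_lt with rfl | hr0
    · simp only [zero_smul, add_zero]
      exact ⟨frontier_subset_closure hy, bdryDist_eq_zero_of_mem_frontier hy⟩
    · by_cases hmΩ : y + r • ν ∈ Ω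
      · refine ⟨subset_closure hmΩ, ?_⟩
        rw [← signedDist_of_mem_closure hΩ.isOpen (subset_closure hmΩ), h2]
      · unfold signedDist at h2
        rw [if_neg hmΩ] at h2
        linarith [bdryDist_nonneg (Ω := Ω) (y + r • ν)]

lemma exists_isFermiCollarWidth (hΩ : IsSmoothBoundedDomain Ω) (hn : 1 ≤ n) :
    ∃ δ : ℝ, IsFermiCollarWidth Ω δ := by
  choose! ε hε hsmooth hunique hseg using
    fun (p : Eucl n) (hp : p ∈ frontier Ω) => exists_local_collar hΩ hn hp
  -- A Lebesgue number for the cover of the compact boundary by the local collars; half of it is a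
  -- collar width, because `x` is then strictly within `δ` of its foot.
  obtain ⟨δ, hδ, hleb⟩ := lebesgue_number_lemma_of_metric (c := fun p : frontier Ω =>
      Metric.ball p.1 (ε p.1)) hΩ.isCompact_frontier
    (fun p => Metric.isOpen_ball) (fun x hx => mem_iUnion.2 ⟨⟨x, hx⟩, Metric.mem_ball_self (hε x hx)⟩)
  have hcov : ∀ x, bdryDist Ω x ≤ δ / 2 → ∃ p ∈ frontier Ω, x ∈ Metric.ball p (ε p) := by
    intro x hx
    obtain ⟨y, hy, hxy⟩ := exists_foot hΩ hn x
    obtain ⟨p, hp⟩ := hleb y hy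
    exact ⟨p.1, p.2, hp (by rw [Metric.mem_ball]; linarith)⟩
  refine ⟨δ / 2, by positivity, ?_, ?_, ?_⟩
  · refine ⟨⋃ p ∈ frontier Ω, Metric.ball p (ε p), signedDist Ω,
      isOpen_biUnion fun p _ => Metric.isOpen_ball, ?_, ?_, ?_⟩
    · intro x hx
      obtain ⟨p, hp, hxp⟩ := hcov x hx.2
      exact mem_biUnion hp hxp
    · intro x hx
      obtain ⟨p, hp, hxp⟩ := mem_iUnion₂.1 hx
      exact ((hsmooth p hp).contDiffAt (Metric.isOpen_ball.mem_nhds hxp)).contDiffWithinAt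
    · exact fun x hx => signedDist_of_mem_closure hΩ.isOpen hx.1
  · intro x hx
    obtain ⟨p, hp, hxp⟩ := hcov x hx.2
    obtain ⟨y, hy, hxy⟩ := exists_foot hΩ hn x
    exact ⟨y, ⟨hy, hxy⟩, fun y' hy' => hunique p hp x hxp y' hy'.1 y hy hy'.2 hxy⟩
  · intro y hy ν hν r hr
    obtain ⟨p, hp⟩ := hleb y hy
    refine hseg p.1 p.2 y hy (hp (Metric.mem_ball_self hδ)) ν hν r hr.1 (hp ?_)
    rw [Metric.mem_ball, dist_eq_norm, add_sub_cancel_left, norm_smul, hν.norm_eq_one, mul_one,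
      Real.norm_of_nonneg hr.1]
    linarith [hr.2]

end Collar

/-! ### Calculus of coordinate derivatives -/

section PartialDerivatives
variable {n : ℕ}

/-- The partial derivative of `f` in the `i`-th coordinate direction. -/
noncomputable def pd (f : Eucl n → ℝ) (i : Fin n) (x : Eucl n) : ℝ :=
  fderiv ℝ f x (EuclideanSpace.single i 1)

variable {f g : Eucl n → ℝ} {x : Eucl n} {i j : Fin n} {S : Set (Eucl n)}

lemma pd_congr (h : f =ᶠ[𝓝 x] g) : pd f i x = pd g i x := by
  unfold pd; rw [h.fderiv_eq]

lemma pd_mul (hf : DifferentiableAt ℝ f x) (hg : DifferentiableAt ℝ g x) :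
    pd (fun y => f y * g y) i x = f x * pd g i x + g x * pd f i x := by
  unfold pd
  rw [fderiv_fun_mul hf hg]
  simp

lemma pd_add (hf : DifferentiableAt ℝ f x) (hg : DifferentiableAt ℝ g x) :
    pd (fun y => f y + g y) i x = pd f i x + pd g i x := by
  unfold pd
  rw [fderiv_fun_add hf hg]
  simp

lemma pd_sub (hf : DifferentiableAt ℝ f x) (hg : DifferentiableAt ℝ g x) :
    pd (fun y => f y - g y) i x = pd f i x - pd g i x := by
  unfold pd
  rw [fderiv_fun_sub hf hg]
  simp

lemma pd_const_mul (c : ℝ) (hf : DifferentiableAt ℝ f x) :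
    pd (fun y => c * f y) i x = c * pd f i x := by
  unfold pd
  rw [fderiv_const_mul hf]
  simp

lemma pd_const (c : ℝ) : pd (fun _ : Eucl n => c) i x = 0 := by
  unfold pd; simp

lemma pd_sum {ι : Type*} (s : Finset ι) {F : ι → Eucl n → ℝ}
    (hF : ∀ k ∈ s, DifferentiableAt ℝ (F k) x) :
    pd (fun y => ∑ k ∈ s, F k y) i x = ∑ k ∈ s, pd (F k) i x := by
  unfold pd
  rw [fderiv_fun_sum hF]
  simp

lemma pd_pow_two (hf : DifferentiableAt ℝ f x) :
    pd (fun y => f y ^ 2) i x = 2 * f x * pd f i x := by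
  have : (fun y => f y ^ 2) = fun y => f y * f y := by ext y; ring
  rw [this, pd_mul hf hf]; ring

lemma pd_comp {φ : ℝ → ℝ} {φ' : ℝ} (hφ : HasDerivAt φ φ' (f x)) (hf : DifferentiableAt ℝ f x) :
    pd (fun y => φ (f y)) i x = φ' * pd f i x := by
  unfold pd
  have := (hφ.comp_hasFDerivAt x hf.hasFDerivAt).fderiv
  rw [show (fun y => φ (f y)) = φ ∘ f from rfl, this]
  simp

lemma contDiffOn_pd {m k : WithTop ℕ∞} (hS : IsOpen S) (hf : ContDiffOn ℝ k f S)
    (h : m + 1 ≤ k) : ContDiffOn ℝ m (pd f i) S :=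
  (hf.fderiv_of_isOpen hS h).clm_apply contDiffOn_const

lemma pd_pd_eq (hf : ContDiffAt ℝ 2 f x) :
    pd (pd f i) j x =
      fderiv ℝ (fderiv ℝ f) x (EuclideanSpace.single j 1) (EuclideanSpace.single i 1) := by
  have h1 : DifferentiableAt ℝ (fderiv ℝ f) x :=
    (hf.fderiv_right (m := 1) (by norm_num)).differentiableAt (by norm_num)
  have h2 := (h1.hasFDerivAt.clm_apply
    (hasFDerivAt_const (EuclideanSpace.single i (1 : ℝ)) x)).fderiv
  unfold pd
  rw [h2]
  simp

lemma pd_comm (hf : ContDiffAt ℝ 2 f x) : pd (pd f i) j x = pd (pd f j) i x := by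
  rw [pd_pd_eq hf, pd_pd_eq hf]
  exact (hf.isSymmSndFDerivAt (by simp)).eq _ _

lemma laplacian_eq_sum_pd (hf : ContDiffAt ℝ 2 f x) :
    Laplacian.laplacian f x = ∑ i, pd (pd f i) i x := by
  rw [InnerProductSpace.laplacian_eq_iteratedFDeriv_orthonormalBasis f
    (EuclideanSpace.basisFun (Fin n) ℝ)]
  refine Finset.sum_congr rfl fun i _ => ?_
  rw [pd_pd_eq hf, iteratedFDeriv_two_apply]
  simp

end PartialDerivatives

/-! ### A globally smooth substitute for the distance function -/

section CollarFunction
variable {n : ℕ} {Ω : Set (Eucl n)}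

/-- A smooth function on `Ω`, with bounded derivatives up to second order, which equals the
distance to the boundary where that distance is less than `δ`, and is at least `δ` elsewhere. -/
structure IsCollarFunction (Ω : Set (Eucl n)) (δ M : ℝ) (D : Eucl n → ℝ) : Prop where
  pos : 0 < δ
  smooth : ContDiffOn ℝ ∞ D Ω
  eq_dist : ∀ x ∈ Ω, bdryDist Ω x < δ → D x = bdryDist Ω x
  le : ∀ x ∈ Ω, δ ≤ bdryDist Ω x → δ ≤ D x
  abs_le : ∀ x ∈ Ω, |D x| ≤ M
  pd_le : ∀ x ∈ Ω, ∀ i, |pd D i x| ≤ M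
  pd_pd_le : ∀ x ∈ Ω, ∀ i j, |pd (pd D i) j x| ≤ M
  normal : ∀ x ∈ Ω, D x < δ → ∃ y ∈ frontier Ω, ∃ ν, IsInwardUnitNormal Ω y ν ∧
    dist x y = D x ∧ ∀ i, pd D i x = ν i

/-- The distance is 1-Lipschitz, so its gradient has norm at most one, and it grows at unit speed
along the segment from the foot, so the derivative along `ν` is one. Equality in Cauchy–Schwarz
makes the gradient equal to `ν`. -/
lemma fderiv_bdryDist_eq_inner (hΩ : IsSmoothBoundedDomain Ω) {x y ν : Eucl n} (hx : x ∈ Ω)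
    (hy : y ∈ frontier Ω) (hxy : dist x y = bdryDist Ω x) (hν : IsInwardUnitNormal Ω y ν)
    (hd : DifferentiableAt ℝ (bdryDist Ω) x) (hpos : 0 < bdryDist Ω x) (v : Eucl n) :
    fderiv ℝ (bdryDist Ω) x v = inner ℝ ν v := by
  have hxe := normal_eq_of_foot_of_mem hΩ hx hy hxy hν
  have hν1 := hν.norm_eq_one
  set d := bdryDist Ω x with hdd
  have hdir : fderiv ℝ (bdryDist Ω) x ν = 1 := by
    have h2 : HasDerivAt (fun t : ℝ => x + t • ν) ν 0 := by
      simpa using ((hasDerivAt_id (0 : ℝ)).smul_const ν).const_add x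
    have h3 : HasFDerivAt (bdryDist Ω) (fderiv ℝ (bdryDist Ω) x) (x + (0 : ℝ) • ν) := by
      simpa using hd.hasFDerivAt
    -- One-sided, because linearity of the distance is established only between the foot and `x`,
    -- not beyond `x`.
    have h1 := (h3.comp_hasDerivAt 0 h2).hasDerivWithinAt (s := Icc (-d) 0)
    have h4 : HasDerivWithinAt (fun t : ℝ => d + t) 1 (Icc (-d) 0) 0 :=
      ((hasDerivAt_id (0 : ℝ)).const_add d).hasDerivWithinAt
    have h5 : ∀ t ∈ Icc (-d) 0, bdryDist Ω (x + t • ν) = d + t := by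
      intro t ht
      apply le_antisymm
      · refine (Metric.infDist_le_dist_of_mem hy).trans ?_
        rw [dist_eq_norm]
        have : x + t • ν - y = (d + t) • ν := by
          nth_rewrite 1 [hxe]
          rw [add_smul]; abel
        rw [this, norm_smul, hν1, mul_one, Real.norm_of_nonneg (by linarith [ht.1])]
      · have h6 := abs_le.1 (abs_bdryDist_sub_le (Ω := Ω) x (x + t • ν))
        rw [dist_eq_norm] at h6
        have : x - (x + t • ν) = -(t • ν) := by abel
        rw [this, norm_neg, norm_smul, hν1, mul_one, Real.norm_of_nonpos ht.2] at h6
        linarith [h6.2]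
    have h6 : HasDerivWithinAt (fun t : ℝ => bdryDist Ω (x + t • ν)) 1 (Icc (-d) 0) 0 :=
      h4.congr h5 (h5 0 (by constructor <;> linarith))
    exact (uniqueDiffOn_Icc (by linarith) 0 (by constructor <;> linarith)).eq_deriv _ h1 h6
  have hnorm : ‖gradient (bdryDist Ω) x‖ ≤ 1 := by
    have h1 : ‖fderiv ℝ (bdryDist Ω) x‖ ≤ (1 : NNReal) :=
      norm_fderiv_le_of_lipschitz ℝ (Metric.lipschitz_infDist_pt (frontier Ω))
    simpa [gradient] using h1
  have hin : ∀ v, fderiv ℝ (bdryDist Ω) x v = inner ℝ (gradient (bdryDist Ω) x) v := by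
    intro v; simp [gradient]
  have hg : gradient (bdryDist Ω) x = ν := by
    rw [← sub_eq_zero, ← norm_eq_zero]
    have h1 := norm_sub_sq_real (gradient (bdryDist Ω) x) ν
    rw [← hin, hdir, hν1] at h1
    have h2 : ‖gradient (bdryDist Ω) x‖ ^ 2 ≤ 1 := by
      have := norm_nonneg (gradient (bdryDist Ω) x)
      nlinarith
    have h3 := norm_nonneg (gradient (bdryDist Ω) x - ν)
    nlinarith
  rw [hin, hg]

lemma isCompact_collar (hΩ : IsSmoothBoundedDomain Ω) (δ : ℝ) : IsCompact (collar Ω δ) :=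
  hΩ.isCompact_closure.of_isClosed_subset
    (isClosed_closure.inter (isClosed_le continuous_bdryDist continuous_const)) fun _ h => h.1

/-- The identity for small arguments, smoothly flattened to the constant `δ` near `δ`. -/
noncomputable def flatten (δ s : ℝ) : ℝ :=
  s + (δ - s) * Real.smoothTransition ((s - 3 / 4 * δ) / (δ / 8))

lemma contDiff_flatten (δ : ℝ) : ContDiff ℝ ∞ (flatten δ) := by
  unfold flatten
  have h : ContDiff ℝ ∞ Real.smoothTransition := Real.smoothTransition.contDiff
  fun_prop

lemma flatten_of_le {δ s : ℝ} (hδ : 0 < δ) (hs : s ≤ 3 / 4 * δ) : flatten δ s = s := by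
  unfold flatten
  rw [Real.smoothTransition.zero_of_nonpos (div_nonpos_of_nonpos_of_nonneg (by linarith)
    (by positivity))]
  ring

lemma flatten_of_ge {δ s : ℝ} (hδ : 0 < δ) (hs : 7 / 8 * δ ≤ s) : flatten δ s = δ := by
  unfold flatten
  rw [Real.smoothTransition.one_of_one_le (by rw [le_div_iff₀ (by positivity)]; linarith)]
  ring

lemma le_flatten {δ s : ℝ} (hδ : 0 < δ) (hs : 3 / 4 * δ ≤ s) : 3 / 4 * δ ≤ flatten δ s := by
  rcases le_total s δ with h | h
  · unfold flatten
    have := mul_nonneg (sub_nonneg.2 h)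
      (Real.smoothTransition.nonneg ((s - 3 / 4 * δ) / (δ / 8)))
    linarith
  · rw [flatten_of_ge hδ (by linarith)]; linarith

lemma abs_flatten_le {δ s : ℝ} (hδ : 0 < δ) (hs : 0 ≤ s) : |flatten δ s| ≤ δ := by
  rcases le_total s δ with h | h
  · unfold flatten
    have h0 := Real.smoothTransition.nonneg ((s - 3 / 4 * δ) / (δ / 8))
    have h1 := Real.smoothTransition.le_one ((s - 3 / 4 * δ) / (δ / 8))
    rw [abs_le]
    constructor <;> nlinarith
  · rw [flatten_of_ge hδ (by linarith), abs_of_pos hδ]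

/-- Flattening the distance before it reaches `δ` removes the points where it may fail to be smooth;
this costs the factor `3 / 4`. The derivative bounds come from compactness of the collar, on a
neighbourhood of which the extension `ρ` is smooth across the boundary. -/
lemma exists_isCollarFunction (hΩ : IsSmoothBoundedDomain Ω) (hn : 1 ≤ n) {δ : ℝ}
    (hδ : IsFermiCollarWidth Ω δ) :
    ∃ (M : ℝ) (D : Eucl n → ℝ), IsCollarFunction Ω (3 / 4 * δ) M D := by
  have hpos := hδ.pos
  obtain ⟨U, ρ, hU, hcU, hρ, hρd⟩ := hδ.smooth_dist
  set F : Eucl n → ℝ := fun x => flatten δ (ρ x) with hF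
  have hFs : ContDiffOn ℝ ∞ F U := (contDiff_flatten δ).comp_contDiffOn hρ
  have hF1 : ContinuousOn (fderiv ℝ F) U := hFs.continuousOn_fderiv_of_isOpen hU (by simp)
  have hF2 : ContinuousOn (fderiv ℝ (fderiv ℝ F)) U :=
    (hFs.fderiv_of_isOpen (m := ∞) hU (by simp)).continuousOn_fderiv_of_isOpen hU (by simp)
  obtain ⟨M₁, hM₁⟩ := (isCompact_collar hΩ δ).exists_bound_of_continuousOn (hF1.mono hcU)
  obtain ⟨M₂, hM₂⟩ := (isCompact_collar hΩ δ).exists_bound_of_continuousOn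
    (E := Eucl n →L[ℝ] Eucl n →L[ℝ] ℝ) (hF2.mono hcU)
  set D : Eucl n → ℝ := fun x => flatten δ (bdryDist Ω x) with hD
  set M := max δ (max M₁ M₂) with hM
  have hM0 : 0 ≤ M := hpos.le.trans (le_max_left _ _)
  have hnear : ∀ x ∈ Ω, bdryDist Ω x < δ → D =ᶠ[𝓝 x] F ∧ x ∈ collar Ω δ := by
    intro x hx hxd
    refine ⟨?_, subset_closure hx, hxd.le⟩
    filter_upwards [hΩ.isOpen.mem_nhds hx,
      continuous_bdryDist.continuousAt.eventually (gt_mem_nhds hxd)] with z hz hzd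
    simp only [hD, hF]
    rw [hρd z ⟨subset_closure hz, hzd.le⟩]
  have hfar : ∀ x ∈ Ω, δ ≤ bdryDist Ω x → D =ᶠ[𝓝 x] fun _ => δ := by
    intro x hx hxd
    have : 7 / 8 * δ < bdryDist Ω x := by linarith
    filter_upwards [continuous_bdryDist.continuousAt.eventually (lt_mem_nhds this)] with z hz
    exact flatten_of_ge hpos hz.le
  have hs : ContDiffOn ℝ ∞ D Ω := by
    intro x hx
    rcases lt_or_ge (bdryDist Ω x) δ with h | h
    · obtain ⟨h1, h2⟩ := hnear x hx h
      exact ((hFs.contDiffAt (hU.mem_nhds (hcU h2))).congr_of_eventuallyEq h1).contDiffWithinAt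
    · exact (contDiffAt_const.congr_of_eventuallyEq (hfar x hx h)).contDiffWithinAt
  refine ⟨M, D, by positivity, hs, ?_, ?_, ?_, ?_, ?_, ?_⟩
  · exact fun x _ h => flatten_of_le hpos h.le
  · exact fun x _ h => le_flatten hpos h
  · exact fun x _ => (abs_flatten_le hpos (bdryDist_nonneg x)).trans (le_max_left _ _)
  · intro x hx i
    rcases lt_or_ge (bdryDist Ω x) δ with h | h
    · obtain ⟨h1, h2⟩ := hnear x hx h
      rw [pd_congr h1]
      have := (fderiv ℝ F x).le_opNorm (EuclideanSpace.single i 1)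
      rw [PiLp.norm_single, norm_one, mul_one] at this
      exact this.trans ((hM₁ x h2).trans ((le_max_left _ _).trans (le_max_right _ _)))
    · rw [pd_congr (hfar x hx h), pd_const]; simpa using hM0
  · intro x hx i j
    rcases lt_or_ge (bdryDist Ω x) δ with h | h
    · obtain ⟨h1, h2⟩ := hnear x hx h
      have h3 : pd D i =ᶠ[𝓝 x] pd F i := by
        filter_upwards [h1.eventuallyEq_nhds] with z hz using pd_congr hz
      rw [pd_congr h3, pd_pd_eq ((hFs.contDiffAt (hU.mem_nhds (hcU h2))).of_le ENat.LEInfty.out)]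
      have h4 := (fderiv ℝ (fderiv ℝ F) x (EuclideanSpace.single j 1)).le_opNorm
        (EuclideanSpace.single i 1)
      have h5 := (fderiv ℝ (fderiv ℝ F) x).le_opNorm (EuclideanSpace.single j 1)
      rw [PiLp.norm_single, norm_one, mul_one] at h4 h5
      exact h4.trans (h5.trans ((hM₂ x h2).trans ((le_max_right _ _).trans (le_max_right _ _))))
    · have h3 : pd D i =ᶠ[𝓝 x] fun _ => 0 := by
        filter_upwards [(hfar x hx h).eventuallyEq_nhds] with z hz
        rw [pd_congr hz, pd_const]
      rw [pd_congr h3, pd_const]; simpa using hM0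
  · intro x hx hxD
    have hxd : bdryDist Ω x < 3 / 4 * δ := by
      by_contra! h
      exact absurd (le_flatten hpos h) (not_le.2 hxD)
    obtain ⟨y, hy, hxy⟩ := exists_foot hΩ hn x
    obtain ⟨ν, hν⟩ := hΩ.exists_normal hy
    have heq : D =ᶠ[𝓝 x] bdryDist Ω := by
      filter_upwards [continuous_bdryDist.continuousAt.eventually (gt_mem_nhds hxd)] with z hz
      exact flatten_of_le hpos hz.le
    have hdiff : DifferentiableAt ℝ (bdryDist Ω) x :=
      (((hs.contDiffAt (hΩ.isOpen.mem_nhds hx)).congr_of_eventuallyEq heq.symm).differentiableAt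
        (by simp))
    refine ⟨y, hy, ν, hν, by rw [hxy, heq.eq_of_nhds], fun i => ?_⟩
    rw [pd_congr heq, pd, fderiv_bdryDist_eq_inner hΩ hx hy hxy hν hdiff
      (bdryDist_pos_of_mem hΩ hn hx), EuclideanSpace.inner_single_right]
    simp

namespace IsCollarFunction
variable {δ M : ℝ} {D : Eucl n → ℝ}

/-- The eikonal equation, from the unit length of the normal. -/
lemma sum_sq (hD : IsCollarFunction Ω δ M D) {x : Eucl n} (hx : x ∈ Ω) (hxD : D x < δ) :
    ∑ i, pd D i x ^ 2 = 1 := by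
  obtain ⟨y, hy, ν, hν, _, h⟩ := hD.normal x hx hxD
  have h1 := hν.norm_eq_one
  rw [EuclideanSpace.norm_eq, Real.sqrt_eq_one] at h1
  simpa [h] using h1

lemma dist_lt_iff (hD : IsCollarFunction Ω δ M D) {x : Eucl n} (hx : x ∈ Ω) :
    bdryDist Ω x < δ ↔ D x < δ := by
  constructor
  · intro h; rwa [hD.eq_dist x hx h]
  · intro h
    by_contra! h1
    exact absurd (hD.le x hx h1) (not_le.2 h)

lemma eq_dist_of_lt (hD : IsCollarFunction Ω δ M D) {x : Eucl n} (hx : x ∈ Ω) (h : D x < δ) :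
    D x = bdryDist Ω x := hD.eq_dist x hx ((hD.dist_lt_iff hx).2 h)

lemma pos_of_mem (hD : IsCollarFunction Ω δ M D) (hΩ : IsSmoothBoundedDomain Ω) (hn : 1 ≤ n)
    {x : Eucl n} (hx : x ∈ Ω) : 0 < D x := by
  rcases lt_or_ge (D x) δ with h | h
  · rw [hD.eq_dist_of_lt hx h]; exact bdryDist_pos_of_mem hΩ hn hx
  · exact hD.pos.trans_le h

end IsCollarFunction
end CollarFunction

/-! ### One-dimensional cutoff functions -/

section Cutoffs

lemma hasDerivAt_expNegInvGlue (x : ℝ) :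
    HasDerivAt expNegInvGlue (x⁻¹ ^ 2 * expNegInvGlue x) x := by
  simpa using expNegInvGlue.hasDerivAt_polynomial_eval_inv_mul 1 x

lemma expNegInvGlue_le_one (x : ℝ) : expNegInvGlue x ≤ 1 := by
  unfold expNegInvGlue
  split_ifs with h
  · exact zero_le_one
  · rw [Real.exp_le_one_iff]
    have := inv_pos.2 (not_le.1 h)
    linarith

lemma exists_smooth_cutoff {a b : ℝ} (hab : a < b) :
    ∃ (θ : ℝ → ℝ) (C : ℝ), ContDiff ℝ ∞ θ ∧ (∀ s, 0 ≤ θ s) ∧ (∀ s, θ s ≤ 1) ∧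
      (∀ s ≤ a, θ s = 1) ∧ (∀ s, b ≤ s → θ s = 0) ∧ ∀ s, |deriv θ s| ≤ C := by
  have hs : ContDiff ℝ ∞ Real.smoothTransition := Real.smoothTransition.contDiff
  set θ : ℝ → ℝ := fun s => Real.smoothTransition ((b - s) / (b - a)) with hθ
  have hba : 0 < b - a := sub_pos.2 hab
  have hθs : ContDiff ℝ ∞ θ := by rw [hθ]; fun_prop
  have h1 : ∀ s ≤ a, θ s = 1 := fun s hs => Real.smoothTransition.one_of_one_le (by
    rw [le_div_iff₀ hba]; linarith)
  have h0 : ∀ s, b ≤ s → θ s = 0 := fun s hs => Real.smoothTransition.zero_of_nonpos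
    (div_nonpos_of_nonpos_of_nonneg (by linarith) hba.le)
  obtain ⟨C, hC⟩ := (isCompact_Icc (a := a) (b := b)).exists_bound_of_continuousOn
    (hθs.continuous_deriv (by simp)).continuousOn
  refine ⟨θ, max C 0, hθs, fun s => Real.smoothTransition.nonneg _,
    fun s => Real.smoothTransition.le_one _, h1, h0, fun s => ?_⟩
  rcases lt_or_ge s a with h | h
  · have : θ =ᶠ[𝓝 s] fun _ => 1 := by
      filter_upwards [gt_mem_nhds h] with t ht using h1 t (le_of_lt ht)
    rw [this.deriv_eq]; simp
  rcases lt_or_ge b s with h' | h'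
  · have : θ =ᶠ[𝓝 s] fun _ => 0 := by
      filter_upwards [lt_mem_nhds h'] with t ht using h0 t (le_of_lt ht)
    rw [this.deriv_eq]; simp
  · exact (hC s ⟨h, h'⟩).trans (le_max_left _ _)

lemma deriv_smoothTransition_bound : ∃ C : ℝ, ∀ s, |deriv Real.smoothTransition s| ≤ C ∧
    (s < 0 ∨ 1 < s → deriv Real.smoothTransition s = 0) := by
  have hs : ContDiff ℝ ∞ Real.smoothTransition := Real.smoothTransition.contDiff
  obtain ⟨C, hC⟩ := (isCompact_Icc (a := (0 : ℝ)) (b := 1)).exists_bound_of_continuousOn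
    (hs.continuous_deriv (by simp)).continuousOn
  have hz : ∀ s : ℝ, s < 0 ∨ 1 < s → deriv Real.smoothTransition s = 0 := by
    rintro s (h | h)
    · have : Real.smoothTransition =ᶠ[𝓝 s] fun _ => 0 := by
        filter_upwards [gt_mem_nhds h] with t ht
          using Real.smoothTransition.zero_of_nonpos (le_of_lt ht)
      rw [this.deriv_eq]; simp
    · have : Real.smoothTransition =ᶠ[𝓝 s] fun _ => 1 := by
        filter_upwards [lt_mem_nhds h] with t ht
          using Real.smoothTransition.one_of_one_le (le_of_lt ht)
      rw [this.deriv_eq]; simp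
  refine ⟨max C 0, fun s => ⟨?_, hz s⟩⟩
  by_cases h : s < 0 ∨ 1 < s
  · rw [hz s h]; simp
  · push Not at h
    exact (hC s h).trans (le_max_left _ _)

end Cutoffs

/-! ### An algebra of integrable functions on the domain -/

section BoundedContinuous
variable {n : ℕ} {Ω : Set (Eucl n)} {f g : Eucl n → ℝ}

/-- `f` is bounded and continuous on `Ω`. -/
def IsBC (Ω : Set (Eucl n)) (f : Eucl n → ℝ) : Prop :=
  ContinuousOn f Ω ∧ ∃ B, ∀ x ∈ Ω, |f x| ≤ B

namespace IsBC

lemma const (c : ℝ) : IsBC Ω fun _ => c := ⟨continuousOn_const, |c|, fun _ _ => le_rfl⟩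

lemma add (hf : IsBC Ω f) (hg : IsBC Ω g) : IsBC Ω fun x => f x + g x := by
  obtain ⟨hf, A, hA⟩ := hf
  obtain ⟨hg, B, hB⟩ := hg
  exact ⟨hf.add hg, A + B, fun x hx => (abs_add_le _ _).trans (add_le_add (hA x hx) (hB x hx))⟩

lemma neg (hf : IsBC Ω f) : IsBC Ω fun x => -f x := by
  obtain ⟨hf, A, hA⟩ := hf
  exact ⟨hf.neg, A, fun x hx => by rw [abs_neg]; exact hA x hx⟩

lemma sub (hf : IsBC Ω f) (hg : IsBC Ω g) : IsBC Ω fun x => f x - g x := by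
  simpa [sub_eq_add_neg] using hf.add hg.neg

lemma mul (hf : IsBC Ω f) (hg : IsBC Ω g) : IsBC Ω fun x => f x * g x := by
  obtain ⟨hf, A, hA⟩ := hf
  obtain ⟨hg, B, hB⟩ := hg
  refine ⟨hf.mul hg, A * B, fun x hx => ?_⟩
  rw [abs_mul]
  exact mul_le_mul (hA x hx) (hB x hx) (abs_nonneg _) ((abs_nonneg _).trans (hA x hx))

lemma pow_two (hf : IsBC Ω f) : IsBC Ω fun x => f x ^ 2 := by
  simpa [sq] using hf.mul hf

lemma sum {ι : Type*} {s : Finset ι} {F : ι → Eucl n → ℝ} (hF : ∀ i ∈ s, IsBC Ω (F i)) :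
    IsBC Ω fun x => ∑ i ∈ s, F i x := by
  classical
  induction s using Finset.induction_on with
  | empty => simpa using const 0
  | insert a s ha ih =>
    simp only [Finset.sum_insert ha]
    exact (hF a (Finset.mem_insert_self _ _)).add
      (ih fun i hi => hF i (Finset.mem_insert_of_mem hi))

lemma comp {φ : ℝ → ℝ} (hφ : Continuous φ) (hf : IsBC Ω f) : IsBC Ω fun x => φ (f x) := by
  obtain ⟨hf, A, hA⟩ := hf
  obtain ⟨B, hB⟩ := (isCompact_Icc (a := -A) (b := A)).exists_bound_of_continuousOn
    hφ.continuousOn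
  exact ⟨hφ.comp_continuousOn hf, B, fun x hx => hB _ (abs_le.1 (hA x hx))⟩

lemma congr (hf : IsBC Ω f) (h : ∀ x ∈ Ω, g x = f x) : IsBC Ω g :=
  ⟨hf.1.congr h, hf.2.imp fun B hB x hx => by rw [h x hx]; exact hB x hx⟩

lemma integrableOn (hΩ : IsSmoothBoundedDomain Ω) (hf : IsBC Ω f) :
    IntegrableOn f Ω := by
  obtain ⟨hf, A, hA⟩ := hf
  refine IntegrableOn.of_bound hΩ.isBounded.measure_lt_top
    (hf.aestronglyMeasurable hΩ.isOpen.measurableSet) A ?_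
  exact (ae_restrict_iff' hΩ.isOpen.measurableSet).2 (Eventually.of_forall hA)

end IsBC
end BoundedContinuous

/-! ### The divergence theorem for fields tangent to the boundary -/

section Divergence
variable {n : ℕ} {Ω : Set (Eucl n)} {δ M : ℝ} {D : Eucl n → ℝ}

/-- Points of `Ω` approaching the boundary. -/
noncomputable def boundaryFilter (Ω : Set (Eucl n)) : Filter (Eucl n) :=
  comap (bdryDist Ω) (𝓝 0) ⊓ 𝓟 Ω

lemma eventually_boundaryFilter {P : Eucl n → Prop} :
    (∀ᶠ x in boundaryFilter Ω, P x) ↔ ∃ ε > 0, ∀ x ∈ Ω, bdryDist Ω x < ε → P x := by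
  unfold boundaryFilter
  rw [eventually_inf_principal, eventually_comap, Metric.eventually_nhds_iff]
  constructor
  · rintro ⟨ε, hε, h⟩
    refine ⟨ε, hε, fun x hx hxd => h (y := bdryDist Ω x) ?_ x rfl hx⟩
    rw [Real.dist_eq, sub_zero, abs_of_nonneg (bdryDist_nonneg x)]; exact hxd
  · rintro ⟨ε, hε, h⟩
    refine ⟨ε, hε, fun y hy x hxy hx => h x hx ?_⟩
    rw [hxy]
    rw [Real.dist_eq, sub_zero] at hy
    exact (le_abs_self _).trans_lt hy

lemma IsCollarFunction.tendsto_zero (hD : IsCollarFunction Ω δ M D) :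
    Tendsto D (boundaryFilter Ω) (𝓝 0) := by
  have h1 : Tendsto (bdryDist Ω) (boundaryFilter Ω) (𝓝 0) :=
    tendsto_comap.mono_left inf_le_left
  refine h1.congr' ?_
  exact eventually_boundaryFilter.2 ⟨δ, hD.pos, fun x hx h => (hD.eq_dist x hx h).symm⟩

/-- Extension by zero gives a compactly supported `C¹` function on the whole space, which is
integrated by parts against the constant one. -/
lemma integral_pd_eq_zero (hΩ : IsSmoothBoundedDomain Ω) {f : Eucl n → ℝ}
    (hf : ContDiffOn ℝ 1 f Ω) {ε : ℝ} (hε : 0 < ε)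
    (hz : ∀ x ∈ Ω, bdryDist Ω x < ε → f x = 0) (i : Fin n) :
    IntegrableOn (pd f i) Ω ∧ ∫ x in Ω, pd f i x = 0 := by
  set F : Eucl n → ℝ := Ω.indicator f with hF
  set K : Set (Eucl n) := {x ∈ closure Ω | ε ≤ bdryDist Ω x} with hK
  have hKc : IsCompact K := hΩ.isCompact_closure.of_isClosed_subset
    (isClosed_closure.inter (isClosed_le continuous_const continuous_bdryDist)) fun _ h => h.1
  have hFK : ∀ x ∉ K, F x = 0 := by
    intro x hx
    by_cases hxΩ : x ∈ Ω
    · rw [hF, indicator_of_mem hxΩ]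
      exact hz x hxΩ (not_le.1 fun h => hx ⟨subset_closure hxΩ, h⟩)
    · exact indicator_of_notMem hxΩ _
  have hnear : ∀ x ∈ Ω, F =ᶠ[𝓝 x] f := fun x hx => by
    filter_upwards [hΩ.isOpen.mem_nhds hx] with y hy using indicator_of_mem hy _
  have hfar : ∀ x ∉ Ω, F =ᶠ[𝓝 x] fun _ => 0 := fun x hx => by
    have hxK : x ∉ K := fun h => by
      have : x ∈ frontier Ω := by rw [hΩ.isOpen.frontier_eq]; exact ⟨h.1, hx⟩
      have h2 := h.2
      rw [bdryDist_eq_zero_of_mem_frontier this] at h2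
      linarith
    filter_upwards [hKc.isClosed.isOpen_compl.mem_nhds hxK] with y hy using hFK y hy
  have hFs : ContDiff ℝ 1 F := by
    rw [contDiff_iff_contDiffAt]
    intro x
    by_cases hx : x ∈ Ω
    · exact (hf.contDiffAt (hΩ.isOpen.mem_nhds hx)).congr_of_eventuallyEq (hnear x hx)
    · exact contDiffAt_const.congr_of_eventuallyEq (hfar x hx)
  have hFc : HasCompactSupport F := HasCompactSupport.intro hKc hFK
  have hpdc : Continuous (pd F i) :=
    (hFs.continuous_fderiv (by norm_num)).clm_apply continuous_const
  have hpdint : Integrable (pd F i) :=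
    hpdc.integrable_of_hasCompactSupport (hFc.fderiv_apply (𝕜 := ℝ) _)
  have hpdΩ : ∀ x ∈ Ω, pd f i x = pd F i x := fun x hx => (pd_congr (hnear x hx)).symm
  constructor
  · exact hpdint.integrableOn.congr_fun (fun x hx => (hpdΩ x hx).symm) hΩ.isOpen.measurableSet
  · rw [setIntegral_congr_fun hΩ.isOpen.measurableSet hpdΩ,
      setIntegral_eq_integral_of_forall_compl_eq_zero (fun x hx => by
        rw [pd_congr (hfar x hx), pd_const])]
    have := integral_mul_fderiv_eq_neg_fderiv_mul_of_integrable (μ := (volume : Measure (Eucl n)))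
      (f := fun _ => (1 : ℝ)) (g := F) (v := EuclideanSpace.single i 1) (by simp)
      (by simp only [one_mul]; exact hpdint)
      (by simpa using hFs.continuous.integrable_of_hasCompactSupport hFc)
      (fun x _ => differentiableAt_const _)
      (fun x _ => (hFs.differentiable (by norm_num)).differentiableAt)
    simpa [pd] using this

lemma integral_div_eq_zero_of_vanishing (hΩ : IsSmoothBoundedDomain Ω) {W : Fin n → Eucl n → ℝ}
    (hW : ∀ i, ContDiffOn ℝ 1 (W i) Ω) {ε : ℝ} (hε : 0 < ε)
    (hz : ∀ i, ∀ x ∈ Ω, bdryDist Ω x < ε → W i x = 0) :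
    IntegrableOn (fun x => ∑ i, pd (W i) i x) Ω ∧ ∫ x in Ω, ∑ i, pd (W i) i x = 0 := by
  have h := fun i => integral_pd_eq_zero hΩ (hW i) hε (hz i) i
  constructor
  · exact integrable_finsetSum _ fun i _ => (h i).1
  · rw [integral_finsetSum _ fun i _ => (h i).1]
    simp [fun i => (h i).2]

namespace IsCollarFunction

lemma contDiffOn_one (hD : IsCollarFunction Ω δ M D) : ContDiffOn ℝ 1 D Ω :=
  hD.smooth.of_le (mod_cast le_top)

lemma contDiffOn_pd (hΩ : IsSmoothBoundedDomain Ω) (hD : IsCollarFunction Ω δ M D) (i : Fin n) :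
    ContDiffOn ℝ ∞ (pd D i) Ω := NeumannTrace.contDiffOn_pd hΩ.isOpen hD.smooth (by simp)

lemma isBC (hD : IsCollarFunction Ω δ M D) : IsBC Ω D :=
  ⟨hD.smooth.continuousOn, M, hD.abs_le⟩

lemma isBC_pd (hΩ : IsSmoothBoundedDomain Ω) (hD : IsCollarFunction Ω δ M D) (i : Fin n) :
    IsBC Ω (pd D i) :=
  ⟨(hD.contDiffOn_pd hΩ i).continuousOn, M, fun x hx => hD.pd_le x hx i⟩

lemma isBC_pd_pd (hΩ : IsSmoothBoundedDomain Ω) (hD : IsCollarFunction Ω δ M D) (i j : Fin n) :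
    IsBC Ω (pd (pd D i) j) :=
  ⟨(NeumannTrace.contDiffOn_pd (m := ∞) hΩ.isOpen (hD.contDiffOn_pd hΩ i) (by simp)).continuousOn,
    M, fun x hx => hD.pd_pd_le x hx i j⟩

lemma differentiableAt (hΩ : IsSmoothBoundedDomain Ω) (hD : IsCollarFunction Ω δ M D)
    {x : Eucl n} (hx : x ∈ Ω) : DifferentiableAt ℝ D x :=
  (hD.smooth.contDiffAt (hΩ.isOpen.mem_nhds hx)).differentiableAt (by simp)

lemma differentiableAt_pd (hΩ : IsSmoothBoundedDomain Ω) (hD : IsCollarFunction Ω δ M D)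
    {x : Eucl n} (hx : x ∈ Ω) (i : Fin n) : DifferentiableAt ℝ (pd D i) x :=
  ((hD.contDiffOn_pd hΩ i).contDiffAt (hΩ.isOpen.mem_nhds hx)).differentiableAt (by simp)

/-- Thin shells near the boundary have volume of the order of their width. -/
lemma volume_shell_le (hΩ : IsSmoothBoundedDomain Ω) (hD : IsCollarFunction Ω δ M D) :
    ∃ C : ℝ, 0 ≤ C ∧ ∀ ε : ℝ, 0 < ε → 3 * ε ≤ δ / 2 →
      volume.real {x ∈ Ω | 2 * ε ≤ bdryDist Ω x ∧ bdryDist Ω x ≤ 3 * ε} ≤ C * ε := by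
  have hδ := hD.pos
  obtain ⟨θ, B, hθs, hθ0, hθ1, hθl, hθr, hθB⟩ := exists_smooth_cutoff (half_lt_self hδ)
  have hB0 : 0 ≤ B := (abs_nonneg _).trans (hθB 0)
  -- A lower bound for `t⁻¹ ^ 2 * expNegInvGlue t` on `1 ≤ t ≤ 2`, the range of `D / ε - 1` on the
  -- shell.
  set c : ℝ := (1 / 4) * expNegInvGlue 1 with hc
  have hc0 : 0 < c := mul_pos (by norm_num) (expNegInvGlue.pos_of_pos one_pos)
  have hM0 : ∀ x ∈ Ω, 0 ≤ M := fun x hx => (abs_nonneg _).trans (hD.abs_le x hx)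
  obtain ⟨x₀, hx₀⟩ := hΩ.isConnected.nonempty
  have hM := hM0 x₀ hx₀
  set V := volume.real Ω with hV
  have hVtop : volume Ω < ⊤ := hΩ.isBounded.measure_lt_top
  refine ⟨(B + n * M) * V / c, by positivity, fun ε hε h3 => ?_⟩
  set sh : Set (Eucl n) := {x ∈ Ω | 2 * ε ≤ bdryDist Ω x ∧ bdryDist Ω x ≤ 3 * ε} with hsh
  have hshm : MeasurableSet sh := hΩ.isOpen.measurableSet.inter
    ((measurableSet_le measurable_const continuous_bdryDist.measurable).inter
      (measurableSet_le continuous_bdryDist.measurable measurable_const))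
  -- The field `θ(D) ε E(D) ∇D` vanishes where the distance is below `ε`, so its divergence
  -- integrates to zero. It has size at most `ε`, but its divergence contains `θ(D)` times the
  -- derivative of `ε E`, which is nonnegative and at least `c` on the shell; all other terms are of
  -- order `ε`.
  set E : ℝ → ℝ := fun s => expNegInvGlue (s / ε - 1) with hE
  set E' : ℝ → ℝ := fun s => (s / ε - 1)⁻¹ ^ 2 * expNegInvGlue (s / ε - 1) with hE'
  have hEs : ContDiff ℝ ∞ E := by
    have : ContDiff ℝ ∞ expNegInvGlue := expNegInvGlue.contDiff
    rw [hE]; fun_prop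
  have hEd : ∀ s, HasDerivAt (fun s => ε * E s) (E' s) s := by
    intro s
    have h1 : HasDerivAt (fun s : ℝ => s / ε - 1) (1 / ε) s :=
      ((hasDerivAt_id s).div_const ε).sub_const 1
    have h2 := ((hasDerivAt_expNegInvGlue (s / ε - 1)).comp s h1).const_mul ε
    refine HasDerivAt.congr_deriv h2 ?_
    show _ = (s / ε - 1)⁻¹ ^ 2 * expNegInvGlue (s / ε - 1)
    field_simp
  set φ : ℝ → ℝ := fun s => θ s * (ε * E s) with hφ
  set φ' : ℝ → ℝ := fun s => deriv θ s * (ε * E s) + θ s * E' s with hφ'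
  have hφs : ContDiff ℝ ∞ φ := by rw [hφ]; fun_prop
  have hφd : ∀ s, HasDerivAt φ (φ' s) s := fun s =>
    ((hθs.differentiable (by simp) s).hasDerivAt).mul (hEd s)
  have hE0 : ∀ s, 0 ≤ E s := fun s => expNegInvGlue.nonneg _
  have hE1 : ∀ s, E s ≤ 1 := fun s => expNegInvGlue_le_one _
  set W : Fin n → Eucl n → ℝ := fun i x => φ (D x) * pd D i x with hW
  have hWs : ∀ i, ContDiffOn ℝ 1 (W i) Ω := fun i =>
    ((hφs.comp_contDiffOn hD.smooth).mul (hD.contDiffOn_pd hΩ i)).of_le (mod_cast le_top)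
  have hWz : ∀ i, ∀ x ∈ Ω, bdryDist Ω x < ε → W i x = 0 := by
    intro i x hx hxd
    have : D x = bdryDist Ω x := hD.eq_dist x hx (by linarith)
    simp only [hW, hφ, hE, this]
    rw [expNegInvGlue.zero_of_nonpos]
    · simp
    · rw [sub_nonpos, div_le_one hε]; exact hxd.le
  obtain ⟨hint, hzero⟩ := integral_div_eq_zero_of_vanishing hΩ hWs hε hWz
  have hdiv : ∀ x ∈ Ω, ∑ i, pd (W i) i x = φ' (D x) + φ (D x) * ∑ i, pd (pd D i) i x := by
    intro x hx
    have hDd := hD.differentiableAt hΩ hx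
    have h1 : ∀ i, pd (W i) i x = φ' (D x) * pd D i x ^ 2 + φ (D x) * pd (pd D i) i x := by
      intro i
      have hc : DifferentiableAt ℝ (fun y => φ (D y)) x := (hφd (D x)).differentiableAt.comp x hDd
      show pd (fun y => φ (D y) * pd D i y) i x = _
      rw [pd_mul hc (hD.differentiableAt_pd hΩ hx i),
        pd_comp (hφd _) hDd]
      ring
    simp only [h1]
    rw [Finset.sum_add_distrib, ← Finset.mul_sum, ← Finset.mul_sum]
    rcases lt_or_ge (D x) δ with h | h
    · rw [hD.sum_sq hx h, mul_one]
    · have hθz : θ (D x) = 0 := hθr _ h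
      have hdθ : deriv θ (D x) = 0 := by
        have : IsLocalMin θ (D x) := Eventually.of_forall fun s => by rw [hθz]; exact hθ0 s
        exact this.deriv_eq_zero
      have : φ' (D x) = 0 := by simp [hφ', hθz, hdθ]
      rw [this]; ring
  have hlow : ∀ x ∈ Ω, sh.indicator (fun _ => c) x - (B + n * M) * ε ≤ ∑ i, pd (W i) i x := by
    intro x hx
    rw [hdiv x hx]
    have h1 : |∑ i, pd (pd D i) i x| ≤ n * M := by
      calc _ ≤ ∑ i, |pd (pd D i) i x| := Finset.abs_sum_le_sum_abs _ _
        _ ≤ ∑ i : Fin n, M := Finset.sum_le_sum fun i _ => hD.pd_pd_le x hx i i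
        _ = n * M := by simp
    have h2 : |φ (D x)| ≤ ε := by
      have h3 := mul_nonneg hε.le (hE0 (D x))
      have h4 : ε * E (D x) ≤ ε := by nlinarith [hE1 (D x)]
      simp only [hφ]
      rw [abs_of_nonneg (mul_nonneg (hθ0 _) h3)]
      nlinarith [hθ0 (D x), hθ1 (D x)]
    have h3 : |φ (D x) * ∑ i, pd (pd D i) i x| ≤ ε * (n * M) := by
      rw [abs_mul]
      exact mul_le_mul h2 h1 (abs_nonneg _) hε.le
    have h4 : |deriv θ (D x) * (ε * E (D x))| ≤ B * ε := by
      rw [abs_mul]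
      refine mul_le_mul (hθB _) ?_ (abs_nonneg _) hB0
      rw [abs_of_nonneg (mul_nonneg hε.le (hE0 _))]
      nlinarith [hE1 (D x)]
    have h5 : sh.indicator (fun _ => c) x ≤ θ (D x) * E' (D x) := by
      by_cases hxs : x ∈ sh
      · rw [indicator_of_mem hxs]
        have hDx : D x = bdryDist Ω x := hD.eq_dist x hx (by linarith [hxs.2.2])
        have hm1 : 1 ≤ D x / ε - 1 := by
          rw [le_sub_iff_add_le, le_div_iff₀ hε, hDx]; linarith [hxs.2.1]
        have hm2 : D x / ε - 1 ≤ 2 := by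
          rw [sub_le_iff_le_add, div_le_iff₀ hε, hDx]; linarith [hxs.2.2]
        rw [hθl (D x) (by rw [hDx]; linarith [hxs.2.2]), one_mul]
        simp only [hE', hc]
        refine mul_le_mul ?_ (expNegInvGlue.monotone hm1) (expNegInvGlue.nonneg _) (by positivity)
        rw [show (1 / 4 : ℝ) = (2⁻¹) ^ 2 by norm_num]
        exact pow_le_pow_left₀ (by norm_num) (inv_anti₀ (by linarith) hm2) 2
      · rw [indicator_of_notMem hxs]
        exact mul_nonneg (hθ0 _) (mul_nonneg (sq_nonneg _) (expNegInvGlue.nonneg _))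
    have h6 := (_root_.abs_le.1 h3).1
    have h7 := (_root_.abs_le.1 h4).1
    simp only [hφ']
    linarith
  have hi1 : IntegrableOn (sh.indicator (fun _ => c)) Ω :=
    ((integrableOn_const hVtop.ne).indicator hshm)
  have hi2 : IntegrableOn (fun _ : Eucl n => (B + n * M) * ε) Ω := integrableOn_const hVtop.ne
  have hmono := setIntegral_mono_on (hi1.sub hi2) hint hΩ.isOpen.measurableSet hlow
  rw [hzero] at hmono
  simp only [Pi.sub_apply] at hmono
  rw [integral_sub hi1 hi2, setIntegral_indicator hshm, setIntegral_const, setIntegral_const] at hmono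
  have hinter : Ω ∩ sh = sh := inter_eq_right.2 fun x h => h.1
  rw [hinter, smul_eq_mul, smul_eq_mul] at hmono
  rw [div_mul_eq_mul_div, le_div_iff₀ hc0]
  linarith

/-- The divergence theorem for vector fields which are tangent to the boundary. -/
theorem integral_div_eq_zero (hΩ : IsSmoothBoundedDomain Ω) (hn : 1 ≤ n)
    (hD : IsCollarFunction Ω δ M D) {W : Fin n → Eucl n → ℝ}
    (hW : ∀ i, ContDiffOn ℝ 1 (W i) Ω)
    (hint : IntegrableOn (fun x => ∑ i, pd (W i) i x) Ω)
    (hflux : Tendsto (fun x => ∑ i, W i x * pd D i x) (boundaryFilter Ω) (𝓝 0)) :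
    ∫ x in Ω, ∑ i, pd (W i) i x = 0 := by
  have hδ := hD.pos
  obtain ⟨C, hC0, hC⟩ := hD.volume_shell_le hΩ
  obtain ⟨B, hB⟩ := deriv_smoothTransition_bound
  have hB0 : 0 ≤ B := (abs_nonneg _).trans (hB 0).1
  have hTs : ContDiff ℝ ∞ Real.smoothTransition := Real.smoothTransition.contDiff
  set F : Eucl n → ℝ := fun x => ∑ i, pd (W i) i x with hF
  -- Zero where `D ≤ 2 ε` and one where `D ≥ 3 ε`, so that its gradient lives on the shell whose
  -- volume has been estimated.
  set χ : ℝ → Eucl n → ℝ := fun ε x => Real.smoothTransition (D x / ε - 2) with hχ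
  have hχ0 : ∀ ε x, 0 ≤ χ ε x := fun _ _ => Real.smoothTransition.nonneg _
  have hχ1 : ∀ ε x, χ ε x ≤ 1 := fun _ _ => Real.smoothTransition.le_one _
  have hχs : ∀ ε, ContDiffOn ℝ ∞ (χ ε) Ω := fun ε =>
    hTs.comp_contDiffOn ((hD.smooth.div_const ε).sub contDiffOn_const)
  have hχi : ∀ ε, IntegrableOn (fun x => χ ε x * F x) Ω := fun ε => by
    refine Integrable.bdd_mul (c := 1) hint
      ((hχs ε).continuousOn.aestronglyMeasurable hΩ.isOpen.measurableSet) ?_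
    exact Eventually.of_forall fun x => by
      rw [Real.norm_of_nonneg (hχ0 ε x)]; exact hχ1 ε x
  have hlim : Tendsto (fun ε => ∫ x in Ω, χ ε x * F x) (𝓝[>] 0) (𝓝 (∫ x in Ω, F x)) := by
    refine tendsto_integral_filter_of_dominated_convergence (fun x => ‖F x‖) ?_ ?_ hint.norm ?_
    · exact Eventually.of_forall fun ε => (hχi ε).aestronglyMeasurable
    · refine Eventually.of_forall fun ε => Eventually.of_forall fun x => ?_
      rw [norm_mul, Real.norm_of_nonneg (hχ0 ε x)]
      exact mul_le_of_le_one_left (norm_nonneg _) (hχ1 ε x)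
    · rw [ae_restrict_iff' hΩ.isOpen.measurableSet]
      refine Eventually.of_forall fun x hx => ?_
      have hpos := hD.pos_of_mem hΩ hn hx
      refine tendsto_const_nhds.congr' ?_
      filter_upwards [Ioo_mem_nhdsGT (show 0 < D x / 3 by positivity)] with ε hε
      have : 1 ≤ D x / ε - 2 := by
        rw [le_sub_iff_add_le, le_div_iff₀ hε.1]; linarith [hε.2]
      simp only [hχ]
      rw [Real.smoothTransition.one_of_one_le this, one_mul]
  -- The error is the gradient of the cutoff paired with the field: at most `B / ε` times a normal
  -- flux below `η`, on a set of volume at most `C * ε`. The powers of `ε` cancel.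
  have hsmall : ∀ η > 0, ∀ᶠ ε in 𝓝[>] (0 : ℝ), |∫ x in Ω, χ ε x * F x| ≤ B * C * η := by
    intro η hη
    obtain ⟨ε₀, hε₀, hfl⟩ := eventually_boundaryFilter.1
      (hflux.eventually (Metric.ball_mem_nhds 0 hη))
    filter_upwards [Ioo_mem_nhdsGT (show 0 < min (ε₀ / 4) (δ / 6) by positivity)] with ε hε
    have hε0 : 0 < ε := hε.1
    have hε1 : ε < ε₀ / 4 := hε.2.trans_le (min_le_left _ _)
    have hε2 : ε < δ / 6 := hε.2.trans_le (min_le_right _ _)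
    obtain ⟨hi, hz⟩ := integral_div_eq_zero_of_vanishing hΩ
      (W := fun i x => χ ε x * W i x) (ε := ε)
      (fun i => ((hχs ε).of_le (mod_cast le_top)).mul (hW i)) hε0 (fun i x hx hxd => by
        have : D x = bdryDist Ω x := hD.eq_dist x hx (by linarith)
        simp only [hχ]
        rw [Real.smoothTransition.zero_of_nonpos, zero_mul]
        rw [sub_nonpos, div_le_iff₀ hε0, this]
        linarith)
    have hdiv : ∀ x ∈ Ω, ∑ i, pd (fun x => χ ε x * W i x) i x - χ ε x * F x =
        deriv Real.smoothTransition (D x / ε - 2) / ε * ∑ i, W i x * pd D i x := by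
      intro x hx
      have hDd := hD.differentiableAt hΩ hx
      have hWd : ∀ i, DifferentiableAt ℝ (W i) x := fun i =>
        ((hW i).contDiffAt (hΩ.isOpen.mem_nhds hx)).differentiableAt (by norm_num)
      have hχd : DifferentiableAt ℝ (χ ε) x :=
        ((hχs ε).contDiffAt (hΩ.isOpen.mem_nhds hx)).differentiableAt (by simp)
      have hd : HasDerivAt (fun s : ℝ => Real.smoothTransition (s / ε - 2))
          (deriv Real.smoothTransition (D x / ε - 2) / ε) (D x) := by
        have h1 : HasDerivAt (fun s : ℝ => s / ε - 2) (1 / ε) (D x) :=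
          ((hasDerivAt_id (D x)).div_const ε).sub_const 2
        have h2 := (hTs.differentiable (by simp) (D x / ε - 2)).hasDerivAt.comp (D x) h1
        exact HasDerivAt.congr_deriv h2 (mul_one_div _ _)
      have h1 : ∀ i, pd (fun x => χ ε x * W i x) i x =
          χ ε x * pd (W i) i x +
            deriv Real.smoothTransition (D x / ε - 2) / ε * (W i x * pd D i x) := by
        intro i
        rw [pd_mul hχd (hWd i)]
        simp only [hχ]
        rw [pd_comp hd hDd]
        ring
      simp only [h1, hF]
      rw [Finset.sum_add_distrib, ← Finset.mul_sum, ← Finset.mul_sum]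
      ring
    have hneg : ∫ x in Ω, χ ε x * F x =
        -∫ x in Ω, deriv Real.smoothTransition (D x / ε - 2) / ε * ∑ i, W i x * pd D i x := by
      rw [← setIntegral_congr_fun hΩ.isOpen.measurableSet hdiv, integral_sub hi (hχi ε), hz]
      ring
    rw [hneg, abs_neg]
    set sh : Set (Eucl n) := {x ∈ Ω | 2 * ε ≤ bdryDist Ω x ∧ bdryDist Ω x ≤ 3 * ε} with hsh
    rw [setIntegral_eq_of_subset_of_forall_sdiff_eq_zero hΩ.isOpen.measurableSet
      (s := sh) (fun x h => h.1)]
    · have hb : ∀ x ∈ sh, ‖deriv Real.smoothTransition (D x / ε - 2) / ε *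
          ∑ i, W i x * pd D i x‖ ≤ B / ε * η := by
        intro x hx
        rw [norm_mul, norm_div, Real.norm_of_nonneg hε0.le]
        have h1 := hfl x hx.1 (by linarith [hx.2.2])
        rw [dist_zero_right] at h1
        exact mul_le_mul (div_le_div_of_nonneg_right (hB _).1 hε0.le) h1.le (norm_nonneg _)
          (by positivity)
      have hfin : volume sh < ⊤ :=
        (measure_mono (fun x h => h.1)).trans_lt hΩ.isBounded.measure_lt_top
      refine (norm_setIntegral_le_of_norm_le_const hfin hb).trans ?_
      calc B / ε * η * volume.real sh ≤ B / ε * η * (C * ε) :=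
            mul_le_mul_of_nonneg_left (hC ε hε0 (by linarith)) (by positivity)
        _ = B * C * η := by field_simp
    · intro x hx
      have hxs : D x / ε - 2 < 0 ∨ 1 < D x / ε - 2 := by
        by_contra! hcon
        apply hx.2
        have h1 : D x ≤ 3 * ε := by
          have := hcon.2
          rw [sub_le_iff_le_add, div_le_iff₀ hε0] at this
          linarith
        have h2 : 2 * ε ≤ D x := by
          have := hcon.1
          rwa [sub_nonneg, le_div_iff₀ hε0] at this
        have h3 := hD.eq_dist_of_lt hx.1 (by linarith)
        exact ⟨hx.1, by linarith, by linarith⟩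
      rw [(hB _).2 hxs]; simp
  have hfin : ∀ η > 0, |∫ x in Ω, F x| ≤ B * C * η := fun η hη =>
    le_of_tendsto hlim.abs (hsmall η hη)
  have h0 : Tendsto (fun η : ℝ => B * C * η) (𝓝[>] 0) (𝓝 0) := by
    have : Continuous fun η : ℝ => B * C * η := by fun_prop
    have h := (this.tendsto 0).mono_left (nhdsWithin_le_nhds (s := Ioi 0))
    simpa using h
  have := ge_of_tendsto h0 (eventually_mem_nhdsWithin.mono fun η hη => hfin η hη)
  exact abs_nonpos_iff.1 this

end IsCollarFunction
end Divergence

/-! ### Boundary regularity in terms of interior limits -/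

section Regularity
variable {n : ℕ} {Ω : Set (Eucl n)} {δ M : ℝ} {D u : Eucl n → ℝ}

lemma eventually_mem_boundaryFilter : ∀ᶠ x in boundaryFilter Ω, x ∈ Ω :=
  mem_inf_of_right (mem_principal_self Ω)

lemma IsBC.mul_tendsto_zero {f g : Eucl n → ℝ} (hg : IsBC Ω g)
    (hf : Tendsto f (boundaryFilter Ω) (𝓝 0)) :
    Tendsto (fun x => g x * f x) (boundaryFilter Ω) (𝓝 0) := by
  obtain ⟨B, hB⟩ := hg.2
  have h0 : Tendsto (fun x => B * ‖f x‖) (boundaryFilter Ω) (𝓝 0) := by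
    simpa using hf.norm.const_mul B
  refine squeeze_zero_norm' ?_ h0
  filter_upwards [eventually_mem_boundaryFilter] with x hx
  rw [norm_mul]
  exact mul_le_mul_of_nonneg_right (hB x hx) (norm_nonneg _)

/-- `u` is `C²` in `Ω` with bounded derivatives, and its gradient becomes orthogonal to that of `D`
at the boundary. -/
structure IsNeumannRegular (Ω : Set (Eucl n)) (D u : Eucl n → ℝ) : Prop where
  contDiffOn : ContDiffOn ℝ 2 u Ω
  isBC : IsBC Ω u
  isBC_pd : ∀ i, IsBC Ω (pd u i)
  isBC_pd_pd : ∀ i j, IsBC Ω (pd (pd u i) j)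
  flux : Tendsto (fun x => ∑ i, pd u i x * pd D i x) (boundaryFilter Ω) (𝓝 0)

lemma sum_pd_mul_eq (f : Eucl n → ℝ) (x v : Eucl n) :
    ∑ i, pd f i x * v i = fderiv ℝ f x v := by
  have hv : v = ∑ i, v i • EuclideanSpace.single i (1 : ℝ) := by
    ext j
    simp [Pi.single_apply]
  conv_rhs => rw [hv]
  rw [map_sum]
  refine Finset.sum_congr rfl fun i _ => ?_
  rw [map_smul, smul_eq_mul, mul_comm]
  rfl

/-- Boundedness is compactness of the closure. For the flux, the gradient of `D` at `x` is the
normal `ν` at the foot `y`, where the derivative of `u` along `ν` vanishes; uniform continuity of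
the derivative carries this to nearby `x`. -/
lemma isNeumannRegular (hΩ : IsSmoothBoundedDomain Ω) (hD : IsCollarFunction Ω δ M D)
    (hu : ContDiffOn ℝ 2 u (closure Ω)) (hN : NeumannCondition Ω u) : IsNeumannRegular Ω D u := by
  have hun := hΩ.uniqueDiffOn_closure
  have hK := hΩ.isCompact_closure
  set Du := fderivWithin ℝ u (closure Ω) with hDu
  have hDus : ContDiffOn ℝ 1 Du (closure Ω) := hu.fderivWithin hun (by norm_num)
  have hDDc : ContinuousOn (fderivWithin ℝ Du (closure Ω)) (closure Ω) :=
    hDus.continuousOn_fderivWithin hun (by norm_num)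
  have huΩ : ContDiffOn ℝ 2 u Ω := hu.mono subset_closure
  have hnh : ∀ x ∈ Ω, closure Ω ∈ 𝓝 x := fun x hx =>
    mem_of_superset (hΩ.isOpen.mem_nhds hx) subset_closure
  have h1 : ∀ x ∈ Ω, fderiv ℝ u x = Du x := fun x hx => (fderivWithin_of_mem_nhds (hnh x hx)).symm
  have h2 : ∀ x ∈ Ω, fderiv ℝ (fderiv ℝ u) x = fderivWithin ℝ Du (closure Ω) x := fun x hx => by
    rw [fderivWithin_of_mem_nhds (hnh x hx)]
    apply Filter.EventuallyEq.fderiv_eq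
    filter_upwards [hΩ.isOpen.mem_nhds hx] with y hy using h1 y hy
  have hpd1 : ∀ i, ContDiffOn ℝ 1 (pd u i) Ω := fun i =>
    contDiffOn_pd hΩ.isOpen huΩ (by norm_num)
  refine ⟨huΩ, ⟨huΩ.continuousOn, ?_⟩, fun i => ⟨(hpd1 i).continuousOn, ?_⟩, fun i j =>
    ⟨(contDiffOn_pd (m := 0) hΩ.isOpen (hpd1 i) (by norm_num)).continuousOn, ?_⟩, ?_⟩
  · obtain ⟨B, hB⟩ := hK.exists_bound_of_continuousOn hu.continuousOn
    exact ⟨B, fun x hx => hB x (subset_closure hx)⟩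
  · obtain ⟨B, hB⟩ := hK.exists_bound_of_continuousOn hDus.continuousOn
    refine ⟨B, fun x hx => ?_⟩
    have h3 := (fderiv ℝ u x).le_opNorm (EuclideanSpace.single i 1)
    rw [PiLp.norm_single, norm_one, mul_one] at h3
    exact h3.trans (by rw [h1 x hx]; exact hB x (subset_closure hx))
  · obtain ⟨B, hB⟩ := hK.exists_bound_of_continuousOn
      (E := Eucl n →L[ℝ] Eucl n →L[ℝ] ℝ) hDDc
    refine ⟨B, fun x hx => ?_⟩
    rw [pd_pd_eq (huΩ.contDiffAt (hΩ.isOpen.mem_nhds hx))]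
    have h4 := (fderiv ℝ (fderiv ℝ u) x (EuclideanSpace.single j 1)).le_opNorm
      (EuclideanSpace.single i 1)
    have h5 := (fderiv ℝ (fderiv ℝ u) x).le_opNorm (EuclideanSpace.single j 1)
    rw [PiLp.norm_single, norm_one, mul_one] at h4 h5
    exact h4.trans (h5.trans (by rw [h2 x hx]; exact hB x (subset_closure hx)))
  · have huc : UniformContinuousOn Du (closure Ω) :=
      hK.uniformContinuousOn_of_continuous hDus.continuousOn
    rw [Metric.uniformContinuousOn_iff] at huc
    rw [Metric.tendsto_nhds]
    intro η hη
    obtain ⟨τ, hτ, hτu⟩ := huc η hη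
    refine eventually_boundaryFilter.2 ⟨min τ δ, lt_min hτ hD.pos, fun x hx hxd => ?_⟩
    have hxδ := (hD.dist_lt_iff hx).1 (hxd.trans_le (min_le_right _ _))
    obtain ⟨y, hy, ν, hν, hxy, hpd⟩ := hD.normal x hx hxδ
    simp only [hpd]
    rw [sum_pd_mul_eq, h1 x hx, dist_zero_right]
    have hyN : Du y ν = 0 := hN y hy ν hν
    have h3 : Du x ν = (Du x - Du y) ν := by
      rw [sub_apply, hyN, sub_zero]
    rw [h3]
    refine ((Du x - Du y).le_opNorm ν).trans_lt ?_
    rw [hν.norm_eq_one, mul_one, ← dist_eq_norm]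
    refine hτu x (subset_closure hx) y (frontier_subset_closure hy) ?_
    rw [hxy, hD.eq_dist_of_lt hx hxδ]
    exact hxd.trans_le (min_le_left _ _)

end Regularity

/-! ### Green and Rellich identities -/

section Identities
variable {n : ℕ} {Ω : Set (Eucl n)} {δ M : ℝ} {D u : Eucl n → ℝ}

namespace IsNeumannRegular

lemma contDiffOn_pd (hΩ : IsSmoothBoundedDomain Ω) (hu : IsNeumannRegular Ω D u) (i : Fin n) :
    ContDiffOn ℝ 1 (pd u i) Ω := NeumannTrace.contDiffOn_pd hΩ.isOpen hu.contDiffOn (by norm_num)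

lemma contDiffOn_one (hu : IsNeumannRegular Ω D u) : ContDiffOn ℝ 1 u Ω :=
  hu.contDiffOn.of_le (by norm_num)

lemma differentiableAt (hΩ : IsSmoothBoundedDomain Ω) (hu : IsNeumannRegular Ω D u)
    {x : Eucl n} (hx : x ∈ Ω) : DifferentiableAt ℝ u x :=
  (hu.contDiffOn.contDiffAt (hΩ.isOpen.mem_nhds hx)).differentiableAt (by norm_num)

lemma differentiableAt_pd (hΩ : IsSmoothBoundedDomain Ω) (hu : IsNeumannRegular Ω D u)
    {x : Eucl n} (hx : x ∈ Ω) (i : Fin n) : DifferentiableAt ℝ (pd u i) x :=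
  ((hu.contDiffOn_pd hΩ i).contDiffAt (hΩ.isOpen.mem_nhds hx)).differentiableAt (by norm_num)

lemma pd_comm (hΩ : IsSmoothBoundedDomain Ω) (hu : IsNeumannRegular Ω D u)
    {x : Eucl n} (hx : x ∈ Ω) (i j : Fin n) : pd (pd u i) j x = pd (pd u j) i x :=
  NeumannTrace.pd_comm (hu.contDiffOn.contDiffAt (hΩ.isOpen.mem_nhds hx))

/-- Green's formula for `u` and itself. -/
lemma integral_energy (hΩ : IsSmoothBoundedDomain Ω) (hn : 1 ≤ n)
    (hD : IsCollarFunction Ω δ M D) (hu : IsNeumannRegular Ω D u) :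
    ∫ x in Ω, (∑ i, pd u i x ^ 2 + u x * ∑ i, pd (pd u i) i x) = 0 := by
  have hdiv : ∀ x ∈ Ω, ∑ i, pd (fun y => u y * pd u i y) i x =
      ∑ i, pd u i x ^ 2 + u x * ∑ i, pd (pd u i) i x := by
    intro x hx
    rw [Finset.mul_sum, ← Finset.sum_add_distrib]
    refine Finset.sum_congr rfl fun i _ => ?_
    rw [pd_mul (hu.differentiableAt hΩ hx) (hu.differentiableAt_pd hΩ hx i)]
    ring
  have hbc : IsBC Ω (fun x => ∑ i, pd u i x ^ 2 + u x * ∑ i, pd (pd u i) i x) :=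
    (IsBC.sum fun i _ => (hu.isBC_pd i).pow_two).add
      (hu.isBC.mul (IsBC.sum fun i _ => hu.isBC_pd_pd i i))
  rw [← setIntegral_congr_fun hΩ.isOpen.measurableSet hdiv]
  refine hD.integral_div_eq_zero hΩ hn (W := fun i y => u y * pd u i y)
    (fun i => hu.contDiffOn_one.mul (hu.contDiffOn_pd hΩ i))
    ((hbc.congr hdiv).integrableOn hΩ) ?_
  refine (hu.isBC.mul_tendsto_zero hu.flux).congr fun x => ?_
  rw [Finset.mul_sum]
  exact Finset.sum_congr rfl fun i _ => by ring

/-- Green's formula for `u²` and a function of `D`. -/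
lemma integral_green (hΩ : IsSmoothBoundedDomain Ω) (hn : 1 ≤ n)
    (hD : IsCollarFunction Ω δ M D) (hu : IsNeumannRegular Ω D u) {φ : ℝ → ℝ}
    (hφ : ContDiff ℝ ∞ φ) (hφ0 : deriv φ 0 = 0) :
    IsBC Ω (fun x => u x ^ 2 * (deriv (deriv φ) (D x) * ∑ i, pd D i x ^ 2 +
        deriv φ (D x) * ∑ i, pd (pd D i) i x) -
      2 * φ (D x) * (∑ i, pd u i x ^ 2 + u x * ∑ i, pd (pd u i) i x)) ∧
    ∫ x in Ω, (u x ^ 2 * (deriv (deriv φ) (D x) * ∑ i, pd D i x ^ 2 +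
        deriv φ (D x) * ∑ i, pd (pd D i) i x) -
      2 * φ (D x) * (∑ i, pd u i x ^ 2 + u x * ∑ i, pd (pd u i) i x)) = 0 := by
  have hφ1 : ContDiff ℝ ∞ (deriv φ) := by
    have := (contDiff_infty_iff_deriv).1 hφ
    exact this.2
  have hφ2 : ContDiff ℝ ∞ (deriv (deriv φ)) := by
    have := (contDiff_infty_iff_deriv).1 hφ1
    exact this.2
  have hφd : ∀ s, HasDerivAt φ (deriv φ s) s := fun s =>
    (hφ.differentiable (by simp) s).hasDerivAt
  have hφd1 : ∀ s, HasDerivAt (deriv φ) (deriv (deriv φ) s) s := fun s =>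
    (hφ1.differentiable (by simp) s).hasDerivAt
  set W : Fin n → Eucl n → ℝ := fun i y =>
    u y ^ 2 * (deriv φ (D y) * pd D i y) - (2 * φ (D y)) * (u y * pd u i y) with hW
  have hdiv : ∀ x ∈ Ω, ∑ i, pd (W i) i x =
      u x ^ 2 * (deriv (deriv φ) (D x) * ∑ i, pd D i x ^ 2 +
        deriv φ (D x) * ∑ i, pd (pd D i) i x) -
      2 * φ (D x) * (∑ i, pd u i x ^ 2 + u x * ∑ i, pd (pd u i) i x) := by
    intro x hx
    have hud := hu.differentiableAt hΩ hx
    have hDd := hD.differentiableAt hΩ hx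
    have h1 : DifferentiableAt ℝ (fun y => φ (D y)) x := (hφd _).differentiableAt.comp x hDd
    have h2 : DifferentiableAt ℝ (fun y => deriv φ (D y)) x :=
      (hφd1 _).differentiableAt.comp x hDd
    have key : ∀ i, pd (W i) i x =
        u x ^ 2 * (deriv (deriv φ) (D x) * pd D i x ^ 2) +
          u x ^ 2 * (deriv φ (D x) * pd (pd D i) i x) -
        (2 * φ (D x) * pd u i x ^ 2 + 2 * φ (D x) * (u x * pd (pd u i) i x)) := by
      intro i
      have hDi := hD.differentiableAt_pd hΩ hx i
      have hui := hu.differentiableAt_pd hΩ hx i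
      simp only [hW]
      rw [pd_sub ((hud.fun_pow 2).fun_mul (h2.fun_mul hDi))
          ((h1.const_mul 2).fun_mul (hud.fun_mul hui)),
        pd_mul (hud.fun_pow 2) (h2.fun_mul hDi), pd_mul h2 hDi, pd_comp (hφd1 _) hDd,
        pd_pow_two hud, pd_mul (h1.const_mul 2) (hud.fun_mul hui), pd_mul hud hui,
        pd_const_mul 2 h1, pd_comp (hφd _) hDd]
      ring
    simp only [key, Finset.sum_sub_distrib, Finset.sum_add_distrib, ← Finset.mul_sum]
    ring
  have hbc : IsBC Ω (fun x => u x ^ 2 * (deriv (deriv φ) (D x) * ∑ i, pd D i x ^ 2 +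
        deriv φ (D x) * ∑ i, pd (pd D i) i x) -
      2 * φ (D x) * (∑ i, pd u i x ^ 2 + u x * ∑ i, pd (pd u i) i x)) := by
    have a1 := IsBC.comp hφ.continuous hD.isBC
    have a2 := IsBC.comp hφ1.continuous hD.isBC
    have a3 := IsBC.comp hφ2.continuous hD.isBC
    have b1 : IsBC Ω (fun x => ∑ i, pd D i x ^ 2) := IsBC.sum fun i _ => (hD.isBC_pd hΩ i).pow_two
    have b2 : IsBC Ω (fun x => ∑ i, pd (pd D i) i x) := IsBC.sum fun i _ => hD.isBC_pd_pd hΩ i i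
    have b3 : IsBC Ω (fun x => ∑ i, pd u i x ^ 2) := IsBC.sum fun i _ => (hu.isBC_pd i).pow_two
    have b4 : IsBC Ω (fun x => ∑ i, pd (pd u i) i x) := IsBC.sum fun i _ => hu.isBC_pd_pd i i
    exact (hu.isBC.pow_two.mul ((a3.mul b1).add (a2.mul b2))).sub
      (((IsBC.const 2).mul a1).mul (b3.add (hu.isBC.mul b4)))
  refine ⟨hbc, ?_⟩
  rw [← setIntegral_congr_fun hΩ.isOpen.measurableSet hdiv]
  refine hD.integral_div_eq_zero hΩ hn (W := W) (fun i => ?_)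
    ((hbc.congr hdiv).integrableOn hΩ) ?_
  · have c1 : ContDiffOn ℝ 1 (fun y => φ (D y)) Ω :=
      (hφ.of_le (mod_cast le_top)).comp_contDiffOn hD.contDiffOn_one
    have c2 : ContDiffOn ℝ 1 (fun y => deriv φ (D y)) Ω :=
      (hφ1.of_le (mod_cast le_top)).comp_contDiffOn hD.contDiffOn_one
    have c3 : ContDiffOn ℝ 1 (pd D i) Ω := (hD.contDiffOn_pd hΩ i).of_le (mod_cast le_top)
    exact ((hu.contDiffOn_one.pow 2).mul (c2.mul c3)).sub
      ((contDiffOn_const.mul c1).mul (hu.contDiffOn_one.mul (hu.contDiffOn_pd hΩ i)))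
  -- The two boundary terms vanish for different reasons: that of `u² ∇φ(D)` because `φ'(0) = 0`,
  -- that of `φ(D) u ∇u` by the Neumann condition.
  · have t1 : Tendsto (fun x => deriv φ (D x)) (boundaryFilter Ω) (𝓝 0) := by
      have := (hφ1.continuous.tendsto 0).comp hD.tendsto_zero
      rwa [hφ0] at this
    have t2 := (hu.isBC.pow_two.mul
      (IsBC.sum fun i (_ : i ∈ Finset.univ) => (hD.isBC_pd hΩ i).pow_two)).mul_tendsto_zero t1
    have t3 := (((IsBC.const 2).mul (IsBC.comp hφ.continuous hD.isBC)).mul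
      hu.isBC).mul_tendsto_zero hu.flux
    have t4 := t2.sub t3
    rw [sub_zero] at t4
    refine t4.congr fun x => ?_
    simp only [hW, sub_mul, Finset.sum_sub_distrib, Finset.mul_sum, Finset.sum_mul]
    congr 1 <;> exact Finset.sum_congr rfl fun i _ => by ring

/-- The Rellich identity for the vector field `a(D) ∇D`. -/
lemma integral_rellich (hΩ : IsSmoothBoundedDomain Ω) (hn : 1 ≤ n)
    (hD : IsCollarFunction Ω δ M D) (hu : IsNeumannRegular Ω D u) {a a' : ℝ → ℝ}
    (ha : ∀ s, HasDerivAt a (a' s) s) (ha' : Continuous a') (ha0 : a 0 = 0) (h : ℝ) :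
    IsBC Ω (fun x => a' (D x) * (2 * h ^ 2 * (∑ i, pd u i x * pd D i x) ^ 2 +
          (u x ^ 2 - h ^ 2 * ∑ i, pd u i x ^ 2) * ∑ i, pd D i x ^ 2) +
        a (D x) * (2 * h ^ 2 * (∑ i, ∑ j, pd u i x * pd u j x * pd (pd D j) i x) +
          (u x ^ 2 - h ^ 2 * ∑ i, pd u i x ^ 2) * ∑ i, pd (pd D i) i x +
          2 * (∑ i, pd u i x * pd D i x) * (h ^ 2 * ∑ i, pd (pd u i) i x + u x))) ∧
    ∫ x in Ω, (a' (D x) * (2 * h ^ 2 * (∑ i, pd u i x * pd D i x) ^ 2 +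
          (u x ^ 2 - h ^ 2 * ∑ i, pd u i x ^ 2) * ∑ i, pd D i x ^ 2) +
        a (D x) * (2 * h ^ 2 * (∑ i, ∑ j, pd u i x * pd u j x * pd (pd D j) i x) +
          (u x ^ 2 - h ^ 2 * ∑ i, pd u i x ^ 2) * ∑ i, pd (pd D i) i x +
          2 * (∑ i, pd u i x * pd D i x) * (h ^ 2 * ∑ i, pd (pd u i) i x + u x))) = 0 := by
  have hacont : Continuous a := continuous_iff_continuousAt.2 fun s => (ha s).continuousAt
  have hac : ContDiff ℝ 1 a := by
    rw [contDiff_one_iff_deriv]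
    refine ⟨fun s => (ha s).differentiableAt, ?_⟩
    rwa [show deriv a = a' from funext fun s => (ha s).deriv]
  set S : Eucl n → ℝ := fun x => ∑ i, pd u i x * pd D i x with hS
  set Q : Eucl n → ℝ := fun x => ∑ i, pd u i x ^ 2 with hQ
  -- The Rellich field `a(D) (2 h² ⟨∇u, ∇D⟩ ∇u + (u² - h² |∇u|²) ∇D)`; its flux disappears at the
  -- boundary because `a(0) = 0`.
  set W : Fin n → Eucl n → ℝ := fun i y =>
    a (D y) * ((2 * h ^ 2) * (S y * pd u i y) + (u y ^ 2 - h ^ 2 * Q y) * pd D i y) with hW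
  have hdiv : ∀ x ∈ Ω, ∑ i, pd (W i) i x =
      a' (D x) * (2 * h ^ 2 * S x ^ 2 + (u x ^ 2 - h ^ 2 * Q x) * ∑ i, pd D i x ^ 2) +
        a (D x) * (2 * h ^ 2 * (∑ i, ∑ j, pd u i x * pd u j x * pd (pd D j) i x) +
          (u x ^ 2 - h ^ 2 * Q x) * ∑ i, pd (pd D i) i x +
          2 * S x * (h ^ 2 * ∑ i, pd (pd u i) i x + u x)) := by
    intro x hx
    have hud := hu.differentiableAt hΩ hx
    have hDd := hD.differentiableAt hΩ hx
    have hDi := hD.differentiableAt_pd hΩ hx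
    have hui := hu.differentiableAt_pd hΩ hx
    have h1 : DifferentiableAt ℝ (fun y => a (D y)) x := (ha _).differentiableAt.comp x hDd
    have hSd : DifferentiableAt ℝ S x :=
      DifferentiableAt.fun_sum fun i _ => (hui i).mul (hDi i)
    have hQd : DifferentiableAt ℝ Q x := DifferentiableAt.fun_sum fun i _ => (hui i).pow 2
    have hSpd : ∀ i, pd S i x = ∑ j, pd u j x * pd (pd D j) i x +
        ∑ j, pd D j x * pd (pd u j) i x := by
      intro i
      simp only [hS]
      rw [pd_sum _ fun j _ => (hui j).fun_mul (hDi j), ← Finset.sum_add_distrib]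
      exact Finset.sum_congr rfl fun j _ => pd_mul (hui j) (hDi j)
    have hQpd : ∀ i, pd Q i x = 2 * ∑ j, pd u j x * pd (pd u j) i x := by
      intro i
      simp only [hQ]
      rw [pd_sum _ fun j _ => (hui j).fun_pow 2, Finset.mul_sum]
      exact Finset.sum_congr rfl fun j _ => by rw [pd_pow_two (hui j)]; ring
    have hgd : DifferentiableAt ℝ (fun y => u y ^ 2 - h ^ 2 * Q y) x :=
      (hud.pow 2).sub (hQd.const_mul _)
    have key : ∀ i, pd (W i) i x =
        a' (D x) * (2 * h ^ 2 * S x) * (pd u i x * pd D i x) +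
        a' (D x) * (u x ^ 2 - h ^ 2 * Q x) * pd D i x ^ 2 +
        a (D x) * (2 * h ^ 2) * (pd u i x * ∑ j, pd u j x * pd (pd D j) i x) +
        a (D x) * (2 * h ^ 2) * (pd u i x * ∑ j, pd D j x * pd (pd u j) i x) +
        a (D x) * (2 * h ^ 2 * S x) * pd (pd u i) i x +
        a (D x) * (2 * u x) * (pd u i x * pd D i x) +
        -(a (D x) * (2 * h ^ 2)) * (pd D i x * ∑ j, pd u j x * pd (pd u j) i x) +
        a (D x) * (u x ^ 2 - h ^ 2 * Q x) * pd (pd D i) i x := by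
      intro i
      simp only [hW]
      rw [pd_mul h1 (((hSd.fun_mul (hui i)).const_mul _).fun_add (hgd.fun_mul (hDi i))),
        pd_add ((hSd.fun_mul (hui i)).const_mul _) (hgd.fun_mul (hDi i)),
        pd_const_mul _ (hSd.fun_mul (hui i)), pd_mul hSd (hui i), pd_mul hgd (hDi i),
        pd_sub (hud.fun_pow 2) (hQd.const_mul _), pd_pow_two hud, pd_const_mul _ hQd,
        pd_comp (ha _) hDd, hSpd, hQpd]
      ring
    -- By symmetry of the Hessian, the second derivatives of `u` coming from `∇S` and from `∇Q`
    -- cancel; only the Laplacian of `u` is left.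
    have hsymm : ∑ i, (pd D i x * ∑ j, pd u j x * pd (pd u j) i x) =
        ∑ i, (pd u i x * ∑ j, pd D j x * pd (pd u j) i x) := by
      simp only [Finset.mul_sum]
      rw [Finset.sum_comm]
      refine Finset.sum_congr rfl fun i _ => Finset.sum_congr rfl fun j _ => ?_
      rw [hu.pd_comm hΩ hx i j]; ring
    have hhess : ∑ i, (pd u i x * ∑ j, pd u j x * pd (pd D j) i x) =
        ∑ i, ∑ j, pd u i x * pd u j x * pd (pd D j) i x := by
      simp only [Finset.mul_sum, mul_assoc]
    simp only [key, Finset.sum_add_distrib, ← Finset.mul_sum]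
    rw [hsymm, hhess, show ∑ i, pd u i x * pd D i x = S x from rfl]
    ring
  have bS : IsBC Ω S := IsBC.sum fun i _ => (hu.isBC_pd i).mul (hD.isBC_pd hΩ i)
  have bQ : IsBC Ω Q := IsBC.sum fun i _ => (hu.isBC_pd i).pow_two
  have bg : IsBC Ω (fun x => u x ^ 2 - h ^ 2 * Q x) :=
    hu.isBC.pow_two.sub ((IsBC.const _).mul bQ)
  have ba := IsBC.comp hacont hD.isBC
  have ba' := IsBC.comp ha' hD.isBC
  have bDD : IsBC Ω (fun x => ∑ i, pd D i x ^ 2) := IsBC.sum fun i _ => (hD.isBC_pd hΩ i).pow_two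
  have bL : IsBC Ω (fun x => ∑ i, pd (pd D i) i x) := IsBC.sum fun i _ => hD.isBC_pd_pd hΩ i i
  have bH : IsBC Ω (fun x => ∑ i, ∑ j, pd u i x * pd u j x * pd (pd D j) i x) :=
    IsBC.sum fun i _ => IsBC.sum fun j _ =>
      ((hu.isBC_pd i).mul (hu.isBC_pd j)).mul (hD.isBC_pd_pd hΩ j i)
  have bU : IsBC Ω (fun x => ∑ i, pd (pd u i) i x) := IsBC.sum fun i _ => hu.isBC_pd_pd i i
  have hbc : IsBC Ω (fun x =>
      a' (D x) * (2 * h ^ 2 * S x ^ 2 + (u x ^ 2 - h ^ 2 * Q x) * ∑ i, pd D i x ^ 2) +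
        a (D x) * (2 * h ^ 2 * (∑ i, ∑ j, pd u i x * pd u j x * pd (pd D j) i x) +
          (u x ^ 2 - h ^ 2 * Q x) * ∑ i, pd (pd D i) i x +
          2 * S x * (h ^ 2 * ∑ i, pd (pd u i) i x + u x))) :=
    (ba'.mul (((IsBC.const _).mul bS.pow_two).add (bg.mul bDD))).add
      (ba.mul ((((IsBC.const _).mul bH).add (bg.mul bL)).add
        (((IsBC.const 2).mul bS).mul (((IsBC.const _).mul bU).add hu.isBC))))
  refine ⟨hbc, ?_⟩
  rw [← setIntegral_congr_fun hΩ.isOpen.measurableSet hdiv]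
  refine hD.integral_div_eq_zero hΩ hn (W := W) (fun i => ?_)
    ((hbc.congr hdiv).integrableOn hΩ) ?_
  · have c1 : ContDiffOn ℝ 1 (fun y => a (D y)) Ω := hac.comp_contDiffOn hD.contDiffOn_one
    have c3 : ∀ i, ContDiffOn ℝ 1 (pd D i) Ω := fun i =>
      (hD.contDiffOn_pd hΩ i).of_le (mod_cast le_top)
    have c4 := hu.contDiffOn_pd hΩ
    have cS : ContDiffOn ℝ 1 S Ω := ContDiffOn.sum fun i _ => (c4 i).mul (c3 i)
    have cQ : ContDiffOn ℝ 1 Q Ω := ContDiffOn.sum fun i _ => (c4 i).pow 2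
    exact c1.mul ((contDiffOn_const.mul (cS.mul (c4 i))).add
      (((hu.contDiffOn_one.pow 2).sub (contDiffOn_const.mul cQ)).mul (c3 i)))
  · have t1 : Tendsto (fun x => a (D x)) (boundaryFilter Ω) (𝓝 0) := by
      have := (hacont.tendsto 0).comp hD.tendsto_zero
      rwa [ha0] at this
    have t2 := (((IsBC.const (2 * h ^ 2)).mul bS.pow_two).add (bg.mul bDD)).mul_tendsto_zero t1
    refine t2.congr fun x => ?_
    have e1 : ∀ i, W i x * pd D i x = a (D x) * (2 * h ^ 2 * S x) * (pd u i x * pd D i x) +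
        a (D x) * (u x ^ 2 - h ^ 2 * Q x) * pd D i x ^ 2 := fun i => by simp only [hW]; ring
    simp only [e1, Finset.sum_add_distrib, ← Finset.mul_sum]
    rw [show ∑ i, pd u i x * pd D i x = S x from rfl]
    ring

end IsNeumannRegular
end Identities

/-! ### Energy estimates tested against functions of the distance -/

section Estimates
variable {n : ℕ} {Ω : Set (Eucl n)} {δ M : ℝ} {D u f : Eucl n → ℝ} {h : ℝ}

lemma sq_sum_pd_mul_le (hD : IsCollarFunction Ω δ M D) {x : Eucl n} (hx : x ∈ Ω) (p : Fin n → ℝ) :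
    (∑ i, p i * pd D i x) ^ 2 ≤ n * M ^ 2 * ∑ i, p i ^ 2 := by
  refine (Finset.sum_mul_sq_le_sq_mul_sq _ _ _).trans ?_
  rw [mul_comm]
  refine mul_le_mul_of_nonneg_right ?_ (Finset.sum_nonneg fun i _ => sq_nonneg _)
  calc ∑ i, pd D i x ^ 2 ≤ ∑ _i : Fin n, M ^ 2 :=
        Finset.sum_le_sum fun i _ => sq_le_sq' (_root_.abs_le.1 (hD.pd_le x hx i)).1
          (_root_.abs_le.1 (hD.pd_le x hx i)).2
    _ = n * M ^ 2 := by simp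

lemma abs_hessian_le (hD : IsCollarFunction Ω δ M D) {x : Eucl n} (hx : x ∈ Ω) (p : Fin n → ℝ) :
    |∑ i, ∑ j, p i * p j * pd (pd D j) i x| ≤ n * M * ∑ i, p i ^ 2 := by
  have hM : 0 ≤ M := (abs_nonneg _).trans (hD.abs_le x hx)
  have h1 : ∀ i j, |p i * p j * pd (pd D j) i x| ≤ M / 2 * p i ^ 2 + M / 2 * p j ^ 2 := by
    intro i j
    rw [abs_mul]
    have h2 : |p i * p j| ≤ (p i ^ 2 + p j ^ 2) / 2 := by
      rw [_root_.abs_le]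
      constructor <;> nlinarith [sq_nonneg (p i + p j), sq_nonneg (p i - p j)]
    calc _ ≤ (p i ^ 2 + p j ^ 2) / 2 * M :=
          mul_le_mul h2 (hD.pd_pd_le x hx j i) (abs_nonneg _) (by positivity)
      _ = _ := by ring
  calc _ ≤ ∑ i, |∑ j, p i * p j * pd (pd D j) i x| := Finset.abs_sum_le_sum_abs _ _
    _ ≤ ∑ i, ∑ j, |p i * p j * pd (pd D j) i x| :=
        Finset.sum_le_sum fun i _ => Finset.abs_sum_le_sum_abs _ _
    _ ≤ ∑ i, ∑ j, (M / 2 * p i ^ 2 + M / 2 * p j ^ 2) :=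
        Finset.sum_le_sum fun i _ => Finset.sum_le_sum fun j _ => h1 i j
    _ = n * M * ∑ i, p i ^ 2 := by
        simp only [Finset.sum_add_distrib, Finset.sum_const, Finset.card_univ, Fintype.card_fin,
          nsmul_eq_mul, ← Finset.mul_sum]
        ring

lemma abs_laplacian_le (hD : IsCollarFunction Ω δ M D) {x : Eucl n} (hx : x ∈ Ω) :
    |∑ i, pd (pd D i) i x| ≤ n * M := by
  calc _ ≤ ∑ i, |pd (pd D i) i x| := Finset.abs_sum_le_sum_abs _ _
    _ ≤ ∑ i : Fin n, M := Finset.sum_le_sum fun i _ => hD.pd_pd_le x hx i i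
    _ = n * M := by simp

lemma abs_normalEnergy_term_le {u f h S Q q : ℝ} (hQ : 0 ≤ Q) (hq : 0 ≤ q) (hS : S ^ 2 ≤ q * Q) :
    |2 * h ^ 2 * S ^ 2 + (u ^ 2 - h ^ 2 * Q)| ≤
      (2 * q + 1) * (u ^ 2 + h⁻¹ ^ 2 * f ^ 2 + h ^ 2 * Q) := by
  have a1 : 0 ≤ h ^ 2 * Q := by positivity
  have a2 : 0 ≤ h⁻¹ ^ 2 * f ^ 2 := by positivity
  have a3 : 0 ≤ h ^ 2 * S ^ 2 := by positivity
  have a4 : h ^ 2 * S ^ 2 ≤ q * (h ^ 2 * Q) := by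
    calc h ^ 2 * S ^ 2 ≤ h ^ 2 * (q * Q) := mul_le_mul_of_nonneg_left hS (sq_nonneg h)
      _ = _ := by ring
  have a5 := mul_nonneg hq a1
  have a6 := mul_nonneg hq a2
  have a7 := mul_nonneg hq (sq_nonneg u)
  have a8 := sq_nonneg u
  rw [_root_.abs_le]
  constructor <;> linarith

/-- The cross term is split as `2 (h S) (h⁻¹ f)`, which is where the weight `h⁻²` on `f²`
originates. -/
lemma abs_rellich_remainder_le {u f h S Q H L p q : ℝ} (hh : 0 < h) (hQ : 0 ≤ Q) (hp : 0 ≤ p)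
    (hq : 0 ≤ q) (hS : S ^ 2 ≤ q * Q) (hH : |H| ≤ p * Q) (hL : |L| ≤ p) :
    |2 * h ^ 2 * H + (u ^ 2 - h ^ 2 * Q) * L + 2 * S * (-f)| ≤
      (3 * p + q + 1) * (u ^ 2 + h⁻¹ ^ 2 * f ^ 2 + h ^ 2 * Q) := by
  have a1 : 0 ≤ h ^ 2 * Q := by positivity
  have a2 : 0 ≤ h⁻¹ ^ 2 * f ^ 2 := by positivity
  have a8 := sq_nonneg u
  have r1 : |2 * h ^ 2 * H| ≤ 2 * p * (h ^ 2 * Q) := by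
    rw [abs_mul, abs_of_nonneg (by positivity : (0 : ℝ) ≤ 2 * h ^ 2)]
    calc 2 * h ^ 2 * |H| ≤ 2 * h ^ 2 * (p * Q) := mul_le_mul_of_nonneg_left hH (by positivity)
      _ = _ := by ring
  have r2 : |(u ^ 2 - h ^ 2 * Q) * L| ≤ p * (u ^ 2 + h ^ 2 * Q) := by
    rw [abs_mul, mul_comm]
    refine mul_le_mul hL ?_ (abs_nonneg _) hp
    rw [_root_.abs_le]
    constructor <;> linarith
  have r3 : |2 * S * (-f)| ≤ q * (h ^ 2 * Q) + h⁻¹ ^ 2 * f ^ 2 := by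
    have e1 : 2 * S * (-f) = -(2 * (h * S) * (h⁻¹ * f)) := by field_simp
    have e2 : (h * S) ^ 2 ≤ q * (h ^ 2 * Q) := by
      calc (h * S) ^ 2 = h ^ 2 * S ^ 2 := by ring
        _ ≤ h ^ 2 * (q * Q) := mul_le_mul_of_nonneg_left hS (sq_nonneg h)
        _ = _ := by ring
    have e3 : (h⁻¹ * f) ^ 2 = h⁻¹ ^ 2 * f ^ 2 := mul_pow _ _ _
    rw [e1, abs_neg, _root_.abs_le]
    have e4 := sq_nonneg (h * S + h⁻¹ * f)
    have e5 := sq_nonneg (h * S - h⁻¹ * f)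
    rw [add_sq] at e4
    rw [sub_sq] at e5
    constructor <;> linarith
  have b1 := mul_nonneg hp a1
  have b2 := mul_nonneg hp a2
  have b3 := mul_nonneg hp a8
  have b4 := mul_nonneg hq a2
  have b5 := mul_nonneg hq a8
  refine (abs_add_le _ _).trans ((add_le_add ((abs_add_le _ _).trans (add_le_add r1 r2)) r3).trans ?_)
  linarith

/-- The energy density of `u` in the direction normal to the level sets of `D`. -/
noncomputable def normalEnergy (D u : Eucl n → ℝ) (h : ℝ) (x : Eucl n) : ℝ :=
  2 * h ^ 2 * (∑ i, pd u i x * pd D i x) ^ 2 + (u x ^ 2 - h ^ 2 * ∑ i, pd u i x ^ 2)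

/-- The density whose integral controls `u`, where `f = (h² Δ - 1) u`. -/
noncomputable def dataDensity (u f : Eucl n → ℝ) (h : ℝ) (x : Eucl n) : ℝ :=
  u x ^ 2 + h⁻¹ ^ 2 * f x ^ 2

namespace IsNeumannRegular

lemma isBC_data (hu : IsNeumannRegular Ω D u)
    (hf : ∀ x ∈ Ω, f x = -(h ^ 2 * ∑ i, pd (pd u i) i x) - u x) : IsBC Ω f :=
  ((((IsBC.const (h ^ 2)).mul (IsBC.sum fun i (_ : i ∈ Finset.univ) => hu.isBC_pd_pd i i)).neg).sub
    hu.isBC).congr hf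

lemma isBC_dataDensity (hu : IsNeumannRegular Ω D u)
    (hf : ∀ x ∈ Ω, f x = -(h ^ 2 * ∑ i, pd (pd u i) i x) - u x) : IsBC Ω (dataDensity u f h) :=
  hu.isBC.pow_two.add ((IsBC.const _).mul (hu.isBC_data hf).pow_two)

lemma isBC_normalEnergy (hΩ : IsSmoothBoundedDomain Ω) (hD : IsCollarFunction Ω δ M D)
    (hu : IsNeumannRegular Ω D u) : IsBC Ω (normalEnergy D u h) :=
  ((IsBC.const _).mul (IsBC.sum fun i (_ : i ∈ Finset.univ) =>
    (hu.isBC_pd i).mul (hD.isBC_pd hΩ i)).pow_two).add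
    (hu.isBC.pow_two.sub ((IsBC.const _).mul
      (IsBC.sum fun i (_ : i ∈ Finset.univ) => (hu.isBC_pd i).pow_two)))

/-- Pairing the equation with `u` gives `h² ∫ |∇u|² = ∫ (u² + u f)`, and `u f` is absorbed because
`f² ≤ h⁻² f²` for `h ≤ 1`. -/
lemma integral_gradient_le (hΩ : IsSmoothBoundedDomain Ω) (hn : 1 ≤ n)
    (hD : IsCollarFunction Ω δ M D) (hu : IsNeumannRegular Ω D u) (hh : 0 < h) (hh1 : h ≤ 1)
    (hf : ∀ x ∈ Ω, f x = -(h ^ 2 * ∑ i, pd (pd u i) i x) - u x) :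
    ∫ x in Ω, (dataDensity u f h x + h ^ 2 * ∑ i, pd u i x ^ 2) ≤
      3 * ∫ x in Ω, dataDensity u f h x := by
  have bQ : IsBC Ω (fun x => ∑ i, pd u i x ^ 2) := IsBC.sum fun i _ => (hu.isBC_pd i).pow_two
  have bU : IsBC Ω (fun x => ∑ i, pd (pd u i) i x) := IsBC.sum fun i _ => hu.isBC_pd_pd i i
  have bw := hu.isBC_dataDensity hf
  have bE := (IsBC.const (h ^ 2)).mul (bQ.add (hu.isBC.mul bU))
  have hpt : ∀ x ∈ Ω, dataDensity u f h x + h ^ 2 * ∑ i, pd u i x ^ 2 ≤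
      h ^ 2 * (∑ i, pd u i x ^ 2 + u x * ∑ i, pd (pd u i) i x) + 3 * dataDensity u f h x := by
    intro x hx
    have h1 := hf x hx
    have h2 : f x ^ 2 ≤ h⁻¹ ^ 2 * f x ^ 2 := by
      have : 1 ≤ h⁻¹ := (one_le_inv₀ hh).2 hh1
      exact le_mul_of_one_le_left (sq_nonneg _) (one_le_pow₀ this)
    have h3 : h ^ 2 * ∑ i, pd (pd u i) i x = -u x - f x := by linarith
    have h4 : h ^ 2 * (u x * ∑ i, pd (pd u i) i x) = u x * (-u x - f x) := by
      rw [← h3]; ring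
    unfold dataDensity
    rw [mul_add, h4]
    nlinarith [sq_nonneg (u x - f x), sq_nonneg (f x), sq_nonneg (u x)]
  have hi1 := (bw.add ((IsBC.const (h ^ 2)).mul bQ)).integrableOn hΩ
  have hi2 := bE.integrableOn hΩ
  have hi3 := (bw.integrableOn hΩ).const_mul 3
  have hmono := setIntegral_mono_on hi1 (hi2.add hi3) hΩ.isOpen.measurableSet hpt
  simp only [Pi.add_apply] at hmono
  rw [integral_add hi2 hi3, integral_const_mul, integral_const_mul,
    hu.integral_energy hΩ hn hD] at hmono
  linarith

/-- The normal energy does not concentrate on level sets of `D`. -/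
lemma exists_integral_normalEnergy_le (hΩ : IsSmoothBoundedDomain Ω) (hn : 1 ≤ n)
    (hD : IsCollarFunction Ω δ M D) :
    ∃ K : ℝ, 0 ≤ K ∧ ∀ (u f : Eucl n → ℝ) (h : ℝ), IsNeumannRegular Ω D u → 0 < h → h ≤ 1 →
      (∀ x ∈ Ω, f x = -(h ^ 2 * ∑ i, pd (pd u i) i x) - u x) →
      ∀ (φ : ℝ → ℝ) (A : ℝ), Continuous φ → (∀ s, 0 ≤ φ s) → (∀ s, 2 / 3 * δ ≤ s → φ s = 0) →
      (∀ s, 0 ≤ s → ∫ t in (0 : ℝ)..s, φ t ≤ A) →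
      ∫ x in Ω, φ (D x) * normalEnergy D u h x ≤ K * A * ∫ x in Ω, dataDensity u f h x := by
  have hδ := hD.pos
  obtain ⟨θ, B, hθs, hθ0, hθ1, hθl, hθr, hθB⟩ :=
    -- The cutoff is one wherever `φ` can be nonzero and vanishes before `D` reaches `δ`, beyond
    -- which the eikonal equation is not available.
    exists_smooth_cutoff (show 2 / 3 * δ < 5 / 6 * δ by linarith)
  have hB0 : 0 ≤ B := (abs_nonneg _).trans (hθB 0)
  obtain ⟨x₀, hx₀⟩ := hΩ.isConnected.nonempty
  have hM : 0 ≤ M := (abs_nonneg _).trans (hD.abs_le x₀ hx₀)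
  set K₁ : ℝ := 2 * (n * M ^ 2) + 1 with hK₁
  set K₂ : ℝ := 3 * (n * M) + n * M ^ 2 + 1 with hK₂
  have hK₁0 : 0 ≤ K₁ := by positivity
  have hK₂0 : 0 ≤ K₂ := by positivity
  refine ⟨3 * (B * K₁ + K₂), by positivity, fun u f h hu hh hh1 hf φ A hφ hφ0 hφr hA => ?_⟩
  have hA0 : 0 ≤ A := by simpa using hA 0 le_rfl
  set Φ : ℝ → ℝ := fun s => ∫ t in (0 : ℝ)..s, φ t with hΦ
  have hΦd : ∀ s, HasDerivAt Φ (φ s) s := fun s =>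
    intervalIntegral.integral_hasDerivAt_right (hφ.intervalIntegrable _ _)
      (hφ.stronglyMeasurableAtFilter _ _) hφ.continuousAt
  have hΦc : Continuous Φ := continuous_iff_continuousAt.2 fun s => (hΦd s).continuousAt
  -- The leading Rellich term is `a'` times the normal energy, and `a'` is `φ` plus `θ' Φ`. Only the
  -- size `A` of the primitive enters the remainders, never the height of `φ`.
  set a : ℝ → ℝ := fun s => θ s * Φ s with ha
  set a' : ℝ → ℝ := fun s => deriv θ s * Φ s + θ s * φ s with ha'
  have had : ∀ s, HasDerivAt a (a' s) s := fun s =>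
    (hθs.differentiable (by simp) s).hasDerivAt.mul (hΦd s)
  have ha'c : Continuous a' :=
    ((hθs.continuous_deriv (by simp)).mul hΦc).add (hθs.continuous.mul hφ)
  obtain ⟨bT, hT⟩ := hu.integral_rellich hΩ hn hD had ha'c (by simp [ha, hΦ]) h
  set T : Eucl n → ℝ := fun x => a' (D x) * (2 * h ^ 2 * (∑ i, pd u i x * pd D i x) ^ 2 +
          (u x ^ 2 - h ^ 2 * ∑ i, pd u i x ^ 2) * ∑ i, pd D i x ^ 2) +
        a (D x) * (2 * h ^ 2 * (∑ i, ∑ j, pd u i x * pd u j x * pd (pd D j) i x) +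
          (u x ^ 2 - h ^ 2 * ∑ i, pd u i x ^ 2) * ∑ i, pd (pd D i) i x +
          2 * (∑ i, pd u i x * pd D i x) * (h ^ 2 * ∑ i, pd (pd u i) i x + u x)) with hTdef
  have hpt : ∀ x ∈ Ω, φ (D x) * normalEnergy D u h x ≤
      T x + (B * K₁ + K₂) * A * (dataDensity u f h x + h ^ 2 * ∑ i, pd u i x ^ 2) := by
    intro x hx
    have hQ0 : 0 ≤ ∑ i, pd u i x ^ 2 := Finset.sum_nonneg fun i _ => sq_nonneg _
    have hw0 : 0 ≤ dataDensity u f h x := by unfold dataDensity; positivity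
    rcases lt_or_ge (D x) δ with hlt | hge
    · have hS := sq_sum_pd_mul_le hD hx fun i => pd u i x
      have hH := abs_hessian_le hD hx fun i => pd u i x
      have hL := abs_laplacian_le hD hx
      have hU : h ^ 2 * ∑ i, pd (pd u i) i x + u x = -f x := by linarith [hf x hx]
      have hΦ0 : 0 ≤ Φ (D x) :=
        intervalIntegral.integral_nonneg (hD.pos_of_mem hΩ hn hx).le fun t _ => hφ0 t
      have hΦA : Φ (D x) ≤ A := hA _ (hD.pos_of_mem hΩ hn hx).le
      have hθφ : θ (D x) * φ (D x) = φ (D x) := by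
        rcases le_total (D x) (2 / 3 * δ) with h1 | h1
        · rw [hθl _ h1, one_mul]
        · rw [hφr _ h1, mul_zero]
      have hT' : T x = (deriv θ (D x) * Φ (D x) + φ (D x)) * normalEnergy D u h x +
          θ (D x) * Φ (D x) *
            (2 * h ^ 2 * (∑ i, ∑ j, pd u i x * pd u j x * pd (pd D j) i x) +
            (u x ^ 2 - h ^ 2 * ∑ i, pd u i x ^ 2) * ∑ i, pd (pd D i) i x +
            2 * (∑ i, pd u i x * pd D i x) * (-f x)) := by
        simp only [hTdef, ha, ha', normalEnergy]
        rw [hU, hD.sum_sq hx hlt, hθφ, mul_one]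
      set S := ∑ i, pd u i x * pd D i x
      set Q := ∑ i, pd u i x ^ 2
      set H := ∑ i, ∑ j, pd u i x * pd u j x * pd (pd D j) i x
      set L := ∑ i, pd (pd D i) i x
      set N := dataDensity u f h x + h ^ 2 * Q with hN
      have hhQ : 0 ≤ h ^ 2 * Q := by positivity
      have hN0 : 0 ≤ N := by positivity
      have hnM : 0 ≤ (n : ℝ) * M := by positivity
      have hnM2 : 0 ≤ (n : ℝ) * M ^ 2 := by positivity
      have he : |normalEnergy D u h x| ≤ K₁ * N :=
        abs_normalEnergy_term_le hQ0 hnM2 hS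
      have hrest : |2 * h ^ 2 * H + (u x ^ 2 - h ^ 2 * Q) * L + 2 * S * (-f x)| ≤ K₂ * N :=
        abs_rellich_remainder_le hh hQ0 hnM hnM2 hS hH hL
      set rest := 2 * h ^ 2 * H + (u x ^ 2 - h ^ 2 * Q) * L + 2 * S * (-f x)
      have t1 : |deriv θ (D x) * Φ (D x) * normalEnergy D u h x| ≤ B * A * (K₁ * N) := by
        rw [abs_mul, abs_mul, abs_of_nonneg hΦ0]
        exact mul_le_mul (mul_le_mul (hθB _) hΦA hΦ0 hB0) he (abs_nonneg _) (by positivity)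
      have t2 : |θ (D x) * Φ (D x) * rest| ≤ 1 * A * (K₂ * N) := by
        rw [abs_mul, abs_mul, abs_of_nonneg hΦ0, abs_of_nonneg (hθ0 _)]
        exact mul_le_mul (mul_le_mul (hθ1 _) hΦA hΦ0 zero_le_one) hrest (abs_nonneg _)
          (by positivity)
      rw [hT']
      have t1' := (_root_.abs_le.1 t1).1
      have t2' := (_root_.abs_le.1 t2).1
      nlinarith
    · have hφz : φ (D x) = 0 := hφr _ (by linarith)
      have hθz : θ (D x) = 0 := hθr _ (by linarith)
      have hdθ : deriv θ (D x) = 0 := by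
        have : IsLocalMin θ (D x) := Eventually.of_forall fun s => by rw [hθz]; exact hθ0 s
        exact this.deriv_eq_zero
      have hTz : T x = 0 := by simp [hTdef, ha, ha', hφz, hθz, hdθ]
      rw [hφz, hTz]
      have : 0 ≤ (B * K₁ + K₂) * A * (dataDensity u f h x + h ^ 2 * ∑ i, pd u i x ^ 2) := by
        positivity
      linarith
  have bQ : IsBC Ω (fun x => ∑ i, pd u i x ^ 2) := IsBC.sum fun i _ => (hu.isBC_pd i).pow_two
  have bw := hu.isBC_dataDensity hf
  have hi1 := ((IsBC.comp hφ hD.isBC).mul (hu.isBC_normalEnergy (h := h) hΩ hD)).integrableOn hΩ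
  have hi2 : IntegrableOn T Ω := bT.integrableOn hΩ
  have hi3 := ((bw.add ((IsBC.const (h ^ 2)).mul bQ)).integrableOn hΩ).const_mul
    ((B * K₁ + K₂) * A)
  have hmono := setIntegral_mono_on hi1 (hi2.add hi3) hΩ.isOpen.measurableSet hpt
  simp only [Pi.add_apply] at hmono
  rw [integral_add hi2 hi3, integral_const_mul, hT, zero_add] at hmono
  refine hmono.trans ?_
  have h3 := mul_le_mul_of_nonneg_left (hu.integral_gradient_le hΩ hn hD hh hh1 hf)
    (show 0 ≤ (B * K₁ + K₂) * A by positivity)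
  refine h3.trans (le_of_eq ?_)
  ring

/-- The second derivative of `∫ u²` over the level sets of `D`, tested against `φ`,
is bounded from below. -/
lemma exists_integral_second_variation_le (hΩ : IsSmoothBoundedDomain Ω) (hn : 1 ≤ n)
    (hD : IsCollarFunction Ω δ M D) :
    ∃ K : ℝ, 0 ≤ K ∧ ∀ (u f : Eucl n → ℝ) (h : ℝ), IsNeumannRegular Ω D u → 0 < h → h ≤ 1 →
      (∀ x ∈ Ω, f x = -(h ^ 2 * ∑ i, pd (pd u i) i x) - u x) →
      ∀ (φ : ℝ → ℝ) (A B₀ B₁ : ℝ), ContDiff ℝ ∞ φ → (∀ s, 0 ≤ φ s) →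
      (∀ s, 2 / 3 * δ ≤ s → φ s = 0) → deriv φ 0 = 0 →
      (∀ s, 0 ≤ s → ∫ t in (0 : ℝ)..s, φ t ≤ A) → (∀ s, φ s ≤ B₀) → (∀ s, |deriv φ s| ≤ B₁) →
      ∫ x in Ω, -(u x ^ 2 * deriv (deriv φ) (D x)) ≤
        K * (B₁ + h⁻¹ ^ 2 * A + h⁻¹ * B₀) * ∫ x in Ω, dataDensity u f h x := by
  have hδ := hD.pos
  obtain ⟨K, hK0, hK⟩ := exists_integral_normalEnergy_le hΩ hn hD
  obtain ⟨x₀, hx₀⟩ := hΩ.isConnected.nonempty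
  have hM : 0 ≤ M := (abs_nonneg _).trans (hD.abs_le x₀ hx₀)
  refine ⟨n * M + 2 * K + 1, by positivity,
    fun u f h hu hh hh1 hf φ A B₀ B₁ hφ hφ0 hφr hφd0 hA hB₀ hB₁ => ?_⟩
  have hA0 : 0 ≤ A := by simpa using hA 0 le_rfl
  have hB₀0 : 0 ≤ B₀ := (hφ0 0).trans (hB₀ 0)
  have hB₁0 : 0 ≤ B₁ := (abs_nonneg _).trans (hB₁ 0)
  obtain ⟨bI, hI⟩ := hu.integral_green hΩ hn hD hφ hφd0
  set I : Eucl n → ℝ := fun x => u x ^ 2 * (deriv (deriv φ) (D x) * ∑ i, pd D i x ^ 2 +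
        deriv φ (D x) * ∑ i, pd (pd D i) i x) -
      2 * φ (D x) * (∑ i, pd u i x ^ 2 + u x * ∑ i, pd (pd u i) i x) with hIdef
  have hg : h⁻¹ * h = 1 := inv_mul_cancel₀ hh.ne'
  set g := h⁻¹ with hgdef
  have hg0 : 0 < g := inv_pos.2 hh
  have hpt : ∀ x ∈ Ω, -(u x ^ 2 * deriv (deriv φ) (D x)) ≤
      -I x + ((n * M * B₁ + g * B₀) * dataDensity u f h x +
        2 * g ^ 2 * (φ (D x) * normalEnergy D u h x)) := by
    intro x hx
    have hw0 : 0 ≤ dataDensity u f h x := by unfold dataDensity; positivity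
    rcases lt_or_ge (D x) δ with hlt | hge
    · have hL := abs_laplacian_le hD hx
      have hU : h ^ 2 * ∑ i, pd (pd u i) i x = -u x - f x := by linarith [hf x hx]
      simp only [hIdef]
      rw [hD.sum_sq hx hlt, mul_one]
      unfold normalEnergy
      set S := ∑ i, pd u i x * pd D i x
      set Q := ∑ i, pd u i x ^ 2
      set L := ∑ i, pd (pd D i) i x
      set U := ∑ i, pd (pd u i) i x
      have e1 : |u x ^ 2 * (deriv φ (D x) * L)| ≤ n * M * B₁ * dataDensity u f h x := by
        rw [abs_mul, abs_mul, abs_of_nonneg (sq_nonneg _)]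
        calc u x ^ 2 * (|deriv φ (D x)| * |L|) ≤ dataDensity u f h x * (B₁ * (n * M)) := by
              refine mul_le_mul ?_ (mul_le_mul (hB₁ _) hL (abs_nonneg _) hB₁0) (by positivity) hw0
              unfold dataDensity
              nlinarith [mul_nonneg (sq_nonneg h⁻¹) (sq_nonneg (f x))]
          _ = _ := by ring
      -- The equation trades `U` for `u` and `f`, and adding and subtracting `4 φ S²` completes the
      -- normal energy, for which a bound without loss is known.
      have e2 : -(2 * φ (D x) * (Q + u x * U)) =
          2 * g ^ 2 * (φ (D x) * (2 * h ^ 2 * S ^ 2 + (u x ^ 2 - h ^ 2 * Q))) -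
            4 * φ (D x) * S ^ 2 + 2 * φ (D x) * (g ^ 2 * (u x * f x)) := by
        have hgh : g ^ 2 * h ^ 2 = 1 := by rw [← mul_pow, hg, one_pow]
        have : U = g ^ 2 * (-u x - f x) := by rw [← hU, ← mul_assoc, hgh, one_mul]
        rw [this]
        linear_combination (2 * φ (D x) * (Q - 2 * S ^ 2)) * hgh
      have e3 : 2 * φ (D x) * (g ^ 2 * (u x * f x)) ≤ g * B₀ * dataDensity u f h x := by
        have h1 : 2 * (u x * (g * f x)) ≤ dataDensity u f h x := by
          unfold dataDensity
          nlinarith [sq_nonneg (u x - g * f x)]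
        calc 2 * φ (D x) * (g ^ 2 * (u x * f x)) = (g * φ (D x)) * (2 * (u x * (g * f x))) := by
              ring
          _ ≤ (g * φ (D x)) * dataDensity u f h x :=
              mul_le_mul_of_nonneg_left h1 (mul_nonneg hg0.le (hφ0 _))
          _ ≤ g * B₀ * dataDensity u f h x :=
              mul_le_mul_of_nonneg_right (mul_le_mul_of_nonneg_left (hB₀ _) hg0.le) hw0
      -- The leftover square of the normal derivative has a favourable sign and is dropped; hence
      -- the estimate is one-sided.
      have e4 : 0 ≤ 4 * φ (D x) * S ^ 2 :=
        mul_nonneg (mul_nonneg (by norm_num) (hφ0 _)) (sq_nonneg _)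
      have e1' := (_root_.abs_le.1 e1).2
      linarith
    · have hnear : φ =ᶠ[𝓝 (D x)] fun _ => 0 := by
        filter_upwards [lt_mem_nhds (show 2 / 3 * δ < D x by linarith)] with s hs
          using hφr s (le_of_lt hs)
      have z0 : φ (D x) = 0 := hnear.eq_of_nhds
      have z1 : deriv φ =ᶠ[𝓝 (D x)] fun _ => 0 := by simpa using hnear.deriv
      have z1' : deriv φ (D x) = 0 := z1.eq_of_nhds
      have z2 : deriv (deriv φ) (D x) = 0 := by rw [z1.deriv_eq]; simp
      simp only [hIdef, z0, z1', z2]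
      have : 0 ≤ (n * M * B₁ + g * B₀) * dataDensity u f h x := by positivity
      linarith
  have hφ2 : Continuous (deriv (deriv φ)) := by
    have h1 := (contDiff_infty_iff_deriv.1 hφ).2
    exact (contDiff_infty_iff_deriv.1 h1).2.continuous
  have bw := hu.isBC_dataDensity hf
  have hi0 := ((hu.isBC.pow_two.mul (IsBC.comp hφ2 hD.isBC)).neg).integrableOn hΩ
  have hi1 : IntegrableOn (fun x => -I x) Ω := bI.neg.integrableOn hΩ
  have hi2 := (bw.integrableOn hΩ).const_mul (n * M * B₁ + g * B₀)
  have hi3 := (((IsBC.comp hφ.continuous hD.isBC).mul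
    (hu.isBC_normalEnergy (h := h) hΩ hD)).integrableOn hΩ).const_mul (2 * g ^ 2)
  have hi4 : IntegrableOn (fun x => (n * M * B₁ + g * B₀) * dataDensity u f h x +
      2 * g ^ 2 * (φ (D x) * normalEnergy D u h x)) Ω := hi2.add hi3
  have hIneg : ∫ x in Ω, -I x = 0 := by rw [integral_neg, hI, neg_zero]
  have hmono := setIntegral_mono_on hi0 (hi1.add hi4) hΩ.isOpen.measurableSet hpt
  simp only [Pi.add_apply] at hmono
  rw [integral_add hi1 hi4, integral_add hi2 hi3, hIneg,
    integral_const_mul, integral_const_mul] at hmono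
  have hE := hK u f h hu hh hh1 hf φ A hφ.continuous hφ0 hφr hA
  set R := ∫ x in Ω, dataDensity u f h x with hR
  have hR0 : 0 ≤ R := integral_nonneg fun x => by unfold dataDensity; positivity
  have hE' := mul_le_mul_of_nonneg_left hE (show 0 ≤ 2 * g ^ 2 by positivity)
  have hnM : 0 ≤ (n : ℝ) * M := by positivity
  have f1 : 0 ≤ (2 * K + 1) * B₁ * R := by positivity
  have f2 : 0 ≤ (n * M + 1) * (g ^ 2 * A) * R := by positivity
  have f3 : 0 ≤ (n * M + 2 * K) * (g * B₀) * R := by positivity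
  nlinarith

end IsNeumannRegular
end Estimates

/-! ### Tent-shaped test functions -/

section TestFunctions

lemma intervalIntegral_translate_le {ψ : ℝ → ℝ} {B L : ℝ} (hL : 0 ≤ L) (hc : Continuous ψ)
    (h0 : ∀ t, 0 ≤ ψ t) (hB : ∀ t, ψ t ≤ B) (hz : ∀ t, L ≤ |t| → ψ t = 0) (a s : ℝ) (hs : 0 ≤ s) :
    ∫ t in (0 : ℝ)..s, ψ (t - a) ≤ 2 * L * B := by
  have hcs : HasCompactSupport ψ := HasCompactSupport.intro (isCompact_Icc (a := -L) (b := L))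
    fun t ht => hz t (by
      by_contra! h
      exact ht ⟨(abs_lt.1 h).1.le, (abs_lt.1 h).2.le⟩)
  have hint : Integrable ψ := hc.integrable_of_hasCompactSupport hcs
  rw [intervalIntegral.integral_of_le hs]
  calc ∫ t in Ioc 0 s, ψ (t - a) ≤ ∫ t, ψ (t - a) :=
        setIntegral_le_integral (hint.comp_sub_right a) (Eventually.of_forall fun t => h0 _)
    _ = ∫ t, ψ t := integral_sub_right_eq_self ψ a
    _ = ∫ t in Icc (-L) L, ψ t := by
        refine (setIntegral_eq_integral_of_forall_compl_eq_zero fun t ht => hz t ?_).symm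
        by_contra! h
        exact ht ⟨(abs_lt.1 h).1.le, (abs_lt.1 h).2.le⟩
    _ ≤ ‖∫ t in Icc (-L) L, ψ t‖ := le_abs_self _
    _ ≤ B * volume.real (Icc (-L) L) :=
        norm_setIntegral_le_of_norm_le_const (by simp) fun t _ => by
          rw [Real.norm_of_nonneg (h0 t)]; exact hB t
    _ = 2 * L * B := by
        rw [Real.volume_real_Icc_of_le (by linarith)]; ring

/-- Even bump functions with a downward kink at the origin, smoothed at scale `κ`. -/
lemma exists_kink_function : ∃ C : ℝ, 2 ≤ C ∧ ∀ κ : ℝ, 0 < κ → κ ≤ 1 / 2 →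
    ∃ Ψ : ℝ → ℝ, ContDiff ℝ ∞ Ψ ∧ (∀ t, 0 ≤ Ψ t) ∧ (∀ t, Ψ t ≤ 2) ∧ (∀ t, 1 ≤ |t| → Ψ t = 0) ∧
      (∀ t, Ψ (-t) = Ψ t) ∧ (∀ t, |deriv Ψ t| ≤ C) ∧ (∀ t, deriv (deriv Ψ) t ≤ C) ∧
      ∀ t, |t| ≤ κ → deriv (deriv Ψ) t ≤ C - 1 / (3 * κ) := by
  obtain ⟨θ, -, hθs, hθ0, hθ1, hθl, hθr, -⟩ := exists_smooth_cutoff (show (1 / 4 : ℝ) < 1 by norm_num)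
  -- Composing with the square makes the cutoff even; the threshold `1 / 4` makes it one for `|t| ≤
  -- 1 / 2`, which covers `|t| ≤ κ`.
  set χ : ℝ → ℝ := fun t => θ (t ^ 2) with hχ
  have hχs : ContDiff ℝ ∞ χ := hθs.comp (contDiff_id.pow 2)
  have hχz : ∀ t, 1 ≤ |t| → χ t = 0 := fun t ht => hθr _ ((one_le_sq_iff_one_le_abs t).2 ht)
  have hχ1 : ContDiff ℝ ∞ (deriv χ) := (contDiff_infty_iff_deriv.1 hχs).2
  have hχ2 : ContDiff ℝ ∞ (deriv (deriv χ)) := (contDiff_infty_iff_deriv.1 hχ1).2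
  have hχc : HasCompactSupport χ := HasCompactSupport.intro (isCompact_Icc (a := -1) (b := 1))
    fun t ht => hχz t (by
      by_contra! h
      exact ht ⟨(abs_lt.1 h).1.le, (abs_lt.1 h).2.le⟩)
  obtain ⟨C₁, hC₁⟩ := hχ1.continuous.bounded_above_of_compact_support hχc.deriv
  obtain ⟨C₂, hC₂⟩ := hχ2.continuous.bounded_above_of_compact_support hχc.deriv.deriv
  have hC₁0 : 0 ≤ C₁ := (norm_nonneg _).trans (hC₁ 0)
  have hC₂0 : 0 ≤ C₂ := (norm_nonneg _).trans (hC₂ 0)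
  have hz1 : ∀ t, 1 < |t| → deriv χ t = 0 ∧ deriv (deriv χ) t = 0 := by
    intro t ht
    have h1 : χ =ᶠ[𝓝 t] fun _ => 0 := by
      filter_upwards [continuous_abs.continuousAt.eventually (lt_mem_nhds ht)] with s hs
        using hχz s (le_of_lt hs)
    have h2 : deriv χ =ᶠ[𝓝 t] fun _ => 0 := by simpa using h1.deriv
    exact ⟨h2.eq_of_nhds, by rw [h2.deriv_eq]; simp⟩
  refine ⟨2 * C₁ + 2 * C₂ + 2, by linarith, fun κ hκ hκ2 => ?_⟩
  -- A smooth even version of `|t|`, with slope at most one and second derivative `κ² / q³`, so that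
  -- `χ (2 - q)` is a smoothed tent.
  set q : ℝ → ℝ := fun t => Real.sqrt (t ^ 2 + κ ^ 2) with hq
  have hpos : ∀ t, 0 < t ^ 2 + κ ^ 2 := fun t => by positivity
  have hq0 : ∀ t, 0 < q t := fun t => Real.sqrt_pos.2 (hpos t)
  have hqsq : ∀ t, q t ^ 2 = t ^ 2 + κ ^ 2 := fun t => Real.sq_sqrt (hpos t).le
  have hqs : ContDiff ℝ ∞ q :=
    ((contDiff_id.pow 2).add contDiff_const).sqrt fun t => (hpos t).ne'
  have htq : ∀ t, |t / q t| ≤ 1 := fun t => by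
    rw [abs_div, abs_of_pos (hq0 t), div_le_one (hq0 t)]
    refine abs_le_of_sq_le_sq ?_ (hq0 t).le
    rw [hqsq]; nlinarith [sq_nonneg κ]
  have hqle : ∀ t, |t| ≤ 1 → q t ≤ 2 := fun t ht => by
    refine le_of_sq_le_sq ?_ (by norm_num)
    rw [hqsq]
    have : t ^ 2 ≤ 1 := (sq_le_one_iff_abs_le_one t).2 ht
    nlinarith
  have hqd : ∀ t, HasDerivAt q (t / q t) t := fun t => by
    have h1 : HasDerivAt (fun t : ℝ => t ^ 2 + κ ^ 2) (2 * t) t := by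
      simpa using (hasDerivAt_pow 2 t).add_const (κ ^ 2)
    refine (h1.sqrt (hpos t).ne').congr_deriv ?_
    show 2 * t / (2 * q t) = t / q t
    rw [mul_div_mul_left _ _ two_ne_zero]
  have hqd2 : ∀ t, HasDerivAt (fun t => t / q t) (κ ^ 2 / q t ^ 3) t := fun t => by
    refine ((hasDerivAt_id t).div (hqd t) (hq0 t).ne').congr_deriv ?_
    have h0 := (hq0 t).ne'
    have h2 := hqsq t
    simp only [id]
    rw [div_eq_div_iff (by positivity) (by positivity)]
    field_simp
    linear_combination h2
  set Ψ : ℝ → ℝ := fun t => χ t * (2 - q t) with hΨ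
  have hΨd : ∀ t, HasDerivAt Ψ (deriv χ t * (2 - q t) + χ t * (-(t / q t))) t := fun t =>
    ((hχs.differentiable (by simp) t).hasDerivAt).mul ((hqd t).const_sub 2)
  have hΨd1 : deriv Ψ = fun t => deriv χ t * (2 - q t) + χ t * (-(t / q t)) :=
    funext fun t => (hΨd t).deriv
  have hΨd2 : ∀ t, deriv (deriv Ψ) t = deriv (deriv χ) t * (2 - q t) +
      2 * (deriv χ t * (-(t / q t))) - χ t * (κ ^ 2 / q t ^ 3) := fun t => by
    rw [hΨd1]
    have h1 := (((hχ1.differentiable (by simp) t).hasDerivAt).mul ((hqd t).const_sub 2)).add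
      (((hχs.differentiable (by simp) t).hasDerivAt).mul (hqd2 t).neg)
    refine Eq.trans h1.deriv ?_
    simp only [Pi.neg_apply]
    ring
  have hub : ∀ t, |t| ≤ 1 → |2 - q t| ≤ 2 := fun t ht => by
    rw [_root_.abs_le]; constructor <;> linarith [hqle t ht, hq0 t]
  -- Only `-χ q''` blows up as `κ → 0`, and it is nonpositive; the other terms are bounded uniformly
  -- in `κ`.
  have hΨ2le : ∀ t, deriv (deriv Ψ) t + χ t * (κ ^ 2 / q t ^ 3) ≤ 2 * C₁ + 2 * C₂ + 2 := by
    intro t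
    rw [hΨd2]
    rcases le_or_gt |t| 1 with ht | ht
    · have h1 : |deriv (deriv χ) t * (2 - q t)| ≤ C₂ * 2 := by
        rw [abs_mul]; exact mul_le_mul (hC₂ t) (hub t ht) (abs_nonneg _) hC₂0
      have h2 : |deriv χ t * (-(t / q t))| ≤ C₁ * 1 := by
        rw [abs_mul, abs_neg]; exact mul_le_mul (hC₁ t) (htq t) (abs_nonneg _) hC₁0
      linarith [(_root_.abs_le.1 h1).2, (_root_.abs_le.1 h2).2]
    · rw [(hz1 t ht).1, (hz1 t ht).2]
      linarith
  refine ⟨Ψ, hχs.mul (contDiff_const.sub hqs), fun t => ?_, fun t => ?_, fun t ht => ?_,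
    fun t => ?_, fun t => ?_, fun t => ?_, fun t ht => ?_⟩
  · rcases le_or_gt |t| 1 with ht | ht
    · exact mul_nonneg (hθ0 _) (by linarith [hqle t ht])
    · simp only [hΨ, hχz t ht.le, zero_mul, le_refl]
  · rcases le_or_gt |t| 1 with ht | ht
    · calc χ t * (2 - q t) ≤ 1 * (2 - q t) :=
            mul_le_mul_of_nonneg_right (hθ1 _) (by linarith [hqle t ht])
        _ ≤ 2 := by linarith [hq0 t]
    · simp only [hΨ, hχz t ht.le, zero_mul]; norm_num
  · simp only [hΨ, hχz t ht, zero_mul]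
  · simp only [hΨ, hχ, hq, neg_sq]
  · rw [hΨd1]
    rcases le_or_gt |t| 1 with ht | ht
    · have h1 : |deriv χ t * (2 - q t)| ≤ C₁ * 2 := by
        rw [abs_mul]; exact mul_le_mul (hC₁ t) (hub t ht) (abs_nonneg _) hC₁0
      have h2 : |χ t * (-(t / q t))| ≤ 1 * 1 := by
        rw [abs_mul, abs_neg, abs_of_nonneg (hθ0 _)]
        exact mul_le_mul (hθ1 _) (htq t) (abs_nonneg _) zero_le_one
      refine (abs_add_le _ _).trans ?_
      linarith
    · simp only [(hz1 t ht).1, hχz t ht.le, zero_mul, add_zero, abs_zero]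
      linarith
  · have h1 : 0 ≤ χ t * (κ ^ 2 / q t ^ 3) :=
      mul_nonneg (hθ0 _) (div_nonneg (sq_nonneg _) (pow_nonneg (hq0 t).le _))
    linarith [hΨ2le t]
  · have ht2 : t ^ 2 ≤ κ ^ 2 := sq_le_sq' (by linarith [(_root_.abs_le.1 ht).1])
      (_root_.abs_le.1 ht).2
    have hχone : χ t = 1 := hθl _ (by nlinarith)
    have h1 := hΨ2le t
    rw [hχone, one_mul] at h1
    have h2 : 1 / (3 * κ) ≤ κ ^ 2 / q t ^ 3 := by
      have h3 : q t ≤ 3 / 2 * κ := by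
        refine le_of_sq_le_sq ?_ (by positivity)
        rw [hqsq]; nlinarith [sq_nonneg κ]
      have h4 : q t ^ 3 ≤ 3 * κ ^ 3 := by
        have h5 : q t ^ 2 ≤ 2 * κ ^ 2 := by rw [hqsq]; linarith
        calc q t ^ 3 = q t ^ 2 * q t := by ring
          _ ≤ (2 * κ ^ 2) * (3 / 2 * κ) := mul_le_mul h5 h3 (hq0 t).le (by positivity)
          _ = 3 * κ ^ 3 := by ring
      rw [div_le_div_iff₀ (by positivity) (pow_pos (hq0 t) 3)]
      linarith
    linarith

/-- Even test functions concentrated near `±r`, whose second derivative is very negative on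
`[r, r + ε]` and bounded from above elsewhere. -/
lemma exists_test_function : ∃ C : ℝ, 0 < C ∧ ∀ r L ε : ℝ, 0 ≤ r → 0 < L → 0 < ε → ε ≤ L / 2 →
    ∃ φ : ℝ → ℝ, ContDiff ℝ ∞ φ ∧ (∀ s, 0 ≤ φ s) ∧ (∀ s, r + L ≤ s → φ s = 0) ∧ deriv φ 0 = 0 ∧
      (∀ s, 0 ≤ s → ∫ t in (0 : ℝ)..s, φ t ≤ C * L ^ 2) ∧ (∀ s, φ s ≤ C * L) ∧
      (∀ s, |deriv φ s| ≤ C) ∧ (∀ s, deriv (deriv φ) s ≤ C / L) ∧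
      ∀ s, r ≤ s → s ≤ r + ε → deriv (deriv φ) s ≤ C / L - 1 / (3 * ε) := by
  obtain ⟨C, hC2, hC⟩ := exists_kink_function
  refine ⟨4 * C, by linarith, fun r L ε hr hL hε hεL => ?_⟩
  obtain ⟨Ψ, hs, h0, h2, hz, hev, hd1, hd2, hd2κ⟩ := hC (ε / L) (by positivity)
    (by rw [div_le_iff₀ hL]; linarith)
  have hs1 : ContDiff ℝ ∞ (deriv Ψ) := (contDiff_infty_iff_deriv.1 hs).2
  -- This scaling keeps slopes of order one, makes height and width of order `L`, and turns the kink
  -- scale `κ = ε / L` into `ε`.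
  set ψ : ℝ → ℝ := fun s => L * Ψ (s / L) with hψ
  have hψs : ContDiff ℝ ∞ ψ := contDiff_const.mul (hs.comp (contDiff_id.div_const L))
  have hψz : ∀ t, L ≤ |t| → ψ t = 0 := fun t ht => by
    simp only [hψ]
    rw [hz _ (by rw [abs_div, abs_of_pos hL, one_le_div hL]; exact ht), mul_zero]
  have hψ0 : ∀ t, 0 ≤ ψ t := fun t => mul_nonneg hL.le (h0 _)
  have hψ2 : ∀ t, ψ t ≤ 2 * L := fun t => by
    simp only [hψ]; nlinarith [h2 (t / L)]
  have hψev : ∀ t, ψ (-t) = ψ t := fun t => by simp only [hψ, neg_div, hev]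
  have hdiv : ∀ a s : ℝ, HasDerivAt (fun s : ℝ => (s + a) / L) (1 / L) s := fun a s =>
    ((hasDerivAt_id s).add_const a).div_const L
  have hψd : ∀ a s, HasDerivAt (fun s => ψ (s + a)) (deriv Ψ ((s + a) / L)) s := fun a s => by
    refine (((hs.differentiable (by simp) _).hasDerivAt.comp s (hdiv a s)).const_mul L).congr_deriv ?_
    field_simp
  have hψd1 : ∀ a s, HasDerivAt (fun s => deriv Ψ ((s + a) / L))
      (deriv (deriv Ψ) ((s + a) / L) / L) s := fun a s => by
    refine ((hs1.differentiable (by simp) _).hasDerivAt.comp s (hdiv a s)).congr_deriv ?_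
    rw [mul_one_div]
  -- Adding the reflected bump makes `φ` even, hence `φ'(0) = 0` also for `r` close to the boundary.
  -- Its second derivative adds at most `C / L`.
  set φ : ℝ → ℝ := fun s => ψ (s + -r) + ψ (s + r) with hφ
  have hφs : ContDiff ℝ ∞ φ := (hψs.comp (contDiff_id.add contDiff_const)).add
    (hψs.comp (contDiff_id.add contDiff_const))
  have hφd : deriv φ = fun s => deriv Ψ ((s + -r) / L) + deriv Ψ ((s + r) / L) :=
    funext fun s => ((hψd (-r) s).add (hψd r s)).deriv
  have hφd2 : ∀ s, deriv (deriv φ) s =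
      deriv (deriv Ψ) ((s + -r) / L) / L + deriv (deriv Ψ) ((s + r) / L) / L := fun s => by
    rw [hφd]; exact ((hψd1 (-r) s).add (hψd1 r s)).deriv
  have hd2L : ∀ t, deriv (deriv Ψ) t / L ≤ C / L := fun t =>
    div_le_div_of_nonneg_right (hd2 t) hL.le
  have hCL : 0 ≤ C / L := by positivity
  refine ⟨φ, hφs, fun s => add_nonneg (hψ0 _) (hψ0 _), fun s hs => ?_, ?_, fun s hs => ?_,
    fun s => ?_, fun s => ?_, fun s => ?_, fun s hs1 hs2 => ?_⟩
  · simp only [hφ]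
    rw [hψz _ (by rw [abs_of_nonneg] <;> linarith), hψz _ (by rw [abs_of_nonneg] <;> linarith),
      add_zero]
  · have heven : (fun s => φ (-s)) = φ := by
      funext s
      simp only [hφ]
      rw [show -s + -r = -(s + r) by ring, show -s + r = -(s + -r) by ring, hψev, hψev, add_comm]
    have h1 := deriv_comp_neg φ 0
    rw [heven, neg_zero] at h1
    linarith
  · have i1 := intervalIntegral_translate_le hL.le hψs.continuous hψ0 hψ2 hψz r s hs
    have i2 := intervalIntegral_translate_le hL.le hψs.continuous hψ0 hψ2 hψz (-r) s hs
    simp only [hφ]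
    rw [intervalIntegral.integral_add]
    · simp only [sub_eq_add_neg, neg_neg] at i1 i2
      nlinarith [sq_nonneg L]
    · exact (hψs.continuous.comp (by fun_prop)).intervalIntegrable _ _
    · exact (hψs.continuous.comp (by fun_prop)).intervalIntegrable _ _
  · have := hψ2 (s + -r)
    have := hψ2 (s + r)
    simp only [hφ]
    nlinarith
  · rw [hφd]
    refine (abs_add_le _ _).trans ?_
    linarith [hd1 ((s + -r) / L), hd1 ((s + r) / L)]
  · rw [hφd2, show 4 * C / L = 4 * (C / L) by ring]
    linarith [hd2L ((s + -r) / L), hd2L ((s + r) / L)]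
  · rw [hφd2, show 4 * C / L = 4 * (C / L) by ring]
    have h1 := hd2κ ((s + -r) / L) (by
      rw [abs_div, abs_of_pos hL]
      refine div_le_div_of_nonneg_right ?_ hL.le
      rw [abs_of_nonneg] <;> linarith)
    have h3 := div_le_div_of_nonneg_right h1 hL.le
    have h4 : (C - 1 / (3 * (ε / L))) / L = C / L - 1 / (3 * ε) := by
      field_simp
    rw [h4] at h3
    linarith [hd2L ((s + r) / L)]

end TestFunctions

/-! ### Averages over thin shells -/

section ShellBound
variable {n : ℕ} {Ω : Set (Eucl n)} {δ M : ℝ} {D : Eucl n → ℝ}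

/-- The open shell of width `ε` inside the level set at distance `r` from the boundary. -/
def shell (Ω : Set (Eucl n)) (r ε : ℝ) : Set (Eucl n) :=
  {x ∈ Ω | r < bdryDist Ω x ∧ bdryDist Ω x < r + ε}

lemma isOpen_shell (ho : IsOpen Ω) (r ε : ℝ) : IsOpen (shell Ω r ε) :=
  ho.inter ((isOpen_lt continuous_const continuous_bdryDist).inter
    (isOpen_lt continuous_bdryDist continuous_const))

lemma shell_subset (r ε : ℝ) : shell Ω r ε ⊆ Ω := fun _ h => h.1

/-- The averages of `u²` over thin shells are bounded by `h^{-2/3}`, where `h = k³`. -/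
lemma exists_integral_shell_le (hΩ : IsSmoothBoundedDomain Ω) (hn : 1 ≤ n)
    (hD : IsCollarFunction Ω δ M D) :
    ∃ K : ℝ, 0 < K ∧ ∀ (u f : Eucl n → ℝ) (k : ℝ), IsNeumannRegular Ω D u → 0 < k → k ≤ 1 →
      (∀ x ∈ Ω, f x = -((k ^ 3) ^ 2 * ∑ i, pd (pd u i) i x) - u x) →
      ∀ r ε : ℝ, 0 ≤ r → r ≤ δ / 2 → 0 < ε → ε ≤ δ * k ^ 2 / 12 →
      ∫ x in shell Ω r ε, u x ^ 2 ≤ ε * (K * k⁻¹ ^ 2 * ∫ x in Ω, dataDensity u f (k ^ 3) x) := by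
  have hδ := hD.pos
  obtain ⟨K, hK0, hK⟩ := IsNeumannRegular.exists_integral_second_variation_le hΩ hn hD
  obtain ⟨C, hC0, hC⟩ := exists_test_function
  -- With `r ≤ δ / 2` the support of `φ` ends at `r + L ≤ δ / 2 + δ / 6 = 2 / 3 * δ`, as the energy
  -- estimate requires.
  set c : ℝ := δ / 6 with hc
  have hc0 : 0 < c := by positivity
  refine ⟨3 * (K * (C + C * c ^ 2 + C * c) + C / c), by positivity,
    fun u f k hu hk hk1 hf r ε hr hrδ hε hεk => ?_⟩
  -- With `h = k³` this is `h^(2/3)` up to a constant, the scale at which `h⁻² L²` and `1 / L`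
  -- agree; the term `h⁻¹ L` is then only `h^(-1/3)`.
  set L : ℝ := c * k ^ 2 with hL
  have hL0 : 0 < L := by positivity
  have hk2 : k ^ 2 ≤ 1 := pow_le_one₀ hk.le hk1
  have hLc : L ≤ c := by rw [hL]; nlinarith
  have hεL : ε ≤ L / 2 := by rw [hL, hc]; linarith
  obtain ⟨φ, hφs, hφ0, hφr, hφd0, hφA, hφB, hφ1, hφ2, hφ2ε⟩ := hC r L ε hr hL0 hε hεL
  have hmain := hK u f (k ^ 3) hu (by positivity) (pow_le_one₀ hk.le hk1) hf φ (C * L ^ 2) (C * L) C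
    hφs hφ0 (fun s hs => hφr s (by linarith)) hφd0 hφA hφB hφ1
  set R := ∫ x in Ω, dataDensity u f (k ^ 3) x with hR
  have bw := hu.isBC_dataDensity hf
  have hR0 : 0 ≤ R := integral_nonneg fun x => by unfold dataDensity; positivity
  have hφ2c : Continuous (deriv (deriv φ)) := by
    have h1 := (contDiff_infty_iff_deriv.1 hφs).2
    exact (contDiff_infty_iff_deriv.1 h1).2.continuous
  have hshm : MeasurableSet (shell Ω r ε) := (isOpen_shell hΩ.isOpen r ε).measurableSet
  have hi1 : IntegrableOn (fun x => -(u x ^ 2 * deriv (deriv φ) (D x))) Ω :=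
    (hu.isBC.pow_two.mul (IsBC.comp hφ2c hD.isBC)).neg.integrableOn hΩ
  have hi2 : IntegrableOn (fun x => C / L * dataDensity u f (k ^ 3) x) Ω :=
    (bw.integrableOn hΩ).const_mul _
  have hi0 : IntegrableOn ((shell Ω r ε).indicator fun x => 1 / (3 * ε) * u x ^ 2) Ω :=
    (((hu.isBC.pow_two).integrableOn hΩ).const_mul _).indicator hshm
  have hpt : ∀ x ∈ Ω, (shell Ω r ε).indicator (fun x => 1 / (3 * ε) * u x ^ 2) x ≤
      -(u x ^ 2 * deriv (deriv φ) (D x)) + C / L * dataDensity u f (k ^ 3) x := by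
    intro x hx
    have hw : u x ^ 2 ≤ dataDensity u f (k ^ 3) x := by
      unfold dataDensity
      have : 0 ≤ (k ^ 3)⁻¹ ^ 2 * f x ^ 2 := by positivity
      linarith
    have hw' := mul_le_mul_of_nonneg_left hw (show 0 ≤ C / L by positivity)
    by_cases hxs : x ∈ shell Ω r ε
    · rw [indicator_of_mem hxs]
      have hDx : D x = bdryDist Ω x := hD.eq_dist x hx (by linarith [hxs.2.2])
      have h1 := hφ2ε (D x) (by linarith [hxs.2.1]) (by linarith [hxs.2.2])
      have h2 := mul_le_mul_of_nonneg_left h1 (sq_nonneg (u x))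
      linarith
    · rw [indicator_of_notMem hxs]
      have h2 := mul_le_mul_of_nonneg_left (hφ2 (D x)) (sq_nonneg (u x))
      linarith
  have hmono := setIntegral_mono_on hi0 (hi1.add hi2) hΩ.isOpen.measurableSet hpt
  simp only [Pi.add_apply] at hmono
  rw [integral_add hi1 hi2, integral_const_mul, setIntegral_indicator hshm,
    inter_eq_right.2 (shell_subset r ε), integral_const_mul] at hmono
  set g := k⁻¹ with hg
  have hgk : g * k = 1 := inv_mul_cancel₀ hk.ne'
  have hg1 : 1 ≤ g := (one_le_inv₀ hk).2 hk1
  have e1 : (k ^ 3)⁻¹ = g ^ 3 := by rw [hg, inv_pow]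
  have e2 : (k ^ 3)⁻¹ ^ 2 * (C * L ^ 2) = C * c ^ 2 * g ^ 2 := by
    rw [e1, hL]
    have : g ^ 4 * k ^ 4 = 1 := by rw [← mul_pow, hgk, one_pow]
    linear_combination (C * c ^ 2 * g ^ 2) * this
  have e3 : (k ^ 3)⁻¹ * (C * L) = C * c * g := by
    rw [e1, hL]
    have : g ^ 2 * k ^ 2 = 1 := by rw [← mul_pow, hgk, one_pow]
    linear_combination (C * c * g) * this
  have e4 : C / L = C / c * g ^ 2 := by
    rw [hL, hg]; field_simp
  rw [e2, e3] at hmain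
  rw [e4] at hmono
  have hgg : g ≤ g ^ 2 := by nlinarith
  have h1g : 1 ≤ g ^ 2 := one_le_pow₀ hg1
  have h5 : K * (C + C * c ^ 2 * g ^ 2 + C * c * g) * R ≤
      K * (C + C * c ^ 2 + C * c) * g ^ 2 * R := by
    refine mul_le_mul_of_nonneg_right ?_ hR0
    rw [mul_assoc K _ (g ^ 2)]
    refine mul_le_mul_of_nonneg_left ?_ hK0
    have h6 := mul_le_mul_of_nonneg_left hgg (show 0 ≤ C * c by positivity)
    have h7 := mul_le_mul_of_nonneg_left h1g hC0.le
    linarith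
  have h8 : 1 / (3 * ε) * ∫ x in shell Ω r ε, u x ^ 2 ≤
      (K * (C + C * c ^ 2 + C * c) + C / c) * g ^ 2 * R := by
    calc _ ≤ _ := hmono
      _ ≤ K * (C + C * c ^ 2 + C * c) * g ^ 2 * R + C / c * g ^ 2 * R := by
          linarith
      _ = _ := by ring
  rw [one_div, inv_mul_le_iff₀ (by positivity)] at h8
  refine h8.trans (le_of_eq ?_)
  ring

end ShellBound

/-! ### Hausdorff measure bounded by volumes of neighbourhoods -/

section Hausdorff

open Metric

variable {n : ℕ}

/-- If `ε`-balls around the points of `K` contain half-size balls lying in `S`, then `K` can be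
covered by balls of radius `4 ε` whose number is controlled by the volume of `S`. -/
lemma exists_cover_tsum_le (hn : 1 ≤ n) {K S : Set (Eucl n)} {ε : ℝ} (hε : 0 < ε)
    (h : ∀ x ∈ K, ∃ z, dist z x ≤ ε / 2 ∧ ball z (ε / 2) ⊆ S) :
    ∃ s : Set (Eucl n), s.Countable ∧ K ⊆ ⋃ x : s, closedBall (x : Eucl n) (4 * ε) ∧
      ∑' _ : s, ENNReal.ofReal (8 * ε) ^ (n - 1) ≤
        ENNReal.ofReal (16 ^ (n - 1) * 2) * (volume (ball (0 : Eucl n) 1))⁻¹ *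
          ((ENNReal.ofReal ε)⁻¹ * volume S) := by
  obtain ⟨s, hsK, hdisj, hcov⟩ := Vitali.exists_disjoint_subfamily_covering_enlargement_closedBall
    K id (fun _ => ε) ε (fun _ _ => le_rfl) 4 (by norm_num)
  have hsc : s.Countable := hdisj.countable_of_nonempty_interior fun x _ =>
    ⟨x, ball_subset_interior_closedBall (mem_ball_self hε)⟩
  refine ⟨s, hsc, fun x hx => ?_, ?_⟩
  · obtain ⟨b, hb, hxb⟩ := hcov x hx
    exact mem_iUnion.2 ⟨⟨b, hb⟩, hxb (mem_closedBall_self hε.le)⟩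
  choose! z hz hzS using h
  -- Each half-size ball sits inside the closed `ε`-ball about its centre `x`, so disjointness of
  -- the Vitali family passes to them and their volumes add up inside `S`.
  have hd2 : Pairwise (Function.onFun Disjoint fun x : s => ball (z x) (ε / 2)) := by
    intro x y hxy
    refine (hdisj x.2 y.2 (fun h => hxy (Subtype.ext h))).mono ?_ ?_
    all_goals
      refine (ball_subset_closedBall).trans (closedBall_subset_closedBall' ?_)
    · have := hz x (hsK x.2)
      simp only [id]
      linarith
    · have := hz y (hsK y.2)
      simp only [id]
      linarith
  have : Countable s := hsc.to_subtype
  have hvol : ∑' x : s, volume (ball (z x) (ε / 2)) ≤ volume S :=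
    (tsum_meas_le_meas_iUnion_of_disjoint volume (fun _ => measurableSet_ball) hd2).trans
      (measure_mono (iUnion_subset fun x => hzS x (hsK x.2)))
  have hβ0 : volume (ball (0 : Eucl n) 1) ≠ 0 := (measure_ball_pos _ _ one_pos).ne'
  have hβt : volume (ball (0 : Eucl n) 1) ≠ ⊤ := measure_ball_lt_top.ne
  have hterm (x : s) : ENNReal.ofReal (8 * ε) ^ (n - 1) =
      ENNReal.ofReal (16 ^ (n - 1) * 2) * (volume (ball (0 : Eucl n) 1))⁻¹ *
        ((ENNReal.ofReal ε)⁻¹ * volume (ball (z x) (ε / 2))) := by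
    rw [Measure.addHaar_ball_of_pos volume _ (half_pos hε), finrank_euclideanSpace_fin]
    -- The diameter of the covering balls is `8 ε = 16 (ε / 2)`, and the missing factor `ε / 2` of
    -- an `n`-dimensional volume accounts for `2 / ε`.
    have h1 : ENNReal.ofReal (8 * ε) ^ (n - 1) = ENNReal.ofReal (16 ^ (n - 1) * 2) *
        ((ENNReal.ofReal ε)⁻¹ * ENNReal.ofReal ((ε / 2) ^ n)) := by
      rw [← ENNReal.ofReal_inv_of_pos hε, ← ENNReal.ofReal_mul (by positivity),
        ← ENNReal.ofReal_mul (by positivity), ← ENNReal.ofReal_pow (by positivity)]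
      congr 1
      obtain ⟨m, rfl⟩ : ∃ j, n = j + 1 := ⟨n - 1, by omega⟩
      rw [Nat.add_sub_cancel, pow_succ, show 8 * ε = 16 * (ε / 2) by ring, mul_pow]
      field_simp
    rw [h1]
    calc _ = ENNReal.ofReal (16 ^ (n - 1) * 2) *
        ((ENNReal.ofReal ε)⁻¹ * ENNReal.ofReal ((ε / 2) ^ n)) *
          ((volume (ball (0 : Eucl n) 1))⁻¹ * volume (ball (0 : Eucl n) 1)) := by
          rw [ENNReal.inv_mul_cancel hβ0 hβt, mul_one]
      _ = _ := by ring
  rw [tsum_congr hterm, ENNReal.tsum_mul_left, ENNReal.tsum_mul_left]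
  gcongr

/-- The dimensional constant comparing the Hausdorff measure with volumes of thin shells. -/
noncomputable def shellConst (n : ℕ) : ℝ≥0∞ :=
  (Measure.addHaarScalarFactor (volume : Measure (Eucl (n - 1)))
      (Measure.hausdorffMeasure ((n - 1 : ℕ) : ℝ)) : ℝ≥0∞) *
    (ENNReal.ofReal (16 ^ (n - 1) * 2) * (volume (ball (0 : Eucl n) 1))⁻¹)

lemma shellConst_ne_top : shellConst n ≠ ⊤ :=
  ENNReal.mul_ne_top ENNReal.coe_ne_top (ENNReal.mul_ne_top ENNReal.ofReal_ne_top
    (ENNReal.inv_ne_top.2 (measure_ball_pos _ _ one_pos).ne'))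

/-- The Vitali covers have diameters tending to zero, so the Hausdorff measure is at most the lower
limit of their sums, each compared with the volume of `S k` divided by `ε k`. No rectifiability of
`K` enters; the price is a non-sharp dimensional constant. -/
lemma euclideanHausdorffMeasure_le_liminf (hn : 1 ≤ n) {K : Set (Eucl n)}
    {S : ℕ → Set (Eucl n)} {ε : ℕ → ℝ} (hε : ∀ k, 0 < ε k) (hε0 : Tendsto ε atTop (𝓝 0))
    (h : ∀ k, ∀ x ∈ K, ∃ z, dist z x ≤ ε k / 2 ∧ ball z (ε k / 2) ⊆ S k) :
    Measure.euclideanHausdorffMeasure (n - 1) K ≤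
      liminf (fun k => shellConst n * ((ENNReal.ofReal (ε k))⁻¹ * volume (S k))) atTop := by
  choose s hsc hsK hs using fun k => exists_cover_tsum_le hn (hε k) (h k)
  have : ∀ k, Countable (s k) := fun k => (hsc k).to_subtype
  have hr : Tendsto (fun k => ENNReal.ofReal (8 * ε k)) atTop (𝓝 0) := by
    have := (ENNReal.continuous_ofReal.tendsto _).comp (hε0.const_mul 8)
    rwa [mul_zero, ENNReal.ofReal_zero] at this
  have hdiam : ∀ k, ∀ x : s k, ediam (closedBall (x : Eucl n) (4 * ε k)) ≤
      ENNReal.ofReal (8 * ε k) := fun k x =>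
    ediam_le_of_forall_dist_le fun a ha b hb =>
      (dist_le_diam_of_mem isBounded_closedBall ha hb).trans
        ((diam_closedBall (by linarith [hε k])).trans (by linarith))
  have hH := Measure.hausdorffMeasure_le_liminf_tsum ((n - 1 : ℕ) : ℝ) K _ hr
    (fun k (x : s k) => closedBall (x : Eucl n) (4 * ε k)) (Eventually.of_forall hdiam)
    (Eventually.of_forall hsK)
  rw [Measure.euclideanHausdorffMeasure_def, Measure.smul_apply, ENNReal.smul_def, smul_eq_mul]
  refine (mul_le_mul_right hH _).trans ?_
  rw [← ENNReal.liminf_const_mul_of_ne_top ENNReal.coe_ne_top]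
  refine liminf_le_liminf (Eventually.of_forall fun k => ?_)
  rw [shellConst, mul_assoc]
  refine mul_le_mul_right ((ENNReal.tsum_le_tsum fun x => ?_).trans (hs k)) _
  rw [← ENNReal.rpow_natCast]
  exact ENNReal.rpow_le_rpow (hdiam k x) (by positivity)

/-- Layer-cake decomposition on `Y`, the bound for sets on each superlevel set, Fatou in the level,
and layer cake again on `S k`. The number `m k` dominates the increase from nearby points of `S k`
to a point of `Y`, so the half-size ball near a point with `t ≤ g` stays in `{t ≤ g + m k}`. -/
lemma lintegral_euclideanHausdorffMeasure_le_liminf (hn : 1 ≤ n) {Y : Set (Eucl n)}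
    (hY : MeasurableSet Y) {S : ℕ → Set (Eucl n)} {g : Eucl n → ℝ} {ε m : ℕ → ℝ}
    (hg0 : ∀ x, 0 ≤ g x) (hm0 : ∀ k, 0 ≤ m k) (hS : ∀ k, MeasurableSet (S k))
    (hgY : ContinuousOn g Y) (hgS : ∀ k, ContinuousOn g (S k))
    (hε : ∀ k, 0 < ε k) (hε0 : Tendsto ε atTop (𝓝 0))
    (h : ∀ k, ∀ x ∈ Y, ∃ z, dist z x ≤ ε k / 2 ∧ ball z (ε k / 2) ⊆ S k)
    (hgm : ∀ k, ∀ x ∈ Y, ∀ y ∈ S k, dist y x < ε k → g x ≤ g y + m k) :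
    ∫⁻ x in Y, ENNReal.ofReal (g x) ∂(Measure.euclideanHausdorffMeasure (n - 1)) ≤
      liminf (fun k => shellConst n * ((ENNReal.ofReal (ε k))⁻¹ *
        ∫⁻ x in S k, ENNReal.ofReal (g x + m k))) atTop := by
  have hmeas (k : ℕ) :
      Measurable fun t : ℝ => (volume.restrict (S k)) {x | t ≤ g x + m k} :=
    Antitone.measurable fun s t hst => measure_mono fun x hx => hst.trans hx
  rw [lintegral_eq_lintegral_meas_le _ (Eventually.of_forall hg0) (hgY.aemeasurable hY)]
  calc _ ≤ ∫⁻ t in Ioi (0 : ℝ), liminf (fun k => shellConst n * ((ENNReal.ofReal (ε k))⁻¹ *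
        (volume.restrict (S k)) {x | t ≤ g x + m k})) atTop := by
        refine lintegral_mono fun t => ?_
        rw [Measure.restrict_apply' hY]
        refine (euclideanHausdorffMeasure_le_liminf hn
          (S := fun k => {x | t ≤ g x + m k} ∩ S k) hε hε0 ?_).trans ?_
        · rintro k x ⟨hxt, hxY⟩
          obtain ⟨z, hz, hzS⟩ := h k x hxY
          refine ⟨z, hz, fun y hy => ⟨?_, hzS hy⟩⟩
          refine le_trans hxt (hgm k x hxY y (hzS hy) ?_)
          have := dist_triangle y z x
          have := mem_ball.1 hy
          linarith
        · refine liminf_le_liminf (Eventually.of_forall fun k => ?_)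
          exact mul_le_mul_right (mul_le_mul_right (Measure.le_restrict_apply _ _) _) _
    _ ≤ liminf (fun k => ∫⁻ t in Ioi (0 : ℝ), shellConst n * ((ENNReal.ofReal (ε k))⁻¹ *
        (volume.restrict (S k)) {x | t ≤ g x + m k})) atTop :=
        lintegral_liminf_le fun k => ((hmeas k).const_mul _).const_mul _
    _ = _ := by
        congr 1
        ext k
        rw [lintegral_const_mul _ ((hmeas k).const_mul _), lintegral_const_mul _ (hmeas k),
          lintegral_eq_lintegral_meas_le _
            (Eventually.of_forall fun x => add_nonneg (hg0 x) (hm0 k))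
            (((hgS k).add continuousOn_const).aemeasurable (hS k))]

end Hausdorff

/-! ### From shells to level sets of the distance -/

section LevelSet

open Metric

variable {n : ℕ} {Ω : Set (Eucl n)}

lemma isClosed_levelSet (r : ℝ) : IsClosed (levelSet Ω r) :=
  isClosed_closure.inter (isClosed_eq continuous_bdryDist continuous_const)

lemma levelSet_zero (hΩ : IsSmoothBoundedDomain Ω) (hn : 1 ≤ n) : levelSet Ω 0 = frontier Ω :=
  Subset.antisymm (fun _ hx => mem_frontier_of_bdryDist_eq_zero hΩ hn hx.2) fun _ hx =>
    ⟨frontier_subset_closure hx, bdryDist_eq_zero_of_mem_frontier hx⟩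

/-- Moving `ε / 2` further along the inward normal reaches distance `r + ε / 2`, the middle of the
shell. The distance is 1-Lipschitz, so a ball of radius `ε / 2` there does not leave it. -/
lemma exists_ball_subset_shell (hΩ : IsSmoothBoundedDomain Ω) (hn : 1 ≤ n) {δ r ε : ℝ}
    (hδ : IsFermiCollarWidth Ω δ) (hr : 0 ≤ r) (hε : 0 < ε) (hrε : r + ε ≤ δ) {x : Eucl n}
    (hx : x ∈ levelSet Ω r) : ∃ z, dist z x ≤ ε / 2 ∧ ball z (ε / 2) ⊆ shell Ω r ε := by
  obtain ⟨hxc, hxr⟩ := hx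
  obtain ⟨y, ν, hy, hν, hxy⟩ : ∃ y ν, y ∈ frontier Ω ∧ IsInwardUnitNormal Ω y ν ∧
      x = y + r • ν := by
    by_cases hxΩ : x ∈ Ω
    · obtain ⟨y, hy, hxy⟩ := exists_foot hΩ hn x
      obtain ⟨ν, hν⟩ := hΩ.exists_normal hy
      exact ⟨y, ν, hy, hν, hxr ▸ normal_eq_of_foot_of_mem hΩ hxΩ hy hxy hν⟩
    · have hxf : x ∈ frontier Ω := ⟨hxc, by rwa [hΩ.isOpen.interior_eq]⟩
      obtain ⟨ν, hν⟩ := hΩ.exists_normal hxf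
      refine ⟨x, ν, hxf, hν, ?_⟩
      rw [← hxr, bdryDist_eq_zero_of_mem_frontier hxf, zero_smul, add_zero]
  obtain ⟨hzc, hzr⟩ := hδ.normal_segment y hy ν hν (r + ε / 2) ⟨by positivity, by linarith⟩
  set z := y + (r + ε / 2) • ν with hz
  have hzΩ : z ∈ Ω := by
    by_contra hzn
    have hzf : z ∈ frontier Ω := ⟨hzc, by rwa [hΩ.isOpen.interior_eq]⟩
    have := bdryDist_eq_zero_of_mem_frontier hzf
    linarith
  refine ⟨z, ?_, fun w hw => ?_⟩
  · rw [hxy, hz, dist_eq_norm, show y + (r + ε / 2) • ν - (y + r • ν) = (ε / 2) • ν by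
      rw [add_smul]; abel, norm_smul, hν.norm_eq_one, mul_one, Real.norm_of_nonneg (by linarith)]
  · have hwz := mem_ball.1 hw
    have h1 := abs_le.1 (abs_bdryDist_sub_le (Ω := Ω) w z)
    refine ⟨ball_subset_of_mem hzΩ (ball_subset_ball (by linarith) hw), ?_, ?_⟩ <;> linarith

/-- The integral of `g` over a level set of the distance is at most the limit of its averages over
thin shells. -/
lemma lintegral_levelSet_le (hΩ : IsSmoothBoundedDomain Ω) (hn : 1 ≤ n) {δ r : ℝ}
    (hδ : IsFermiCollarWidth Ω δ) (hr : 0 ≤ r) (hrδ : r < δ) {g : Eucl n → ℝ}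
    (hg : ContinuousOn g (closure Ω)) (hg0 : ∀ x, 0 ≤ g x) {A B ε₀ : ℝ} (hε₀ : 0 < ε₀)
    (hA : ∀ ε, 0 < ε → ε ≤ ε₀ → volume.real (shell Ω r ε) ≤ ε * A)
    (hB : ∀ ε, 0 < ε → ε ≤ ε₀ → ∫ x in shell Ω r ε, g x ≤ ε * B) :
    ∫⁻ x in levelSet Ω r, ENNReal.ofReal (g x) ∂(Measure.euclideanHausdorffMeasure (n - 1)) ≤
      shellConst n * ENNReal.ofReal B := by
  have huc := hΩ.isCompact_closure.uniformContinuousOn_of_continuous hg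
  rw [uniformContinuousOn_iff] at huc
  have hex (k : ℕ) : ∃ ε : ℝ, 0 < ε ∧ ε ≤ ε₀ ∧ r + ε ≤ δ ∧ ε ≤ 1 / ((k : ℝ) + 1) ∧
      ∀ x ∈ closure Ω, ∀ y ∈ closure Ω, dist x y < ε → dist (g x) (g y) < 1 / ((k : ℝ) + 1) := by
    obtain ⟨η, hη, hη'⟩ := huc (1 / ((k : ℝ) + 1)) (by positivity)
    refine ⟨min (min ε₀ (δ - r)) (min (1 / ((k : ℝ) + 1)) η), ?_, ?_, ?_, ?_, ?_⟩
    · have : 0 < δ - r := by linarith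
      positivity
    · exact (min_le_left _ _).trans (min_le_left _ _)
    · linarith [(min_le_left (min ε₀ (δ - r)) (min (1 / ((k : ℝ) + 1)) η)).trans
        (min_le_right _ _)]
    · exact (min_le_right _ _).trans (min_le_left _ _)
    · exact fun x hx y hy hxy => hη' x hx y hy
        (hxy.trans_le ((min_le_right _ _).trans (min_le_right _ _)))
  choose ε hε hεε₀ hεδ hεk hosc using hex
  set m : ℕ → ℝ := fun k => 1 / ((k : ℝ) + 1) with hm
  have hm0 : Tendsto m atTop (𝓝 0) := tendsto_one_div_add_atTop_nhds_zero_nat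
  have hmn (k : ℕ) : 0 ≤ m k := by positivity
  have hε0 : Tendsto ε atTop (𝓝 0) :=
    squeeze_zero (fun k => (hε k).le) hεk hm0
  have hsc (k : ℕ) : shell Ω r (ε k) ⊆ closure Ω := (shell_subset _ _).trans subset_closure
  have hsm (k : ℕ) : MeasurableSet (shell Ω r (ε k)) :=
    (isOpen_shell hΩ.isOpen r (ε k)).measurableSet
  refine (lintegral_euclideanHausdorffMeasure_le_liminf hn (isClosed_levelSet r).measurableSet
    (S := fun k => shell Ω r (ε k)) (m := m) hg0 hmn hsm
    (hg.mono inter_subset_left) (fun k => hg.mono (hsc k)) hε hε0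
    (fun k x hx => exists_ball_subset_shell hΩ hn hδ hr (hε k) (hεδ k) hx)
    fun k x hx y hy hyx => ?_).trans ?_
  · have := (abs_lt.1 (hosc k y (hsc k hy) x hx.1 hyx)).1
    linarith
  -- The volume bound `A` serves only to show that the oscillation error contributes `m k * A`,
  -- which tends to zero.
  have hbound (k : ℕ) : (ENNReal.ofReal (ε k))⁻¹ *
      ∫⁻ x in shell Ω r (ε k), ENNReal.ofReal (g x + m k) ≤ ENNReal.ofReal (B + m k * A) := by
    have hfin : volume (shell Ω r (ε k)) ≠ ⊤ :=
      (hΩ.isBounded.subset (shell_subset _ _)).measure_lt_top.ne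
    have hgi : IntegrableOn g (shell Ω r (ε k)) :=
      (hg.integrableOn_compact hΩ.isCompact_closure).mono_set (hsc k)
    have hci : IntegrableOn (fun _ => m k) (shell Ω r (ε k)) := integrableOn_const hfin
    rw [← ofReal_integral_eq_lintegral_ofReal (f := fun x => g x + m k) (hgi.add hci)
      (Eventually.of_forall fun x => add_nonneg (hg0 x) (hmn k)),
      ← ENNReal.ofReal_inv_of_pos (hε k), ← ENNReal.ofReal_mul (inv_nonneg.2 (hε k).le)]
    refine ENNReal.ofReal_le_ofReal ?_
    rw [inv_mul_le_iff₀ (hε k)]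
    rw [integral_add hgi hci, setIntegral_const, smul_eq_mul]
    have h1 := hB (ε k) (hε k) (hεε₀ k)
    have h2 := mul_le_mul_of_nonneg_right (hA (ε k) (hε k) (hεε₀ k)) (hmn k)
    linarith
  have hlim : Tendsto (fun k => shellConst n * ENNReal.ofReal (B + m k * A)) atTop
      (𝓝 (shellConst n * ENNReal.ofReal B)) := by
    refine ENNReal.Tendsto.const_mul ?_ (Or.inr shellConst_ne_top)
    have := (hm0.mul_const A).const_add B
    rw [zero_mul, add_zero] at this
    exact (ENNReal.continuous_ofReal.tendsto _).comp this
  rw [← hlim.liminf_eq]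
  exact liminf_le_liminf (Eventually.of_forall fun k => mul_le_mul_right (hbound k) _)

end LevelSet


/-! ### The estimate on level sets -/

section SurfaceEstimate

variable {n : ℕ} {Ω : Set (Eucl n)}

lemma eLpNorm_two_sq {α : Type*} [MeasurableSpace α] (μ : Measure α) (f : α → ℝ) :
    eLpNorm f 2 μ ^ 2 = ∫⁻ x, ENNReal.ofReal (f x ^ 2) ∂μ := by
  have h := eLpNorm_nnreal_pow_eq_lintegral (μ := μ) (f := f) (p := 2) two_ne_zero
  simp only [NNReal.coe_ofNat, ENNReal.rpow_ofNat] at h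
  rw [show ((2 : NNReal) : ℝ≥0∞) = 2 from rfl] at h
  rw [h]
  refine lintegral_congr fun x => ?_
  rw [Real.enorm_eq_ofReal_abs, ← ENNReal.ofReal_pow (abs_nonneg _), sq_abs]

lemma neumannCondition_const (c : ℝ) : NeumannCondition Ω fun _ => c := by
  intro p _ ν _
  rw [fderivWithin_const_apply]
  rfl

lemma helmholtz_eq (ho : IsOpen Ω) {u : Eucl n → ℝ} (hu : ContDiffOn ℝ 2 u Ω) (h : ℝ)
    {x : Eucl n} (hx : x ∈ Ω) :
    helmholtz h u x = -(h ^ 2 * ∑ i, pd (pd u i) i x) - u x := by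
  rw [helmholtz, posLaplacian, laplacian_eq_sum_pd (hu.contDiffAt (ho.mem_nhds hx)), mul_neg]

lemma ofReal_integral_dataDensity (hΩ : IsSmoothBoundedDomain Ω) {D u f : Eucl n → ℝ} {h : ℝ}
    (hu : IsNeumannRegular Ω D u)
    (hf : ∀ x ∈ Ω, f x = -(h ^ 2 * ∑ i, pd (pd u i) i x) - u x) :
    ENNReal.ofReal (∫ x in Ω, dataDensity u f h x) =
      l2Norm Ω u ^ 2 + ENNReal.ofReal (h⁻¹ ^ 2) * l2Norm Ω f ^ 2 := by
  rw [ofReal_integral_eq_lintegral_ofReal ((hu.isBC_dataDensity hf).integrableOn hΩ)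
    (Eventually.of_forall fun x => by unfold dataDensity; positivity), l2Norm, l2Norm,
    eLpNorm_two_sq, eLpNorm_two_sq, ← lintegral_const_mul' _ _ ENNReal.ofReal_ne_top,
    ← lintegral_add_left'
      ((hu.isBC.pow_two.integrableOn hΩ).aestronglyMeasurable.aemeasurable.ennreal_ofReal)]
  refine lintegral_congr fun x => ?_
  rw [dataDensity, ENNReal.ofReal_add (sq_nonneg _) (by positivity),
    ENNReal.ofReal_mul (sq_nonneg _)]

/-- The constant function one satisfies the Neumann condition, so the shell estimate with `h = 1`
bounds the volumes themselves. -/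
lemma exists_volume_shell_le (hΩ : IsSmoothBoundedDomain Ω) (hn : 1 ≤ n) {δ M : ℝ}
    {D : Eucl n → ℝ} (hD : IsCollarFunction Ω δ M D) :
    ∃ A : ℝ, ∀ r ε : ℝ, 0 ≤ r → r ≤ δ / 2 → 0 < ε → ε ≤ δ / 12 →
      volume.real (shell Ω r ε) ≤ ε * A := by
  obtain ⟨K, -, hK⟩ := exists_integral_shell_le hΩ hn hD
  set f : Eucl n → ℝ := fun x => -((1 ^ 3) ^ 2 * ∑ i, pd (pd (fun _ => 1) i) i x) - 1 with hf
  refine ⟨K * 1⁻¹ ^ 2 * ∫ x in Ω, dataDensity (fun _ => 1) f (1 ^ 3) x,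
    fun r ε hr hrδ hε hεδ => ?_⟩
  have h := hK (fun _ => 1) f 1
    (isNeumannRegular hΩ hD contDiffOn_const (neumannCondition_const 1)) one_pos le_rfl
    (fun _ _ => rfl) r ε hr hrδ hε (by simpa using hεδ)
  rwa [one_pow, setIntegral_const, smul_eq_mul, mul_one] at h

/-- The `h^{-2/3}` bound for the square of the `L²` norm on the level sets of the distance. -/
lemma exists_l2NormSurface_sq_le (hΩ : IsSmoothBoundedDomain Ω) (hn : 1 ≤ n) {δ : ℝ}
    (hδ : IsFermiCollarWidth Ω δ) :
    ∃ C : ℝ, 0 < C ∧ ∀ u : Eucl n → ℝ, ContDiffOn ℝ 2 u (closure Ω) → NeumannCondition Ω u →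
      ∀ h : ℝ, 0 < h → h ≤ 1 → ∀ r ∈ Icc 0 (δ / 3),
        l2NormSurface (levelSet Ω r) u ^ 2 ≤ ENNReal.ofReal (C * h ^ (-(2 / 3) : ℝ)) *
          (l2Norm Ω u ^ 2 + ENNReal.ofReal (h ^ (-2 : ℝ)) * l2Norm Ω (helmholtz h u) ^ 2) := by
  have hδ0 := hδ.pos
  obtain ⟨M, D, hD⟩ := exists_isCollarFunction hΩ hn hδ
  obtain ⟨K, hK0, hK⟩ := exists_integral_shell_le hΩ hn hD
  obtain ⟨A, hA⟩ := exists_volume_shell_le hΩ hn hD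
  have hc : shellConst n ≤ ENNReal.ofReal ((shellConst n).toReal + 1) := by
    rw [ENNReal.le_ofReal_iff_toReal_le shellConst_ne_top (by positivity)]
    linarith
  refine ⟨((shellConst n).toReal + 1) * K, by positivity, fun u hu hN h hh hh1 r hr => ?_⟩
  set k : ℝ := h ^ (1 / 3 : ℝ) with hk
  have hk0 : 0 < k := Real.rpow_pos_of_pos hh _
  have hk1 : k ≤ 1 := Real.rpow_le_one hh.le hh1 (by norm_num)
  have hk3 : k ^ 3 = h := by
    rw [hk, ← Real.rpow_natCast, ← Real.rpow_mul hh.le]; norm_num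
  have hk2 : h ^ (-(2 / 3) : ℝ) = k⁻¹ ^ 2 := by
    rw [hk, ← Real.rpow_neg hh.le, ← Real.rpow_natCast, ← Real.rpow_mul hh.le]; norm_num
  have hh2 : h ^ (-2 : ℝ) = h⁻¹ ^ 2 := by
    rw [Real.rpow_neg hh.le, inv_pow]; norm_num
  have huN := isNeumannRegular hΩ hD hu hN
  have hf : ∀ x ∈ Ω, helmholtz h u x = -((k ^ 3) ^ 2 * ∑ i, pd (pd u i) i x) - u x := by
    intro x hx
    rw [hk3]
    exact helmholtz_eq hΩ.isOpen (hu.mono subset_closure) h hx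
  have hkk : k ^ 2 ≤ 1 := pow_le_one₀ hk0.le hk1
  -- The collar function has width `3 / 4 * δ` and the shell estimate allows half of it; `δ / 3` is
  -- below `3 / 8 * δ`.
  have hrδ : r ≤ 3 / 4 * δ / 2 := by linarith [hr.2]
  have hmain := lintegral_levelSet_le hΩ hn hδ hr.1 (by linarith [hr.2]) (g := fun x => u x ^ 2)
    (hu.continuousOn.pow 2) (fun x => sq_nonneg _) (A := A)
    (B := K * k⁻¹ ^ 2 * ∫ x in Ω, dataDensity u (helmholtz h u) (k ^ 3) x)
    (ε₀ := 3 / 4 * δ * k ^ 2 / 12) (by positivity)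
    (fun ε hε hε' => hA r ε hr.1 hrδ hε (hε'.trans (by nlinarith)))
    (fun ε hε hε' => hK u _ k huN hk0 hk1 hf r ε hr.1 hrδ hε hε')
  rw [l2NormSurface, eLpNorm_two_sq]
  refine hmain.trans ?_
  rw [hk2, hh2, ← hk3, ENNReal.ofReal_mul (by positivity),
    ofReal_integral_dataDensity hΩ huN (hk3 ▸ hf), ← mul_assoc, mul_assoc _ K,
    ENNReal.ofReal_mul (p := (shellConst n).toReal + 1) (by positivity)]
  gcongr

end SurfaceEstimate

end NeumannTrace

/-! ### The main theorem -/

theorem proposition2p2 {n : ℕ} (hn : 1 ≤ n) (Ω : Set (NeumannTrace.Eucl n))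
    (hΩ : NeumannTrace.IsSmoothBoundedDomain Ω) :
    (∃ δ : ℝ, NeumannTrace.IsFermiCollarWidth Ω δ) ∧
    ∀ δ : ℝ, NeumannTrace.IsFermiCollarWidth Ω δ →
      ∃ C : ℝ, 0 < C ∧
        (∀ u : NeumannTrace.Eucl n → ℝ, ContDiffOn ℝ 2 u (closure Ω) →
          NeumannTrace.NeumannCondition Ω u →
          ∀ h : ℝ, 0 < h → h ≤ 1 →
          ∀ G : NeumannTrace.Eucl n → NeumannTrace.Eucl n,
          NeumannTrace.HasWeakGradient Ω (NeumannTrace.helmholtz h u) G →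
          ∀ r ∈ Icc 0 (δ / 3),
            NeumannTrace.l2NormSurface (NeumannTrace.levelSet Ω r) u ^ 2 ≤
              ENNReal.ofReal (C * h ^ (-(2 / 3) : ℝ)) *
                (NeumannTrace.l2Norm Ω u ^ 2 +
                  ENNReal.ofReal (h ^ (-2 : ℝ)) *
                    NeumannTrace.l2Norm Ω (NeumannTrace.helmholtz h u) ^ 2 +
                  NeumannTrace.l2Norm Ω G ^ 2)) ∧
        (∀ h : ℝ, 0 < h → h ≤ 1 →
          ∀ u : NeumannTrace.Eucl n → ℝ,
          NeumannTrace.IsNormalizedNeumannEigenfunction Ω (h ^ (-2 : ℝ)) u →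
            NeumannTrace.l2NormSurface (frontier Ω) u ≤
              ENNReal.ofReal (C * h ^ (-(1 / 3) : ℝ))) := by
  refine ⟨NeumannTrace.exists_isFermiCollarWidth hΩ hn, fun δ hδ => ?_⟩
  obtain ⟨C, hC0, hC⟩ := NeumannTrace.exists_l2NormSurface_sq_le hΩ hn hδ
  -- One constant must serve both the squared estimate and its square root, and `C + 1` does since
  -- `C ≤ (C + 1)²`.
  refine ⟨C + 1, by positivity, fun u hu hN h hh hh1 G _ r hr => ?_, fun h hh hh1 u hu => ?_⟩
  · refine (hC u hu hN h hh hh1 r hr).trans ?_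
    refine mul_le_mul' (ENNReal.ofReal_le_ofReal ?_) le_self_add
    gcongr
    linarith
  · have hδ0 := hδ.pos
    have h0 := hC u hu.contDiffOn hu.neumann h hh hh1 0 ⟨le_rfl, by positivity⟩
    have hf : NeumannTrace.l2Norm Ω (NeumannTrace.helmholtz h u) = 0 := by
      rw [NeumannTrace.l2Norm, eLpNorm_congr_ae (g := 0), eLpNorm_zero]
      filter_upwards [ae_restrict_mem hΩ.isOpen.measurableSet] with x hx
      rw [NeumannTrace.helmholtz, hu.eigen x hx, ← mul_assoc, Real.rpow_neg hh.le,
        Real.rpow_two, mul_inv_cancel₀ (by positivity), one_mul, sub_self, Pi.zero_apply]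
    rw [NeumannTrace.levelSet_zero hΩ hn, hu.normalized, hf, one_pow, zero_pow two_ne_zero,
      mul_zero, add_zero, mul_one] at h0
    refine (ENNReal.pow_le_pow_left_iff two_ne_zero).1 (h0.trans ?_)
    rw [← ENNReal.ofReal_pow (by positivity)]
    refine ENNReal.ofReal_le_ofReal ?_
    have hsq : (h ^ (-(1 / 3) : ℝ)) ^ 2 = h ^ (-(2 / 3) : ℝ) := by
      rw [← Real.rpow_natCast, ← Real.rpow_mul hh.le]; norm_num
    rw [mul_pow, hsq]
    gcongr
    nlinarith
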